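/- Let $R$ be an integral domain and $q\in R$ a unit. For $n\ge 0$ let $\mathcal H_n$ be the $R$-algebra with generators $T_1,\dots,T_{n-1}$ and relations $T_iT_j=T_jT_i$ for $|i-j|>1$, $T_iT_{i+1}T_i=T_{i+1}T_iT_{i+1}$, $(T_i-q)(T_i+q^{-1})=0$; regard $\mathcal H_{n}$ as mapping to $\mathcal H_{n+1}$ by $T_i\mapsto T_i$, let $*$ be the $R$-linear anti-automorphism fixing each $T_i$, and let $T_v=T_{i_1}\cdots T_{i_l}$ for a reduced expression $v=s_{i_1}\cdots s_{i_l}$ in the symmetric group $\mathfrak S_n$, which acts on $\{1,\dots,n\}$ from the right. Let $T_{i,j}=T_iT_{i+1}\cdots T_{j-1}$ for $i\le j$. For a Young diagram $\lambda$ of size $n$, let $\mathfrak t^\lambda$ be the standard $\lambda$-tableau with $1,\dots,n$ entered in order along the rows; for a bijective $\lambda$-tableau $\mathfrak t$ let $w(\mathfrak t)$ be the permutation with $\mathfrak t=\mathfrak t^\lambda w(\mathfrak t)$. Let $m_\lambda=\sum_v q^{\ell(v)}T_v$, summed over the row stabiliser of $\mathfrak t^\lambda$, and, for standard $\lambda$-tableaux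 $\mathfrak s,\mathfrak t$, let $m^\lambda_{\mathfrak s\mathfrak t}=T_{w(\mathfrak s)}^*\,m_\lambda\,T_{w(\mathfrak t)}$. For every $n$ these elements form a cellular basis of $\mathcal H_n$ (the Murphy basis) with respect to $*$ and the dominance order $\unrhd$. Let $\Delta^\lambda$ be the resulting right cell modules, with standard bases $\{m^\lambda_{\mathfrak t}\}$. Then $\Delta^\lambda$ is generated by $m^\lambda_{\mathfrak t^\lambda}$, and the following hold. Write $\mu\to\lambda$ if $\lambda=\mu\cup\alpha$ is obtained from $\mu$ by adding one node $\alpha$; for a $\mu$-tableau $\mathfrak s$ with $n-1$ nodes, $\mathfrak s\cup\alpha$ is the $\lambda$-tableau that agrees with $\mathfrak s$ on $\mu$ and has $n$ in the node $\alpha$. 1. Let $n\ge1$ and let $\lambda$ be a Young diagram of size $n$. There is a filtration $0=N_0\subseteq N_1\subseteq\cdots\subseteq N_p=\operatorname{Res}^{\mathcal H_n}_{\mathcal H_{n-1}}\Delta^\lambda$ by right $\mathcal H_{n-1}$-submodules and there are isomorphisms $N_j/N_{j-1}\cong\Delta^{\mu^{(j)}}$, where $\{\mu^{(1)},\dots,\mu^{(p)}\}=\{\mu:\mu\to\lambda\}$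 and $\mu^{(i)}\rhd\mu^{(j)}$ whenever $i<j$, such that for every $j$ the elements $$d^{(n)}_{\mu\to\lambda}=T_{w(\mathfrak t^\mu\cup\alpha)},\qquad \mu=\mu^{(j)},\quad \lambda=\mu\cup\alpha,$$ are branching coefficients: $m^\lambda_{\mathfrak t^\lambda}\,d^{(n)}_{\mu\to\lambda}\in N_j$, and $m^\lambda_{\mathfrak t^\lambda}\,d^{(n)}_{\mu\to\lambda}+N_{j-1}$ corresponds to $m^\mu_{\mathfrak t^\mu}$ under the isomorphism. 2. If $\mu\to\lambda=\mu\cup\alpha$ with $|\lambda|=n$, and $a(\alpha)$ is the entry of $\mathfrak t^\lambda$ in the node $\alpha$, then $w(\mathfrak t^\mu\cup\alpha)$ is the cycle $(n,n-1,\dots,a(\alpha))$, and $d^{(n)}_{\mu\to\lambda}=T_{(n,n-1,\dots,a(\alpha))}=T_{a(\alpha),n}$. 3. For a standard $\lambda$-tableau $\mathfrak t$, identified with the path $\emptyset=\lambda^{(0)}\to\lambda^{(1)}\to\cdots\to\lambda^{(n)}=\lambda$ in which $\lambda^{(k)}$ consists of the nodes of $\mathfrak t$ with entries at most $k$, put $d_{\mathfrak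 t}=d^{(n)}_{\lambda^{(n-1)}\to\lambda^{(n)}}\cdots d^{(1)}_{\lambda^{(0)}\to\lambda^{(1)}}$. Then $d_{\mathfrak t}=T_{w(\mathfrak t)}$. Consequently $m^\lambda_{\mathfrak t}=m^\lambda_{\mathfrak t^\lambda}\,d_{\mathfrak t}$ and $m^\lambda_{\mathfrak s\mathfrak t}=d_{\mathfrak s}^*\,m_\lambda\,d_{\mathfrak t}$ for all standard $\lambda$-tableaux $\mathfrak s,\mathfrak t$. -/

import Mathlib

open MulOpposite

/-! ## Cellular algebras, cell modules, cell filtrations -/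

section Cellular

/-- The submodule `A^{▷ lam}` spanned by all `c μ s t` with `μ ▷ lam`
(the partial order `⊵` on the index set is written `≥`). -/
def cellAbove (R : Type*) {A L : Type*} {M : L → Type*} [CommRing R] [Ring A] [Algebra R A]
    [PartialOrder L] (c : (lam : L) → M lam → M lam → A) (lam : L) : Submodule R A :=
  Submodule.span R {x | ∃ μ, lam < μ ∧ ∃ s t : M μ, x = c μ s t}

/-- `(A, star, L, ≥, c)` is a cell datum. -/
structure IsCellDatum (R : Type*) {A L : Type*} {M : L → Type*} [CommRing R] [Ring A] [Algebra R A]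
    [PartialOrder L] [∀ lam, Fintype (M lam)] (star : A →ₗ[R] A)
    (c : (lam : L) → M lam → M lam → A) : Prop where
  star_mul : ∀ x y, star (x * y) = star y * star x
  star_star : ∀ x, star (star x) = x
  finite_index : Finite L
  linearIndependent : LinearIndependent R
    (fun i : (Σ lam : L, M lam × M lam) => c i.1 i.2.1 i.2.2)
  span_eq_top : Submodule.span R
    (Set.range (fun i : (Σ lam : L, M lam × M lam) => c i.1 i.2.1 i.2.2)) = ⊤
  mul_right : ∀ (lam : L) (t : M lam) (a : A), ∃ r : M lam → R, ∀ s : M lam,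
    c lam s t * a - ∑ v, r v • c lam s v ∈ cellAbove R c lam
  star_basis : ∀ (lam : L) (s t : M lam), star (c lam s t) - c lam t s ∈ cellAbove R c lam

variable {R A L : Type*} {M : L → Type*} [CommRing R] [Ring A] [Algebra R A]
    [PartialOrder L] [∀ lam, Fintype (M lam)] {star : A →ₗ[R] A}
    {c : (lam : L) → M lam → M lam → A}

namespace IsCellDatum

theorem sum_injective (h : IsCellDatum R star c) {lam : L} (s : M lam) {f g : M lam → R}
    (hfg : ∑ v, f v • c lam s v - ∑ v, g v • c lam s v ∈ cellAbove R c lam) : f = g := by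
  classical
  let F : (Σ lam : L, M lam × M lam) → A := fun i => c i.1 i.2.1 i.2.2
  let e : M lam → (Σ lam : L, M lam × M lam) := fun v => ⟨lam, s, v⟩
  have he : Function.Injective e := by
    intro a b hab
    simpa [e] using hab
  have hd := h.linearIndependent.disjoint_span_image
    (s := Set.range e) (t := {i | lam < i.1}) (by
      rw [Set.disjoint_left]
      rintro _ ⟨v, rfl⟩ hv
      exact lt_irrefl _ hv)
  rw [← Finset.sum_sub_distrib] at hfg
  simp_rw [← sub_smul] at hfg
  have hz : ∑ v, (f v - g v) • c lam s v = 0 := by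
    refine Submodule.disjoint_def.1 hd _ ?_ ?_
    · refine Submodule.sum_mem _ fun v _ => Submodule.smul_mem _ _ (Submodule.subset_span ?_)
      exact ⟨e v, ⟨v, rfl⟩, rfl⟩
    · refine Submodule.span_mono ?_ hfg
      rintro _ ⟨μ, hμ, s', t', rfl⟩
      exact ⟨⟨μ, s', t'⟩, hμ, rfl⟩
  have hli : LinearIndependent R (fun v => c lam s v) := h.linearIndependent.comp e he
  have := Fintype.linearIndependent_iff.1 hli _ hz
  funext v
  exact sub_eq_zero.1 (this v)

theorem cellAbove_mul_mem (h : IsCellDatum R star c) (lam : L) {x : A}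
    (hx : x ∈ cellAbove R c lam) (a : A) : x * a ∈ cellAbove R c lam := by
  induction hx using Submodule.span_induction with
  | mem x hx =>
    obtain ⟨μ, hμ, s, t, rfl⟩ := hx
    obtain ⟨r, hr⟩ := h.mul_right μ t a
    have h1 : cellAbove R c μ ≤ cellAbove R c lam := by
      refine Submodule.span_mono ?_
      rintro _ ⟨ν, hν, s', t', rfl⟩
      exact ⟨ν, hμ.trans hν, s', t', rfl⟩
    have h2 : ∑ v, r v • c μ s v ∈ cellAbove R c lam :=
      Submodule.sum_mem _ fun v _ => Submodule.smul_mem _ _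
        (Submodule.subset_span ⟨μ, hμ, s, v, rfl⟩)
    simpa using Submodule.add_mem _ (h1 (hr s)) h2
  | zero => simp
  | add x y _ _ hx hy => rw [add_mul]; exact Submodule.add_mem _ hx hy
  | smul r x _ hx => rw [smul_mul_assoc]; exact Submodule.smul_mem _ _ hx

/-- The coefficients `r_v(t, a)`. -/
noncomputable def coeff (h : IsCellDatum R star c) (lam : L) (t : M lam) (a : A) : M lam → R :=
  (h.mul_right lam t a).choose

theorem coeff_spec (h : IsCellDatum R star c) (lam : L) (t : M lam) (a : A) (s : M lam) :
    c lam s t * a - ∑ v, h.coeff lam t a v • c lam s v ∈ cellAbove R c lam :=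
  (h.mul_right lam t a).choose_spec s

theorem coeff_eq (h : IsCellDatum R star c) (lam : L) (t : M lam) (a : A) (f : M lam → R)
    (hf : c lam t t * a - ∑ v, f v • c lam t v ∈ cellAbove R c lam) :
    h.coeff lam t a = f := by
  refine h.sum_injective t ?_
  have := Submodule.sub_mem _ hf (h.coeff_spec lam t a t)
  simpa using this

end IsCellDatum

/-- The cell module: free over `R` with basis indexed by `M lam`. -/
def CellModule (_h : IsCellDatum R star c) (lam : L) : Type _ := M lam → R

namespace CellModule

variable (h : IsCellDatum R star c) (lam : L)

instance : AddCommGroup (CellModule h lam) := inferInstanceAs (AddCommGroup (M lam → R))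

instance : Module R (CellModule h lam) := inferInstanceAs (Module R (M lam → R))

/-- The standard basis of the cell module. -/
noncomputable def basis : Module.Basis (M lam) R (CellModule h lam) := Pi.basisFun R (M lam)

/-- The right action `c_t a = ∑ v, r_v(t, a) c_v`, extended linearly in `c_t`. -/
noncomputable instance : Module Aᵐᵒᵖ (CellModule h lam) where
  smul a x := fun v => ∑ t : M lam, x t * h.coeff lam t (unop a) v
  smul_zero a := by
    funext v
    change ∑ t : M lam, (0 : R) * h.coeff lam t (unop a) v = 0
    simp
  smul_add a x y := by
    funext v
    change ∑ t : M lam, (x t + y t) * h.coeff lam t (unop a) v =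
      (∑ t : M lam, x t * _) + ∑ t : M lam, y t * _
    simp [add_mul, Finset.sum_add_distrib]
  zero_smul x := by
    funext v
    change ∑ t : M lam, x t * h.coeff lam t 0 v = 0
    refine Finset.sum_eq_zero fun t _ => ?_
    rw [h.coeff_eq lam t 0 0 (by simp)]
    simp
  add_smul a b x := by
    funext v
    change ∑ t : M lam, x t * h.coeff lam t (unop a + unop b) v =
      (∑ t : M lam, x t * _) + ∑ t : M lam, x t * _
    rw [← Finset.sum_add_distrib]
    refine Finset.sum_congr rfl fun t _ => ?_
    rw [h.coeff_eq lam t (unop a + unop b) (h.coeff lam t (unop a) + h.coeff lam t (unop b)),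
      Pi.add_apply, mul_add]
    have := Submodule.add_mem _ (h.coeff_spec lam t (unop a) t) (h.coeff_spec lam t (unop b) t)
    simp only [Pi.add_apply, add_smul, Finset.sum_add_distrib, mul_add]
    convert this using 1
    abel
  one_smul x := by
    classical
    funext v
    change ∑ t : M lam, x t * h.coeff lam t 1 v = x v
    have : ∀ t, h.coeff lam t 1 = Pi.single t 1 := fun t =>
      h.coeff_eq lam t 1 _ (by simp [Pi.single_apply])
    simp only [this, Pi.single_apply, mul_ite, mul_one, mul_zero]
    exact (Finset.sum_ite_eq Finset.univ v x).trans (if_pos (Finset.mem_univ v))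
  mul_smul a b x := by
    funext v
    change ∑ t : M lam, x t * h.coeff lam t (unop b * unop a) v =
      ∑ u : M lam, (∑ t : M lam, x t * h.coeff lam t (unop b) u) * h.coeff lam u (unop a) v
    have : ∀ t, h.coeff lam t (unop b * unop a) =
        fun v => ∑ u, h.coeff lam t (unop b) u * h.coeff lam u (unop a) v := by
      intro t
      refine h.coeff_eq lam t _ _ ?_
      have h1 := h.cellAbove_mul_mem lam (h.coeff_spec lam t (unop b) t) (unop a)
      have h2 : ∑ u, h.coeff lam t (unop b) u •
          (c lam t u * unop a - ∑ v, h.coeff lam u (unop a) v • c lam t v) ∈ cellAbove R c lam :=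
        Submodule.sum_mem _ fun u _ => Submodule.smul_mem _ _ (h.coeff_spec lam u (unop a) t)
      have h3 := Submodule.add_mem _ h1 h2
      convert h3 using 1
      simp only [sub_mul, Finset.sum_mul, smul_mul_assoc, mul_assoc, smul_sub,
        Finset.sum_sub_distrib, Finset.smul_sum, smul_smul, Finset.sum_smul]
      rw [Finset.sum_comm]
      abel
    simp only [this, Finset.mul_sum, Finset.sum_mul, mul_assoc]
    rw [Finset.sum_comm]

end CellModule

/-- The restriction of a right module along an algebra homomorphism. -/
def ResModule {B : Type*} [Ring B] [Algebra R B] (_f : A →ₐ[R] B) (V : Type*) : Type _ := V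

namespace ResModule

variable {B : Type*} [Ring B] [Algebra R B] (f : A →ₐ[R] B) (V : Type*) [AddCommGroup V]

instance : AddCommGroup (ResModule f V) := inferInstanceAs (AddCommGroup V)

instance [Module Bᵐᵒᵖ V] : Module Aᵐᵒᵖ (ResModule f V) :=
  Module.compHom V (RingHom.op (f : A →+* B))

/-- The identity map from a module to its restriction. -/
def of : V ≃+ ResModule f V := AddEquiv.refl V

end ResModule

/-- A cell filtration `0 = N 0 ⊆ N 1 ⊆ ⋯ ⊆ N r = V` of a right `A`-module `V`, with
isomorphisms from the subquotients to cell modules. -/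
structure CellFiltration (h : IsCellDatum R star c) (V : Type*) [AddCommGroup V]
    [Module Aᵐᵒᵖ V] where
  len : ℕ
  label : Fin len → L
  N : Fin (len + 1) → Submodule Aᵐᵒᵖ V
  N_zero : N 0 = ⊥
  N_last : N (Fin.last len) = ⊤
  N_le : ∀ j : Fin len, N j.castSucc ≤ N j.succ
  iso : ∀ j : Fin len,
    (N j.succ ⧸ (N j.castSucc).submoduleOf (N j.succ)) ≃ₗ[Aᵐᵒᵖ] CellModule h (label j)

namespace CellFiltration

/-- The filtration is order preserving. -/
def OrderPreserving {h : IsCellDatum R star c} {V : Type*} [AddCommGroup V] [Module Aᵐᵒᵖ V]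
    (F : CellFiltration h V) : Prop :=
  ∀ i j : Fin F.len, i < j → F.label j < F.label i

/-- Given a cell filtration of the restriction to `A` of a right `B`-module `V` with generator
`x`, and a generator `y` of the cell module of `A` that labels the `j`-th subquotient:
`d ∈ B` is a branching coefficient, i.e. `x d` lies in `N (j + 1)` and
`x d + N j ↦ y` under the isomorphism of the `j`-th subquotient with the cell module. -/
def IsBranchingCoeff {h : IsCellDatum R star c} {B : Type*} [Ring B] [Algebra R B]
    {f : A →ₐ[R] B} {V : Type*} [AddCommGroup V] [Module Bᵐᵒᵖ V]
    (F : CellFiltration h (ResModule f V)) (j : Fin F.len) (x : V)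
    (y : CellModule h (F.label j)) (d : B) : Prop :=
  ∃ hx : ResModule.of f V (op d • x) ∈ F.N j.succ,
    F.iso j (Submodule.Quotient.mk ⟨ResModule.of f V (op d • x), hx⟩) = y

end CellFiltration

end Cellular

/-! ## Young diagrams and tableaux

Rows, columns and entries are numbered from `0`: the entries of a tableau with `n` nodes
are the elements `0, …, n - 1` of `Fin n`. -/

/-- Young diagrams with `n` nodes. -/
@[ext]
structure Shape (n : ℕ) where
  diagram : YoungDiagram
  card_eq : diagram.card = n

namespace Shape

variable {n : ℕ}

/-- The nodes of a Young diagram, as pairs (row, column). -/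
abbrev Node (lam : Shape n) : Type := {p : ℕ × ℕ // p ∈ lam.diagram.cells}

theorem card_node (lam : Shape n) : Fintype.card lam.Node = n := by
  simpa using lam.card_eq

/-- The number of nodes in the rows above row `i`. -/
def rowStart (lam : Shape n) (i : ℕ) : ℕ := ∑ r ∈ Finset.range i, lam.diagram.rowLen r

theorem rowStart_succ (lam : Shape n) (i : ℕ) :
    lam.rowStart (i + 1) = lam.rowStart i + lam.diagram.rowLen i :=
  Finset.sum_range_succ _ _

theorem rowStart_mono (lam : Shape n) : Monotone lam.rowStart :=
  monotone_nat_of_le_succ fun i => by rw [rowStart_succ]; omega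

theorem ext_rowStart {lam μ : Shape n} (h : ∀ i, lam.rowStart i = μ.rowStart i) : lam = μ := by
  have h2 : ∀ i, lam.diagram.rowLen i = μ.diagram.rowLen i := by
    intro i
    have := h (i + 1)
    rw [rowStart_succ, rowStart_succ, h i] at this
    omega
  ext ⟨i, j⟩
  simp only [YoungDiagram.mem_cells, YoungDiagram.mem_iff_lt_rowLen, h2]

/-- Dominance order: `lam ≤ μ` means that `μ` dominates `lam`. -/
instance : PartialOrder (Shape n) where
  le lam μ := ∀ j, lam.rowStart j ≤ μ.rowStart j
  le_refl _ _ := le_rfl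
  le_trans _ _ _ h1 h2 j := (h1 j).trans (h2 j)
  le_antisymm _ _ h1 h2 := ext_rowStart fun j => le_antisymm (h1 j) (h2 j)

theorem rowStart_le (lam : Shape n) (i : ℕ) : lam.rowStart i ≤ n := by
  classical
  have h1 : lam.rowStart i = ((Finset.range i).biUnion lam.diagram.row).card := by
    rw [Finset.card_biUnion]
    · exact Finset.sum_congr rfl fun r _ => lam.diagram.rowLen_eq_card
    · intro a _ b _ hab
      refine Finset.disjoint_left.2 fun p hp hq => hab ?_
      rw [YoungDiagram.mem_row_iff] at hp hq
      exact hp.2.symm.trans hq.2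
  rw [h1]
  refine (Finset.card_le_card ?_).trans lam.card_eq.le
  intro p hp
  obtain ⟨r, _, hr⟩ := Finset.mem_biUnion.1 hp
  exact (YoungDiagram.mem_row_iff.1 hr).1

/-- `μ → lam` in Young's lattice: `lam` is obtained from `μ` by adding a node. -/
def Edge (μ : Shape n) (lam : Shape (n + 1)) : Prop :=
  ∃ α, α ∉ μ.diagram.cells ∧ lam.diagram.cells = insert α μ.diagram.cells

end Shape

/-- Injective tableaux of shape `lam`. -/
abbrev Tableau {n : ℕ} (lam : Shape n) : Type := lam.Node ≃ Fin n

namespace Tableau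

variable {n : ℕ}

/-- An injective filling of the `n` nodes by elements of `Fin n`, as a tableau. -/
noncomputable def ofInjective {lam : Shape n} (f : lam.Node → Fin n) (hf : Function.Injective f) :
    Tableau lam :=
  Equiv.ofBijective f ((Fintype.bijective_iff_injective_and_card f).2
    ⟨hf, by rw [lam.card_node, Fintype.card_fin]⟩)

theorem entry_lt {lam : Shape n} (p : lam.Node) :
    lam.rowStart p.1.1 + p.1.2 < lam.rowStart (p.1.1 + 1) := by
  have : p.1.2 < lam.diagram.rowLen p.1.1 := YoungDiagram.mem_iff_lt_rowLen.1 p.2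
  rw [Shape.rowStart_succ]
  omega

theorem entry_lt_of_row_lt {lam : Shape n} {p p' : lam.Node} (h : p.1.1 < p'.1.1) :
    lam.rowStart p.1.1 + p.1.2 < lam.rowStart p'.1.1 + p'.1.2 :=
  (entry_lt p).trans_le (le_trans (lam.rowStart_mono h) (Nat.le_add_right _ _))

/-- The tableau `t^lam`, with the entries in increasing order from left to right along the
rows, from top to bottom. -/
noncomputable def initial (lam : Shape n) : Tableau lam :=
  ofInjective
    (fun p => ⟨lam.rowStart p.1.1 + p.1.2, (entry_lt p).trans_le (lam.rowStart_le _)⟩) (by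
      intro p p' hp
      have hp' : lam.rowStart p.1.1 + p.1.2 = lam.rowStart p'.1.1 + p'.1.2 := by
        simpa using hp
      rcases lt_trichotomy p.1.1 p'.1.1 with h | h | h
      · exact absurd hp' (entry_lt_of_row_lt h).ne
      · rw [h] at hp'
        exact Subtype.ext (Prod.ext h (by omega))
      · exact absurd hp' (entry_lt_of_row_lt h).ne')

/-- The permutation `w(t)` with `t = t^lam w(t)`. Permutations act on entries on the right:
the entry of `t` in a node is the image under `w(t)` of the entry of `t^lam` in it. -/
noncomputable def perm {lam : Shape n} (t : Tableau lam) : Equiv.Perm (Fin n) :=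
  (initial lam).symm.trans t

/-- A tableau is standard if its entries increase strictly along rows and along columns. -/
def IsStandard {lam : Shape n} (t : Tableau lam) : Prop :=
  (∀ p p' : lam.Node, p.1.1 = p'.1.1 → p.1.2 < p'.1.2 → t p < t p') ∧
  (∀ p p' : lam.Node, p.1.2 = p'.1.2 → p.1.1 < p'.1.1 → t p < t p')

theorem initial_isStandard (lam : Shape n) : (initial lam).IsStandard := by
  constructor
  · intro p p' h h'
    change lam.rowStart p.1.1 + p.1.2 < lam.rowStart p'.1.1 + p'.1.2
    rw [h]
    omega
  · intro p p' _ h'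
    exact entry_lt_of_row_lt h'

theorem IsStandard.le {lam : Shape n} {t : Tableau lam} (ht : t.IsStandard) {p p' : lam.Node}
    (h : p.1 ≤ p'.1) : t p ≤ t p' := by
  have hm : (p.1.1, p'.1.2) ∈ lam.diagram.cells :=
    lam.diagram.up_left_mem h.1 le_rfl p'.2
  have h1 : t p ≤ t ⟨_, hm⟩ := by
    rcases h.2.lt_or_eq with h2 | h2
    · exact (ht.1 p ⟨_, hm⟩ rfl h2).le
    · exact (congrArg t (show p = ⟨_, hm⟩ from Subtype.ext (Prod.ext rfl h2))).le
  have h3 : t ⟨_, hm⟩ ≤ t p' := by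
    rcases h.1.lt_or_eq with h2 | h2
    · exact (ht.2 ⟨_, hm⟩ p' rfl h2).le
    · exact (congrArg t (show (⟨_, hm⟩ : lam.Node) = p' from Subtype.ext (Prod.ext h2 rfl))).le
  exact h1.trans h3

/-- The tableau `s ∪ α` of shape `lam`, where `lam = μ ∪ α`: it agrees with `s` on the nodes
of `μ`, and has the largest entry in the node `α`. -/
noncomputable def adjoin {μ : Shape n} {lam : Shape (n + 1)} (s : Tableau μ)
    (h : μ.Edge lam) : Tableau lam :=
  ofInjective
    (fun p => if hp : p.1 ∈ μ.diagram.cells then (s ⟨p.1, hp⟩).castSucc else Fin.last n) (by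
      obtain ⟨α, hα, hlam⟩ := h
      intro p p' hpp
      have hout : ∀ p : lam.Node, p.1 ∉ μ.diagram.cells → p.1 = α := by
        intro p hp
        have h1 : p.1 ∈ insert α μ.diagram.cells := hlam ▸ p.2
        exact (Finset.mem_insert.1 h1).resolve_right hp
      by_cases hp : p.1 ∈ μ.diagram.cells <;> by_cases hp' : p'.1 ∈ μ.diagram.cells
      · simp only [hp, hp', dite_true] at hpp
        have := s.injective (Fin.castSucc_injective _ hpp)
        exact Subtype.ext (by simpa using this)
      · simp only [hp, hp', dite_true, dite_false] at hpp
        exact absurd hpp (Fin.castSucc_lt_last _).ne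
      · simp only [hp, hp', dite_true, dite_false] at hpp
        exact absurd hpp (Fin.castSucc_lt_last _).ne'
      · exact Subtype.ext ((hout p hp).trans (hout p' hp').symm))

end Tableau

/-- Standard tableaux of shape `lam`. -/
abbrev StdTableau {n : ℕ} (lam : Shape n) : Type := {t : Tableau lam // t.IsStandard}

namespace StdTableau

variable {n : ℕ}

noncomputable instance (lam : Shape n) : Fintype (StdTableau lam) := Fintype.ofFinite _

/-- The tableau `t^lam` as a standard tableau. -/
noncomputable def initial (lam : Shape n) : StdTableau lam :=
  ⟨Tableau.initial lam, Tableau.initial_isStandard lam⟩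

/-- The Young diagram obtained by removing from the shape of `t` the node that contains the
largest entry. -/
def prevShape {lam : Shape (n + 1)} (t : StdTableau lam) : Shape n where
  diagram :=
    { cells := lam.diagram.cells.erase (t.1.symm (Fin.last n)).1
      isLowerSet := by
        intro a b hba ha
        rw [Finset.mem_coe, Finset.mem_erase] at ha ⊢
        have hb : b ∈ lam.diagram.cells := lam.diagram.isLowerSet hba ha.2
        refine ⟨?_, hb⟩
        intro hb'
        have h1 := t.2.le (p := ⟨b, hb⟩) (p' := ⟨a, ha.2⟩) hba
        have h2 : (⟨b, hb⟩ : lam.Node) = t.1.symm (Fin.last n) := Subtype.ext hb'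
        rw [h2, Equiv.apply_symm_apply] at h1
        have h3 := Fin.last_le_iff.1 h1
        exact ha.1 (by rw [← h3, Equiv.symm_apply_apply]) }
  card_eq := by
    change (lam.diagram.cells.erase _).card = n
    rw [Finset.card_erase_of_mem (t.1.symm (Fin.last n)).2]
    have : lam.diagram.cells.card = n + 1 := lam.card_eq
    omega

theorem prevShape_edge {lam : Shape (n + 1)} (t : StdTableau lam) : t.prevShape.Edge lam :=
  ⟨(t.1.symm (Fin.last n)).1, Finset.notMem_erase _ _,
    (Finset.insert_erase (t.1.symm (Fin.last n)).2).symm⟩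

/-- The standard tableau `t'` obtained from `t` by removing the node with the largest entry. -/
noncomputable def prev {lam : Shape (n + 1)} (t : StdTableau lam) : StdTableau t.prevShape :=
  ⟨Tableau.ofInjective
    (fun p => (t.1 ⟨p.1, (Finset.mem_erase.1 p.2).2⟩).castPred (by
      intro h
      refine (Finset.mem_erase.1 p.2).1 ?_
      rw [← h, Equiv.symm_apply_apply])) (by
      intro p p' hpp
      have := t.1.injective (Fin.castPred_inj.1 hpp)
      exact Subtype.ext (by simpa using this)),
    ⟨fun p p' h h' => t.2.1 ⟨p.1, _⟩ ⟨p'.1, _⟩ h h',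
     fun p p' h h' => t.2.2 ⟨p.1, _⟩ ⟨p'.1, _⟩ h h'⟩⟩

end StdTableau

/-- The Young subgroup: the row stabiliser of `t^lam`. -/
noncomputable def youngSubgroup {n : ℕ} (lam : Shape n) : Subgroup (Equiv.Perm (Fin n)) where
  carrier := {w | ∀ k, ((Tableau.initial lam).symm (w k)).1.1 =
    ((Tableau.initial lam).symm k).1.1}
  one_mem' _ := rfl
  mul_mem' {a b} ha hb k := (ha (b k)).trans (hb k)
  inv_mem' {a} ha k := by
    have := ha (a⁻¹ k)
    rw [show a (a⁻¹ k) = k from Equiv.apply_symm_apply a k] at this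
    exact this.symm

/-! ## Reduced expressions

The simple transposition `s_i` exchanges `i` and `i + 1`, for `i = 0, …, n - 2`. -/

section Reduced

variable {n : ℕ}

/-- The simple transposition `(i, i + 1)`. -/
def simpleSwap (i : Fin (n - 1)) : Equiv.Perm (Fin n) :=
  Equiv.swap ⟨i.1, by omega⟩ ⟨i.1 + 1, by omega⟩

/-- `l = [i_1, …, i_k]` is an expression `w = s_{i_1} ⋯ s_{i_k}` for permutations acting on the
right, so that `s_{i_1}` is applied first. As multiplication in `Equiv.Perm` is composition of
maps written on the left, the factors are multiplied in the reverse order. -/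
def IsExpression (l : List (Fin (n - 1))) (w : Equiv.Perm (Fin n)) : Prop :=
  (l.map simpleSwap).reverse.prod = w

/-- `l` is a reduced expression of `w`. -/
def IsReducedExpression (l : List (Fin (n - 1))) (w : Equiv.Perm (Fin n)) : Prop :=
  IsExpression l w ∧ ∀ l', IsExpression l' w → l.length ≤ l'.length

theorem exists_expression (w : Equiv.Perm (Fin n)) : ∃ l, IsExpression l w := by
  cases n with
  | zero => exact ⟨[], Subsingleton.elim _ _⟩
  | succ m =>
    have hw : w ∈ Submonoid.closure
        (Set.range fun i : Fin m => Equiv.swap i.castSucc i.succ) := by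
      rw [Equiv.Perm.mclosure_swap_castSucc_succ]
      exact Submonoid.mem_top _
    induction hw using Submonoid.closure_induction with
    | mem x hx =>
      obtain ⟨i, rfl⟩ := hx
      exact ⟨[i], by simp [IsExpression, simpleSwap]; rfl⟩
    | one => exact ⟨[], rfl⟩
    | mul x y _ _ hx hy =>
      obtain ⟨l, hl⟩ := hx
      obtain ⟨l', hl'⟩ := hy
      refine ⟨l' ++ l, ?_⟩
      unfold IsExpression at *
      rw [List.map_append, List.reverse_append, List.prod_append, hl, hl']

theorem exists_reduced (w : Equiv.Perm (Fin n)) : ∃ l, IsReducedExpression l w := by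
  obtain ⟨l, hl, hmin⟩ := exists_minimal_of_wellFoundedLT (α := ℕ)
    (fun k => ∃ l : List (Fin (n - 1)), IsExpression l w ∧ l.length = k)
    ⟨_, _, (exists_expression w).choose_spec, rfl⟩
  obtain ⟨l, hl, rfl⟩ := hl
  refine ⟨l, hl, fun l' hl' => ?_⟩
  by_contra hlt
  rw [not_le] at hlt
  exact absurd (hmin ⟨l', hl', rfl⟩ hlt.le) (not_le.2 hlt)

/-- A reduced expression of `w`. -/
noncomputable def reducedWord (w : Equiv.Perm (Fin n)) : List (Fin (n - 1)) :=
  (exists_reduced w).choose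

/-- The length of a permutation. -/
noncomputable def permLength (w : Equiv.Perm (Fin n)) : ℕ := (reducedWord w).length

/-- The descending cycle `(n - 1, n - 2, …, a)`, sending `k` to `k - 1` for `k > a` and `a` to the
largest element `n - 1` of `Fin n`. -/
def descendingCycle (a : Fin n) : Equiv.Perm (Fin n) :=
  ((List.finRange n).filter (a ≤ ·)).reverse.formPerm

end Reduced

/-! ## Hecke algebras -/

/-- The defining relations of the Iwahori-Hecke algebra of the symmetric group on `n` letters,
with parameter `q`. -/
inductive HeckeRel (R : Type*) [CommRing R] (q : Rˣ) (n : ℕ) :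
    FreeAlgebra R (Fin (n - 1)) → FreeAlgebra R (Fin (n - 1)) → Prop
  | comm (i j : Fin (n - 1)) (h : i.1 + 1 < j.1 ∨ j.1 + 1 < i.1) :
      HeckeRel R q n (FreeAlgebra.ι R i * FreeAlgebra.ι R j)
        (FreeAlgebra.ι R j * FreeAlgebra.ι R i)
  | braid (i j : Fin (n - 1)) (h : i.1 + 1 = j.1) :
      HeckeRel R q n (FreeAlgebra.ι R i * FreeAlgebra.ι R j * FreeAlgebra.ι R i)
        (FreeAlgebra.ι R j * FreeAlgebra.ι R i * FreeAlgebra.ι R j)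
  | quad (i : Fin (n - 1)) :
      HeckeRel R q n ((FreeAlgebra.ι R i - algebraMap R _ (q : R)) *
        (FreeAlgebra.ι R i + algebraMap R _ ((q⁻¹ : Rˣ) : R))) 0

/-- The Iwahori-Hecke algebra of the symmetric group on `n` letters. -/
def Hecke (R : Type*) [CommRing R] (q : Rˣ) (n : ℕ) : Type _ := RingQuot (HeckeRel R q n)

namespace Hecke

variable {R : Type*} [CommRing R] {q : Rˣ} {n : ℕ}

instance : Ring (Hecke R q n) := inferInstanceAs (Ring (RingQuot (HeckeRel R q n)))

instance : Algebra R (Hecke R q n) :=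
  inferInstanceAs (Algebra R (RingQuot (HeckeRel R q n)))

/-- The generators `T_i`. -/
def gen (i : Fin (n - 1)) : Hecke R q n :=
  RingQuot.mkAlgHom R (HeckeRel R q n) (FreeAlgebra.ι R i)

theorem gen_comm (i j : Fin (n - 1)) (h : i.1 + 1 < j.1 ∨ j.1 + 1 < i.1) :
    (gen i * gen j : Hecke R q n) = gen j * gen i := by
  have := RingQuot.mkAlgHom_rel R (HeckeRel.comm (R := R) (q := q) i j h)
  rw [map_mul, map_mul] at this
  exact this

theorem gen_braid (i j : Fin (n - 1)) (h : i.1 + 1 = j.1) :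
    (gen i * gen j * gen i : Hecke R q n) = gen j * gen i * gen j := by
  have := RingQuot.mkAlgHom_rel R (HeckeRel.braid (R := R) (q := q) i j h)
  rw [map_mul, map_mul, map_mul, map_mul] at this
  exact this

theorem gen_quad (i : Fin (n - 1)) :
    ((gen i - algebraMap R _ (q : R)) * (gen i + algebraMap R _ ((q⁻¹ : Rˣ) : R)) :
      Hecke R q n) = 0 := by
  have := RingQuot.mkAlgHom_rel R (HeckeRel.quad (R := R) (q := q) i)
  rw [map_mul, map_sub, map_add, AlgHom.commutes, AlgHom.commutes, map_zero] at this
  exact this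

/-- The universal property of the presentation. -/
def lift {B : Type*} [Ring B] [Algebra R B] (g : Fin (n - 1) → B)
    (hcomm : ∀ i j : Fin (n - 1), i.1 + 1 < j.1 ∨ j.1 + 1 < i.1 → g i * g j = g j * g i)
    (hbraid : ∀ i j : Fin (n - 1), i.1 + 1 = j.1 → g i * g j * g i = g j * g i * g j)
    (hquad : ∀ i, (g i - algebraMap R B (q : R)) * (g i + algebraMap R B ((q⁻¹ : Rˣ) : R)) = 0) :
    Hecke R q n →ₐ[R] B :=
  RingQuot.liftAlgHom R ⟨FreeAlgebra.lift R g, by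
    intro x y hxy
    cases hxy with
    | comm i j h => simpa using hcomm i j h
    | braid i j h => simpa using hbraid i j h
    | quad i => simpa using hquad i⟩

theorem lift_gen {B : Type*} [Ring B] [Algebra R B] (g : Fin (n - 1) → B)
    (hcomm : ∀ i j : Fin (n - 1), i.1 + 1 < j.1 ∨ j.1 + 1 < i.1 → g i * g j = g j * g i)
    (hbraid : ∀ i j : Fin (n - 1), i.1 + 1 = j.1 → g i * g j * g i = g j * g i * g j)
    (hquad : ∀ i, (g i - algebraMap R B (q : R)) * (g i + algebraMap R B ((q⁻¹ : Rˣ) : R)) = 0)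
    (i : Fin (n - 1)) : lift (q := q) g hcomm hbraid hquad (gen i) = g i := by
  unfold lift gen
  erw [RingQuot.liftAlgHom_mkAlgHom_apply]
  exact FreeAlgebra.lift_ι_apply g i

/-- The inclusion of the Hecke algebra on `n` letters in the one on `n + 1` letters, `T_i ↦ T_i`. -/
def incl (n : ℕ) : Hecke R q n →ₐ[R] Hecke R q (n + 1) :=
  lift (fun i => gen (i.castLE (by omega)))
    (fun i j h => gen_comm _ _ (by simpa using h))
    (fun i j h => gen_braid _ _ (by simpa using h))
    (fun i => gen_quad _)

/-- The algebra homomorphism to the opposite algebra that fixes the generators. -/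
def starHom : Hecke R q n →ₐ[R] (Hecke R q n)ᵐᵒᵖ :=
  lift (fun i => op (gen i))
    (fun i j h => congrArg op (gen_comm j i h.symm))
    (fun i j h => congrArg op (by
      have := gen_braid (R := R) (q := q) i j h
      simpa [mul_assoc] using this))
    (fun i => congrArg op (by
      have := gen_quad (R := R) (q := q) i
      rw [sub_mul, mul_add, mul_add, Algebra.commutes (q : R) (gen i)] at this
      change (gen i + algebraMap R _ ((q⁻¹ : Rˣ) : R)) * (gen i - algebraMap R _ (q : R)) = 0
      rw [mul_sub, add_mul, add_mul, Algebra.commutes ((q⁻¹ : Rˣ) : R) (gen i),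
        Algebra.commutes ((q⁻¹ : Rˣ) : R) (algebraMap R _ (q : R))]
      rw [← this]))

/-- The involution `*`, the `R`-linear anti-automorphism that fixes the generators; it sends
`T_v` to the element attached to the inverse of `v`. -/
def star : Hecke R q n →ₗ[R] Hecke R q n :=
  (opLinearEquiv R).symm.toLinearMap ∘ₗ starHom.toLinearMap

/-- `T_w = T_{i_1} ⋯ T_{i_k}` for a reduced expression `w = s_{i_1} ⋯ s_{i_k}`. -/
noncomputable def T (w : Equiv.Perm (Fin n)) : Hecke R q n := ((reducedWord w).map gen).prod

/-- `T_{i,j} = T_i T_{i+1} ⋯ T_{j-1}` if `i ≤ j`, and `T_{i,j} = T_{i-1} T_{i-2} ⋯ T_j`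
if `j < i`. -/
def TT (i j : Fin n) : Hecke R q n :=
  if i ≤ j then
    (((List.finRange (n - 1)).filter (fun k => i.1 ≤ k.1 ∧ k.1 < j.1)).map gen).prod
  else
    (((List.finRange (n - 1)).filter (fun k => j.1 ≤ k.1 ∧ k.1 < i.1)).reverse.map gen).prod

open Classical in
/-- `m_lam = ∑ q^{l(v)} T_v`, the sum over the Young subgroup. -/
noncomputable def m (lam : Shape n) : Hecke R q n :=
  ∑ v : Equiv.Perm (Fin n) with v ∈ youngSubgroup lam, (q : R) ^ permLength v • T v

/-- The elements `m_{st} = T_{w(s)}^* m_lam T_{w(t)}` of the Murphy basis. -/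
noncomputable def murphy (lam : Shape n) (s t : StdTableau lam) : Hecke R q n :=
  star (T s.1.perm) * m lam * T t.1.perm

/-- The element `T_{w(t^μ ∪ α)}` for an edge `μ → lam = μ ∪ α`. -/
noncomputable def dCoeff (n : ℕ) (μ : Shape n) (lam : Shape (n + 1)) (h : μ.Edge lam) :
    Hecke R q (n + 1) :=
  T ((Tableau.initial μ).adjoin h).perm

/-- For a family `d` of elements attached to the edges of Young's lattice, and a standard
tableau `t`, identified with the path `∅ = lam_0 → lam_1 → ⋯ → lam_n` in Young's lattice for which
`lam_k` is the set of nodes of `t` with one of the `k` smallest entries: the ordered product of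
`d` over the edges of the path, last edge first. -/
noncomputable def pathProd
    (d : (n : ℕ) → (μ : Shape n) → (lam : Shape (n + 1)) → μ.Edge lam → Hecke R q (n + 1)) :
    (n : ℕ) → (lam : Shape n) → StdTableau lam → Hecke R q n
  | 0, _, _ => 1
  | n + 1, lam, t =>
      d n t.prevShape lam t.prevShape_edge * incl n (pathProd d n t.prevShape t.prev)

end Hecke

/-! Everything is computed with words. A tableau is recorded by its row word, which sends an entry
to the row containing it. For a monotone word `f0` the elements `wordSum R q f0 f`, with `f` a
rearrangement of `f0`, span the right ideal generated by `wordSum R q f0 f0`. When `f0` is the word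
of a shape `lam`, this generator is `m lam`, and the ideal is the q-analogue of the permutation
module on the cosets of the Young subgroup. Generators act by exchanging neighbouring letters,
through explicit formulas (`wordOp`) that make sense on formal combinations of words. A relation
between words can therefore be transported to every quotient that respects these formulas.

Cellularity is a straightening argument. The Garnir sum of a window in two neighbouring rows that is
longer than the upper row lies in the two-sided ideal generated by the elements `wordSum R q f f`
with `f` monotone and strictly smaller than `f0` (`wordLin_garnirSum_mem`). Modulo such sums every
word is a combination of lattice words that dominate it (`single_mem_span_lattice`), and lattice
words are exactly the row words of standard tableaux. Straightening on the right and, after applying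
`star`, on the left shows that the Murphy elements span (`mul_wordSum_mul_mem_murphySpan`). The
algebra is free of rank `n!`, by Matsumoto's theorem and the regular representation. Counting in
Young's lattice bounds the number of Murphy elements by `n!` (`sum_card_mul_card_le`), so they form
a basis.

For the restriction, a cell module is filtered by the row of its largest entry. The smaller algebra
does not move the last letter of a word, and straightening can only increase it, so the tableaux
with largest entry in row `r` or below span a submodule. The subquotient for row `r` has the basis
`s ∪ α`, and deleting the last letter maps it bijectively to the cell module of the smaller shape
`μ`. The real content is that this map is equivariant. For that, a Garnir relation of `μ` with the
letter `r` appended must hold modulo the next step of the filtration (`containsGarnir_append`). Such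
a relation comes from a Garnir relation of `lam`, by moving one letter `r` to the end. After this,
`restrictLin_wordVecLin_appendLin` compares the two straightening processes.

The branching coefficients and the path products then reduce to permutations. One has `w(s ∪ α) =
w(t^μ ∪ α) w(s)` for the right action, with lengths adding up (`perm_adjoin`, `dCoeff_mul_incl`),
and `w(t^μ ∪ α)` is a descending cycle (`perm_adjoin_initial`). -/

/-! ## Inversions and lengths of permutations -/

section Inversions

variable {n : ℕ}

/-- The first of the two positions exchanged by `simpleSwap i`. -/
def lo (i : Fin (n - 1)) : Fin n := ⟨i.1, by omega⟩

/-- The second of the two positions exchanged by `simpleSwap i`. -/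
def hi (i : Fin (n - 1)) : Fin n := ⟨i.1 + 1, by omega⟩

theorem lo_lt_hi (i : Fin (n - 1)) : lo i < hi i := Nat.lt_succ_self i.1

theorem simpleSwap_lo (i : Fin (n - 1)) : simpleSwap i (lo i) = hi i := Equiv.swap_apply_left _ _

theorem simpleSwap_hi (i : Fin (n - 1)) : simpleSwap i (hi i) = lo i := Equiv.swap_apply_right _ _

theorem simpleSwap_of_ne {i : Fin (n - 1)} {x : Fin n} (h1 : x ≠ lo i) (h2 : x ≠ hi i) :
    simpleSwap i x = x := Equiv.swap_apply_of_ne_of_ne h1 h2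

theorem simpleSwap_mul_self (i : Fin (n - 1)) : simpleSwap i * simpleSwap i = 1 :=
  Equiv.swap_mul_self _ _

theorem simpleSwap_simpleSwap (i : Fin (n - 1)) (x : Fin n) :
    simpleSwap i (simpleSwap i x) = x := Equiv.swap_apply_self _ _ _

theorem simpleSwap_inv (i : Fin (n - 1)) : (simpleSwap i)⁻¹ = simpleSwap i := Equiv.swap_inv _ _

theorem simpleSwap_val (i : Fin (n - 1)) (x : Fin n) :
    (simpleSwap i x).1 = if x.1 = i.1 then i.1 + 1 else if x.1 = i.1 + 1 then i.1 else x.1 := by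
  unfold simpleSwap
  rw [Equiv.swap_apply_def]
  simp only [Fin.ext_iff]
  split_ifs <;> rfl

theorem simpleSwap_lt_iff {i : Fin (n - 1)} {x y : Fin n} (h : ¬ (x = lo i ∧ y = hi i))
    (h' : ¬ (x = hi i ∧ y = lo i)) : simpleSwap i x < simpleSwap i y ↔ x < y := by
  simp only [Fin.lt_def, simpleSwap_val]
  simp only [Fin.ext_iff, lo, hi] at h h'
  split_ifs <;> omega

theorem perm_apply_inv (p : Equiv.Perm (Fin n)) (x : Fin n) : p (p⁻¹ x) = x :=
  Equiv.apply_symm_apply p x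

theorem perm_inv_apply (p : Equiv.Perm (Fin n)) (x : Fin n) : p⁻¹ (p x) = x :=
  Equiv.symm_apply_apply p x

/-- The set of inversions of a permutation. -/
def inversions (p : Equiv.Perm (Fin n)) : Finset (Fin n × Fin n) :=
  {a | a.1 < a.2 ∧ p a.2 < p a.1}

theorem mem_inversions {p : Equiv.Perm (Fin n)} {a : Fin n × Fin n} :
    a ∈ inversions p ↔ a.1 < a.2 ∧ p a.2 < p a.1 := by simp [inversions]

/-- The number of inversions of a permutation. -/
def invCount (p : Equiv.Perm (Fin n)) : ℕ := (inversions p).card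

theorem invCount_one : invCount (1 : Equiv.Perm (Fin n)) = 0 := by
  rw [invCount, Finset.card_eq_zero, Finset.eq_empty_iff_forall_notMem]
  intro a ha
  rw [mem_inversions] at ha
  exact lt_asymm ha.1 ha.2

/-- Exchanging two neighbouring values alters the relative order of one pair of positions only,
namely those where `p` takes these values. -/
theorem invCount_simpleSwap_mul {i : Fin (n - 1)} {p : Equiv.Perm (Fin n)}
    (h : p⁻¹ (lo i) < p⁻¹ (hi i)) : invCount (simpleSwap i * p) = invCount p + 1 := by
  have hnot : (p⁻¹ (lo i), p⁻¹ (hi i)) ∉ inversions p := by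
    rw [mem_inversions]
    rintro ⟨_, h2⟩
    exact lt_asymm ((perm_apply_inv p _).symm.trans_lt (h2.trans_eq (perm_apply_inv p _)))
      (lo_lt_hi i)
  rw [invCount, invCount, ← Finset.card_insert_of_notMem hnot]
  congr 1
  ext ⟨a, b⟩
  rw [Finset.mem_insert, mem_inversions, mem_inversions, Prod.mk.injEq]
  simp only [Equiv.Perm.mul_apply]
  by_cases h1 : a = p⁻¹ (lo i) ∧ b = p⁻¹ (hi i)
  · obtain ⟨rfl, rfl⟩ := h1
    simp only [and_self, true_or, iff_true, perm_apply_inv, simpleSwap_lo, simpleSwap_hi]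
    exact ⟨h, lo_lt_hi i⟩
  · simp only [h1, false_or]
    refine and_congr_right fun hab => ?_
    rw [simpleSwap_lt_iff]
    · rintro ⟨hb, ha⟩
      rw [← Equiv.Perm.eq_inv_iff_eq] at ha hb
      rw [ha, hb] at hab
      exact lt_asymm hab h
    · rintro ⟨hb, ha⟩
      rw [← Equiv.Perm.eq_inv_iff_eq] at ha hb
      exact h1 ⟨ha, hb⟩

theorem invCount_simpleSwap_mul' {i : Fin (n - 1)} {p : Equiv.Perm (Fin n)}
    (h : p⁻¹ (hi i) < p⁻¹ (lo i)) : invCount (simpleSwap i * p) + 1 = invCount p := by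
  have := invCount_simpleSwap_mul (i := i) (p := simpleSwap i * p) (by
    simpa [mul_inv_rev, simpleSwap_inv, simpleSwap_lo, simpleSwap_hi] using h)
  rw [← this, ← mul_assoc, simpleSwap_mul_self, one_mul]

theorem inv_apply_lo_lt_or (p : Equiv.Perm (Fin n)) (i : Fin (n - 1)) :
    p (lo i) < p (hi i) ∨ p (hi i) < p (lo i) :=
  lt_or_gt_of_ne fun h => (lo_lt_hi i).ne (p.injective h)

/-- A function on `Fin n` that is monotone on neighbours is monotone. -/
theorem monotone_of_lo_le_hi {α : Type*} [Preorder α] {f : Fin n → α}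
    (h : ∀ i : Fin (n - 1), f (lo i) ≤ f (hi i)) : Monotone f := by
  cases n with
  | zero => exact fun a => a.elim0
  | succ m => exact Fin.monotone_iff_le_succ.2 fun i => h i

theorem eq_one_of_lo_lt_hi {p : Equiv.Perm (Fin n)}
    (h : ∀ i : Fin (n - 1), p (lo i) < p (hi i)) : p = 1 := by
  have hm : StrictMono p :=
    (monotone_of_lo_le_hi fun i => (h i).le).strictMono_of_injective p.injective
  have : hm.orderIsoOfSurjective p p.surjective = OrderIso.refl _ := Subsingleton.elim _ _
  exact Equiv.ext fun x => congrArg (fun e : Fin n ≃o Fin n => e x) this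

theorem exists_descent {p : Equiv.Perm (Fin n)} (hp : p ≠ 1) :
    ∃ i : Fin (n - 1), p⁻¹ (hi i) < p⁻¹ (lo i) := by
  by_contra! h
  refine hp (inv_eq_one.1 (eq_one_of_lo_lt_hi fun i => ?_))
  exact (h i).lt_of_ne fun h' => (lo_lt_hi i).ne (p⁻¹.injective h')

theorem eq_one_of_invCount_eq_zero {p : Equiv.Perm (Fin n)} (h : invCount p = 0) : p = 1 := by
  by_contra hp
  obtain ⟨i, hi⟩ := exists_descent hp
  have := invCount_simpleSwap_mul' hi
  omega

/-- Induction on the length of a permutation, multiplying by simple transpositions. -/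
theorem perm_induction {P : Equiv.Perm (Fin n) → Prop} (one : P 1)
    (step : ∀ (p : Equiv.Perm (Fin n)) (i : Fin (n - 1)), p⁻¹ (lo i) < p⁻¹ (hi i) → P p →
      P (simpleSwap i * p)) (p : Equiv.Perm (Fin n)) : P p := by
  induction h : invCount p generalizing p with
  | zero => rw [eq_one_of_invCount_eq_zero h]; exact one
  | succ k ih =>
    have hp : p ≠ 1 := by rintro rfl; rw [invCount_one] at h; omega
    obtain ⟨i, hi⟩ := exists_descent hp
    have h1 := invCount_simpleSwap_mul' hi
    have h2 := step (simpleSwap i * p) i (by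
      simpa [mul_inv_rev, simpleSwap_inv, simpleSwap_lo, simpleSwap_hi] using hi)
      (ih _ (by omega))
    rwa [← mul_assoc, simpleSwap_mul_self, one_mul] at h2

/-- Expressions are read for the right action while `Equiv.Perm` composes on the left, so the last
letter of a word is the leftmost factor. -/
theorem isExpression_concat (l : List (Fin (n - 1))) (i : Fin (n - 1)) (w : Equiv.Perm (Fin n)) :
    IsExpression (l ++ [i]) w ↔ IsExpression l (simpleSwap i * w) := by
  unfold IsExpression
  simp only [List.map_append, List.map_cons, List.map_nil, List.reverse_append,
    List.reverse_singleton, List.singleton_append, List.prod_cons]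
  constructor
  · rintro rfl
    rw [← mul_assoc, simpleSwap_mul_self, one_mul]
  · intro h
    rw [h, ← mul_assoc, simpleSwap_mul_self, one_mul]

theorem isExpression_nil : IsExpression ([] : List (Fin (n - 1))) 1 := rfl

theorem IsExpression.invCount_le {l : List (Fin (n - 1))} {w : Equiv.Perm (Fin n)}
    (h : IsExpression l w) : invCount w ≤ l.length := by
  induction l using List.reverseRecOn generalizing w with
  | nil =>
    have : w = 1 := h.symm
    rw [this, invCount_one]
    exact Nat.zero_le _
  | append_singleton l i ih =>
    rw [isExpression_concat] at h
    have h1 := ih h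
    rw [List.length_append, List.length_singleton]
    rcases inv_apply_lo_lt_or w⁻¹ i with h2 | h2
    · have := invCount_simpleSwap_mul h2; omega
    · have := invCount_simpleSwap_mul' h2; omega

theorem exists_expression_length_eq (w : Equiv.Perm (Fin n)) :
    ∃ l : List (Fin (n - 1)), IsExpression l w ∧ l.length = invCount w := by
  induction w using perm_induction with
  | one => exact ⟨[], isExpression_nil, by rw [invCount_one]; rfl⟩
  | step p i hi ih =>
    obtain ⟨l, hl, hl'⟩ := ih
    refine ⟨l ++ [i], ?_, ?_⟩
    · rwa [isExpression_concat, ← mul_assoc, simpleSwap_mul_self, one_mul]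
    · rw [List.length_append, hl', invCount_simpleSwap_mul hi]; rfl

/-- Each letter changes the number of inversions by exactly one, and a nontrivial permutation always
has a descent that lowers it. The minimal length is thus the number of inversions. -/
theorem isReducedExpression_iff {l : List (Fin (n - 1))} {w : Equiv.Perm (Fin n)} :
    IsReducedExpression l w ↔ IsExpression l w ∧ l.length = invCount w := by
  constructor
  · rintro ⟨h1, h2⟩
    obtain ⟨l', hl, hl'⟩ := exists_expression_length_eq w
    exact ⟨h1, le_antisymm (hl' ▸ h2 l' hl) h1.invCount_le⟩
  · rintro ⟨h1, h2⟩
    exact ⟨h1, fun l' hl' => h2.le.trans hl'.invCount_le⟩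

theorem reducedWord_spec (w : Equiv.Perm (Fin n)) :
    IsExpression (reducedWord w) w ∧ (reducedWord w).length = invCount w :=
  isReducedExpression_iff.1 (exists_reduced w).choose_spec

theorem permLength_eq (w : Equiv.Perm (Fin n)) : permLength w = invCount w :=
  (reducedWord_spec w).2

theorem simpleSwap_comm {i j : Fin (n - 1)} (h : i.1 + 1 < j.1 ∨ j.1 + 1 < i.1) :
    simpleSwap i * simpleSwap j = simpleSwap j * simpleSwap i := by
  ext x
  simp only [Equiv.Perm.mul_apply, simpleSwap_val]
  split_ifs <;> omega

theorem simpleSwap_braid {i j : Fin (n - 1)} (h : i.1 + 1 = j.1) :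
    simpleSwap i * simpleSwap j * simpleSwap i = simpleSwap j * simpleSwap i * simpleSwap j := by
  ext x
  have hj : j.1 = i.1 + 1 := h.symm
  simp only [Equiv.Perm.mul_apply, simpleSwap_val, hj]
  have e1 : i.1 ≠ i.1 + 1 + 1 := by omega
  have e2 : i.1 + 1 + 1 ≠ i.1 := by omega
  by_cases h1 : x.1 = i.1
  · simp [h1, e1, e2]
  by_cases h2 : x.1 = i.1 + 1
  · simp [h2, e1, e2]
  by_cases h3 : x.1 = i.1 + 1 + 1
  · simp [h3, e1, e2]
  · simp [h1, h2, h3]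

theorem exists_reduced_concat {w : Equiv.Perm (Fin n)} {i : Fin (n - 1)}
    (h : w⁻¹ (hi i) < w⁻¹ (lo i)) : ∃ l, IsReducedExpression l (simpleSwap i * w) ∧
      IsReducedExpression (l ++ [i]) w := by
  obtain ⟨l, hl, hl'⟩ := exists_expression_length_eq (simpleSwap i * w)
  refine ⟨l, isReducedExpression_iff.2 ⟨hl, hl'⟩,
    isReducedExpression_iff.2 ⟨(isExpression_concat _ _ _).2 hl, ?_⟩⟩
  rw [← invCount_simpleSwap_mul' h, List.length_append, hl']
  rfl

theorem IsReducedExpression.of_concat {l : List (Fin (n - 1))} {i : Fin (n - 1)}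
    {w : Equiv.Perm (Fin n)} (h : IsReducedExpression (l ++ [i]) w) :
    w⁻¹ (hi i) < w⁻¹ (lo i) ∧ IsReducedExpression l (simpleSwap i * w) := by
  rw [isReducedExpression_iff, isExpression_concat, List.length_append, List.length_singleton] at h
  have h1 := h.1.invCount_le
  rcases inv_apply_lo_lt_or w⁻¹ i with h2 | h2
  · have := invCount_simpleSwap_mul h2; omega
  · have := invCount_simpleSwap_mul' h2
    exact ⟨h2, isReducedExpression_iff.2 ⟨h.1, by omega⟩⟩

end Inversions

/-! ### Matsumoto's theorem: independence of `T_w` from the reduced word -/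

namespace Hecke

variable {R : Type*} [CommRing R] {q : Rˣ} {n : ℕ}

/-- The product of generators along two reduced expressions of the same permutation agrees. -/
theorem prod_gen_eq {w : Equiv.Perm (Fin n)} {l l' : List (Fin (n - 1))}
    (h : IsReducedExpression l w) (h' : IsReducedExpression l' w) :
    ((l.map gen).prod : Hecke R q n) = (l'.map gen).prod := by
  induction hk : invCount w using Nat.strong_induction_on generalizing w l l' with
  | _ k ih =>
  subst hk
  have hlen := (isReducedExpression_iff.1 h).2.trans (isReducedExpression_iff.1 h').2.symm
  rcases l.eq_nil_or_concat' with rfl | ⟨x, i, rfl⟩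
  · rw [List.length_nil, eq_comm, List.length_eq_zero_iff] at hlen
    rw [hlen]
  rcases l'.eq_nil_or_concat' with rfl | ⟨y, j, rfl⟩
  · simp at hlen
  clear hlen
  obtain ⟨hi, hx⟩ := h.of_concat
  obtain ⟨hj, hy⟩ := h'.of_concat
  have hil := invCount_simpleSwap_mul' hi
  have hjl := invCount_simpleSwap_mul' hj
  have key : ∀ {a : List (Fin (n - 1))} {u : Equiv.Perm (Fin n)} {b : List (Fin (n - 1))},
      invCount u < invCount w → IsReducedExpression a u → IsReducedExpression b u →
      ((a.map gen).prod : Hecke R q n) = (b.map gen).prod :=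
    fun hu ha hb => ih _ hu ha hb rfl
  -- the case of neighbouring letters
  have braid : ∀ {x y : List (Fin (n - 1))} {i j : Fin (n - 1)}, i.1 + 1 = j.1 →
      w⁻¹ (_root_.hi i) < w⁻¹ (lo i) → w⁻¹ (_root_.hi j) < w⁻¹ (lo j) →
      IsReducedExpression x (simpleSwap i * w) → IsReducedExpression y (simpleSwap j * w) →
      (((x ++ [i]).map gen).prod : Hecke R q n) = ((y ++ [j]).map gen).prod := by
    intro x y i j hij hi hj hx hy
    have hil := invCount_simpleSwap_mul' hi
    have hjl := invCount_simpleSwap_mul' hj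
    have e : lo j = _root_.hi i := Fin.ext hij.symm
    rw [e] at hj
    have n1 : simpleSwap i (_root_.hi j) = _root_.hi j := simpleSwap_of_ne
      (by simp only [ne_eq, Fin.ext_iff, lo, _root_.hi]; omega)
      (by simp only [ne_eq, Fin.ext_iff, _root_.hi]; omega)
    have n2 : simpleSwap j (lo i) = lo i := simpleSwap_of_ne
      (by simp only [ne_eq, Fin.ext_iff, lo]; omega)
      (by simp only [ne_eq, Fin.ext_iff, lo, _root_.hi]; omega)
    have n3 : simpleSwap j (_root_.hi i) = _root_.hi j := e ▸ simpleSwap_lo j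
    have d1 : (simpleSwap i * w)⁻¹ (_root_.hi j) < (simpleSwap i * w)⁻¹ (lo j) := by
      simp only [mul_inv_rev, simpleSwap_inv, Equiv.Perm.mul_apply, e, simpleSwap_hi, n1]
      exact hj.trans hi
    have d2 : (simpleSwap j * (simpleSwap i * w))⁻¹ (_root_.hi i) <
        (simpleSwap j * (simpleSwap i * w))⁻¹ (lo i) := by
      simp only [mul_inv_rev, simpleSwap_inv, Equiv.Perm.mul_apply, n1, n2, n3, simpleSwap_lo]
      exact hj
    have d3 : (simpleSwap j * w)⁻¹ (_root_.hi i) < (simpleSwap j * w)⁻¹ (lo i) := by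
      simp only [mul_inv_rev, simpleSwap_inv, Equiv.Perm.mul_apply, n2, n3]
      exact hj.trans hi
    have l1 := invCount_simpleSwap_mul' d1
    have l2 := invCount_simpleSwap_mul' d2
    -- Both letters are descents of `w`, so `w` has reduced words `a i j i` and `a j i j` with a
    -- common prefix `a`. By induction `x` may be replaced by `a i j` and `y` by `a j i`, and the
    -- braid relation finishes.
    obtain ⟨a, ha, ha'⟩ := exists_reduced_concat d2
    have ha2 : IsReducedExpression (a ++ [i] ++ [j]) (simpleSwap i * w) := by
      rw [isReducedExpression_iff] at ha' ⊢
      refine ⟨(isExpression_concat _ _ _).2 ha'.1, ?_⟩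
      rw [List.length_append, ha'.2, ← l1]; rfl
    have d4 : (simpleSwap i * (simpleSwap j * w))⁻¹ (_root_.hi j) <
        (simpleSwap i * (simpleSwap j * w))⁻¹ (lo j) := by
      simp only [mul_inv_rev, simpleSwap_inv, Equiv.Perm.mul_apply, e, simpleSwap_hi, n1, n2,
        simpleSwap_hi]
      exact hi
    have l3 := invCount_simpleSwap_mul' d3
    have l4 := invCount_simpleSwap_mul' d4
    have hw : simpleSwap j * (simpleSwap i * (simpleSwap j * w)) =
        simpleSwap i * (simpleSwap j * (simpleSwap i * w)) := by
      have := simpleSwap_braid hij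
      simp only [← mul_assoc, this]
    have hb2 : IsReducedExpression (a ++ [j] ++ [i]) (simpleSwap j * w) := by
      rw [isReducedExpression_iff] at ha ⊢
      rw [isExpression_concat, isExpression_concat, hw]
      refine ⟨ha.1, ?_⟩
      rw [List.length_append, List.length_append, ha.2, ← hw]
      simp only [List.length_singleton]
      omega
    rw [List.map_append, List.map_append, List.prod_append, List.prod_append,
      key (by omega) hx ha2, key (by omega) hy hb2]
    have := gen_braid (R := R) (q := q) i j hij
    simp only [List.map_append, List.map_cons, List.map_nil, List.prod_append, List.prod_cons,
      List.prod_nil, mul_one, mul_assoc] at this ⊢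
    rw [this]
  by_cases hij : i = j
  · subst hij
    rw [List.map_append, List.map_append, List.prod_append, List.prod_append,
      key (by omega) hx hy]
  by_cases h1 : i.1 + 1 = j.1
  · exact braid h1 hi hj hx hy
  by_cases h2 : j.1 + 1 = i.1
  · exact (braid h2 hj hi hy hx).symm
  have h3 : i.1 + 1 < j.1 ∨ j.1 + 1 < i.1 := by
    have : i.1 ≠ j.1 := fun h => hij (Fin.ext h)
    omega
  have n1 : simpleSwap i (_root_.hi j) = _root_.hi j := simpleSwap_of_ne
    (by simp only [ne_eq, Fin.ext_iff, lo, _root_.hi]; omega)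
    (by simp only [ne_eq, Fin.ext_iff, _root_.hi]; omega)
  have n2 : simpleSwap i (lo j) = lo j := simpleSwap_of_ne
    (by simp only [ne_eq, Fin.ext_iff, lo]; omega)
    (by simp only [ne_eq, Fin.ext_iff, lo, _root_.hi]; omega)
  have d1 : (simpleSwap i * w)⁻¹ (_root_.hi j) < (simpleSwap i * w)⁻¹ (lo j) := by
    simp only [mul_inv_rev, simpleSwap_inv, Equiv.Perm.mul_apply, n1, n2]
    exact hj
  have l1 := invCount_simpleSwap_mul' d1
  -- For commuting letters the common prefix `a` is a reduced word of `s_j s_i w`; induction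
  -- replaces `x` by `a j` and `y` by `a i`.
  obtain ⟨a, ha, ha'⟩ := exists_reduced_concat d1
  have hb : IsReducedExpression (a ++ [i]) (simpleSwap j * w) := by
    rw [isReducedExpression_iff] at ha ⊢
    rw [isExpression_concat, ← mul_assoc, simpleSwap_comm h3, mul_assoc]
    refine ⟨ha.1, ?_⟩
    rw [List.length_append, ha.2, List.length_singleton]
    omega
  rw [List.map_append, List.map_append, List.prod_append, List.prod_append,
    key (by omega) hx ha', key (by omega) hy hb]
  have := gen_comm (R := R) (q := q) i j h3
  simp only [List.map_append, List.map_cons, List.map_nil, List.prod_append, List.prod_cons,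
    List.prod_nil, mul_one, mul_assoc] at this ⊢
  rw [this]

theorem T_eq_prod {w : Equiv.Perm (Fin n)} {l : List (Fin (n - 1))}
    (h : IsReducedExpression l w) : (T w : Hecke R q n) = (l.map gen).prod :=
  prod_gen_eq (isReducedExpression_iff.2 (reducedWord_spec w)) h

theorem T_one : (T 1 : Hecke R q n) = 1 :=
  T_eq_prod (isReducedExpression_iff.2 ⟨isExpression_nil, by rw [invCount_one]; rfl⟩)

theorem T_mul_gen {p : Equiv.Perm (Fin n)} {i : Fin (n - 1)} (h : p⁻¹ (lo i) < p⁻¹ (hi i)) :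
    (T p * gen i : Hecke R q n) = T (simpleSwap i * p) := by
  obtain ⟨l, hl, hl'⟩ := exists_expression_length_eq p
  rw [T_eq_prod (isReducedExpression_iff.2 ⟨hl, hl'⟩), T_eq_prod (l := l ++ [i])]
  · simp
  · rw [isReducedExpression_iff, isExpression_concat, ← mul_assoc, simpleSwap_mul_self, one_mul,
      invCount_simpleSwap_mul h, List.length_append, hl']
    exact ⟨hl, rfl⟩

/-- The coefficient `q - q⁻¹` of the quadratic relation. -/
def zeta (q : Rˣ) : R := (q : R) - ((q⁻¹ : Rˣ) : R)

theorem gen_mul_gen (i : Fin (n - 1)) :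
    (gen i * gen i : Hecke R q n) = 1 + zeta q • gen i := by
  have h := gen_quad (R := R) (q := q) i
  rw [sub_mul, mul_add, mul_add, ← Algebra.commutes ((q⁻¹ : Rˣ) : R) (gen i), ← map_mul,
    Units.mul_inv, map_one, ← Algebra.smul_def, ← Algebra.smul_def] at h
  rw [zeta, sub_smul]
  have h2 : (gen i * gen i : Hecke R q n) - (1 + ((q : R) • gen i - ((q⁻¹ : Rˣ) : R) • gen i)) = 0 := by
    rw [← h]; abel
  exact sub_eq_zero.1 h2

theorem T_mul_gen' {p : Equiv.Perm (Fin n)} {i : Fin (n - 1)} (h : p⁻¹ (hi i) < p⁻¹ (lo i)) :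
    (T p * gen i : Hecke R q n) = T (simpleSwap i * p) + zeta q • T p := by
  have h1 := T_mul_gen (R := R) (q := q) (p := simpleSwap i * p) (i := i) (by
    simpa [mul_inv_rev, simpleSwap_inv, simpleSwap_lo, simpleSwap_hi] using h)
  rw [← mul_assoc, simpleSwap_mul_self, one_mul] at h1
  rw [← h1, mul_assoc, gen_mul_gen, mul_add, mul_one, mul_smul_comm]

end Hecke

namespace Hecke

variable {R : Type*} [CommRing R] {q : Rˣ} {n : ℕ}

/-! ## The regular representation and the standard basis -/

theorem quad_of_mul_self {B : Type*} [Ring B] [Algebra R B] {x : B} (h : x * x = 1 + zeta q • x) :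
    (x - algebraMap R B (q : R)) * (x + algebraMap R B ((q⁻¹ : Rˣ) : R)) = 0 := by
  rw [sub_mul, mul_add, mul_add, h, ← Algebra.commutes ((q⁻¹ : Rˣ) : R) x,
    ← map_mul, Units.mul_inv, map_one, ← Algebra.smul_def, ← Algebra.smul_def, zeta]
  module

section Regular

variable (q n)

/-- The coefficient that occurs in the action of a generator on two values `a`, `b`. -/
def swapCoeff {α : Type*} [LT α] [DecidableRel (α := α) (· < ·)] (a b : α) : R :=
  if b < a then zeta q else 0

/-- Left multiplication by a generator on the free module with basis the permutations. -/
noncomputable def leftOp (i : Fin (n - 1)) :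
    Module.End R (Equiv.Perm (Fin n) →₀ R) :=
  Finsupp.linearCombination R fun p => Finsupp.single (p * simpleSwap i) 1 +
    (swapCoeff q (p (lo i)) (p (hi i)) : R) • Finsupp.single p 1

variable {q n}

theorem leftOp_single (i : Fin (n - 1)) (p : Equiv.Perm (Fin n)) :
    leftOp q n i (Finsupp.single p 1) = Finsupp.single (p * simpleSwap i) 1 +
      (swapCoeff q (p (lo i)) (p (hi i)) : R) • Finsupp.single p 1 := by
  rw [leftOp, Finsupp.linearCombination_single, one_smul]

theorem end_ext {f g : Module.End R (Equiv.Perm (Fin n) →₀ R)}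
    (h : ∀ p, f (Finsupp.single p 1) = g (Finsupp.single p 1)) : f = g :=
  Finsupp.lhom_ext' fun p => LinearMap.ext_ring (h p)

theorem leftOp_comm (i j : Fin (n - 1)) (h : i.1 + 1 < j.1 ∨ j.1 + 1 < i.1) :
    leftOp q n i * leftOp q n j = leftOp q n j * leftOp q n i := by
  refine end_ext fun p => ?_
  have h1 : simpleSwap i (lo j) = lo j := simpleSwap_of_ne
    (by simp only [ne_eq, Fin.ext_iff, lo]; omega) (by simp only [ne_eq, Fin.ext_iff, lo, hi]; omega)
  have h2 : simpleSwap i (hi j) = hi j := simpleSwap_of_ne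
    (by simp only [ne_eq, Fin.ext_iff, lo, hi]; omega) (by simp only [ne_eq, Fin.ext_iff, hi]; omega)
  have h3 : simpleSwap j (lo i) = lo i := simpleSwap_of_ne
    (by simp only [ne_eq, Fin.ext_iff, lo]; omega) (by simp only [ne_eq, Fin.ext_iff, lo, hi]; omega)
  have h4 : simpleSwap j (hi i) = hi i := simpleSwap_of_ne
    (by simp only [ne_eq, Fin.ext_iff, lo, hi]; omega) (by simp only [ne_eq, Fin.ext_iff, hi]; omega)
  simp only [Module.End.mul_apply, leftOp_single, map_add, map_smul, Equiv.Perm.mul_apply, h1, h2,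
    h3, h4]
  rw [mul_assoc, mul_assoc, simpleSwap_comm h]
  module

theorem leftOp_mul_self (i : Fin (n - 1)) :
    leftOp q n i * leftOp q n i = 1 + zeta q • leftOp q n i := by
  refine end_ext fun p => ?_
  simp only [Module.End.mul_apply, leftOp_single, map_add, map_smul, Equiv.Perm.mul_apply,
    simpleSwap_lo, simpleSwap_hi, LinearMap.add_apply, LinearMap.smul_apply, Module.End.one_apply]
  rw [mul_assoc, simpleSwap_mul_self, mul_one]
  unfold swapCoeff
  rcases inv_apply_lo_lt_or p i with h | h
  · rw [if_pos h, if_neg h.le.not_gt]; module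
  · rw [if_pos h, if_neg h.le.not_gt]; module

theorem leftOp_braid (i j : Fin (n - 1)) (h : i.1 + 1 = j.1) :
    leftOp q n i * leftOp q n j * leftOp q n i = leftOp q n j * leftOp q n i * leftOp q n j := by
  refine end_ext fun p => ?_
  have e : lo j = hi i := Fin.ext h.symm
  have n1 : simpleSwap i (hi j) = hi j := simpleSwap_of_ne
    (by simp only [ne_eq, Fin.ext_iff, lo, hi]; omega) (by simp only [ne_eq, Fin.ext_iff, hi]; omega)
  have n2 : simpleSwap j (lo i) = lo i := simpleSwap_of_ne
    (by simp only [ne_eq, Fin.ext_iff, lo]; omega) (by simp only [ne_eq, Fin.ext_iff, lo, hi]; omega)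
  have n3 : simpleSwap j (hi i) = hi j := e ▸ simpleSwap_lo j
  have n4 : simpleSwap j (hi j) = hi i := e ▸ simpleSwap_hi j
  have b : p * simpleSwap j * simpleSwap i * simpleSwap j =
      p * simpleSwap i * simpleSwap j * simpleSwap i := by
    have := simpleSwap_braid h
    simp only [mul_assoc] at this ⊢
    rw [this]
  have c1 : p * simpleSwap i * simpleSwap i = p := by rw [mul_assoc, simpleSwap_mul_self, mul_one]
  have c2 : p * simpleSwap j * simpleSwap j = p := by rw [mul_assoc, simpleSwap_mul_self, mul_one]
  have ab : p (lo i) ≠ p (hi i) := fun h => (lo_lt_hi i).ne (p.injective h)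
  have bc : p (hi i) ≠ p (hi j) := fun h => (lo_lt_hi j).ne (e ▸ p.injective h)
  have ac : p (lo i) ≠ p (hi j) := fun h =>
    ((lo_lt_hi i).trans_le (e ▸ (lo_lt_hi j).le)).ne (p.injective h)
  simp only [Module.End.mul_apply, leftOp_single, map_add, map_smul, Equiv.Perm.mul_apply,
    simpleSwap_lo, simpleSwap_hi, e, n1, n2, n3, n4, b, c1, c2]
  -- The coefficients depend only on the relative order of three values of `p`, so six orders have
  -- to be checked; the remaining combinations of inequalities are cyclic.
  generalize p (lo i) = x, p (hi i) = y, p (hi j) = w at *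
  unfold swapCoeff
  rcases lt_or_gt_of_ne ab with h1 | h1 <;> rcases lt_or_gt_of_ne bc with h2 | h2 <;>
    rcases lt_or_gt_of_ne ac with h3 | h3 <;>
    first
    | exact absurd (h1.trans h2) h3.le.not_gt
    | exact absurd (h2.trans h1) h3.le.not_gt
    | (simp only [h1, h2, h3, h1.le.not_gt, h2.le.not_gt, h3.le.not_gt, if_true, if_false]; module)

variable (R q n) in
/-- The left regular representation, on the free module with basis the permutations. -/
noncomputable def leftReg : Hecke R q n →ₐ[R] Module.End R (Equiv.Perm (Fin n) →₀ R) :=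
  lift (leftOp q n) leftOp_comm leftOp_braid (fun i =>
    quad_of_mul_self (B := Module.End R (Equiv.Perm (Fin n) →₀ R)) (q := q) (x := leftOp q n i)
      (leftOp_mul_self i))

theorem leftReg_gen (i : Fin (n - 1)) : leftReg R q n (gen i) = leftOp q n i :=
  lift_gen (leftOp q n) leftOp_comm leftOp_braid _ i

end Regular

/-- The multiplication rules `T_mul_gen` and `T_mul_gen'` show stability under generators, hence
under all noncommutative polynomials in them. -/
theorem span_T_mul (x : Hecke R q n) {u : Hecke R q n}
    (hu : u ∈ Submodule.span R (Set.range (T (R := R) (q := q) (n := n)))) :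
    u * x ∈ Submodule.span R (Set.range (T (R := R) (q := q) (n := n))) := by
  obtain ⟨a, rfl⟩ := RingQuot.mkAlgHom_surjective R (HeckeRel R q n) x
  let π : FreeAlgebra R (Fin (n - 1)) →ₐ[R] Hecke R q n := RingQuot.mkAlgHom R (HeckeRel R q n)
  change u * π a ∈ _
  induction a using FreeAlgebra.induction generalizing u with
  | grade0 r =>
    have : u * π (algebraMap R _ r) = r • u := by
      rw [AlgHom.commutes, Algebra.smul_def]
      exact (Algebra.commutes r u).symm
    rw [this]
    exact Submodule.smul_mem _ _ hu
  | grade1 i =>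
    change u * gen i ∈ _
    induction hu using Submodule.span_induction with
    | mem x hx =>
      obtain ⟨p, rfl⟩ := hx
      rcases inv_apply_lo_lt_or p⁻¹ i with h | h
      · rw [T_mul_gen h]
        exact Submodule.subset_span ⟨_, rfl⟩
      · rw [T_mul_gen' h]
        exact Submodule.add_mem _ (Submodule.subset_span ⟨_, rfl⟩)
          (Submodule.smul_mem _ _ (Submodule.subset_span ⟨_, rfl⟩))
    | zero => rw [zero_mul]; exact Submodule.zero_mem _
    | add x y _ _ hx hy => rw [add_mul]; exact Submodule.add_mem _ hx hy
    | smul r x _ hx => rw [smul_mul_assoc]; exact Submodule.smul_mem _ _ hx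
  | mul a b ha hb =>
    rw [map_mul]
    have := hb (ha hu)
    rwa [mul_assoc] at this
  | add a b ha hb =>
    rw [map_add]
    have := Submodule.add_mem _ (ha hu) (hb hu)
    rwa [← mul_add] at this

theorem span_T : Submodule.span R (Set.range (T (R := R) (q := q) (n := n))) = ⊤ := by
  rw [eq_top_iff]
  intro x _
  have := span_T_mul x (Submodule.subset_span ⟨1, T_one⟩ :
    (1 : Hecke R q n) ∈ Submodule.span R (Set.range (T (R := R) (q := q) (n := n))))
  rwa [one_mul] at this

/-- To prove a linear property of all elements, it is enough to check `1` and right multiplication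
by the generators. -/
theorem induction_gen {P : Submodule R (Hecke R q n)} (one : 1 ∈ P)
    (mul : ∀ x ∈ P, ∀ i, x * gen i ∈ P) (x : Hecke R q n) : x ∈ P := by
  have hT : ∀ p : Equiv.Perm (Fin n), T p ∈ P := by
    intro p
    induction p using perm_induction with
    | one => rwa [T_one]
    | step p i hi ih => rw [← T_mul_gen hi]; exact mul _ ih i
  have : Submodule.span R (Set.range (T (R := R) (q := q) (n := n))) ≤ P :=
    Submodule.span_le.2 (by rintro _ ⟨p, rfl⟩; exact hT p)
  have hx : x ∈ Submodule.span R (Set.range (T (R := R) (q := q) (n := n))) := span_T (R := R) (q := q) (n := n) ▸ Submodule.mem_top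
  exact this hx

/-! ## The involution -/

theorem star_gen (i : Fin (n - 1)) : star (gen i : Hecke R q n) = gen i := by
  change unop (starHom (gen i)) = _
  rw [starHom, lift_gen]
  rfl

theorem star_mul (x y : Hecke R q n) : star (x * y) = star y * star x := by
  change unop (starHom (x * y)) = unop (starHom y) * unop (starHom x)
  rw [map_mul]
  rfl

theorem star_one : star (1 : Hecke R q n) = 1 := by
  change unop (starHom (1 : Hecke R q n)) = 1
  rw [map_one]
  rfl

theorem star_star (x : Hecke R q n) : star (star x) = x := by
  refine induction_gen (P := LinearMap.eqLocus (star (R := R) (q := q) (n := n) ∘ₗ star) LinearMap.id) ?_ ?_ x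
  · change star (star (1 : Hecke R q n)) = 1
    rw [star_one, star_one]
  · intro x hx i
    change star (star (x * gen i)) = x * gen i
    have hx' : star (star x) = x := hx
    rw [star_mul, star_mul, star_gen, star_gen, hx']

theorem star_prod_gen (l : List (Fin (n - 1))) :
    star ((l.map gen).prod : Hecke R q n) = (l.reverse.map gen).prod := by
  induction l with
  | nil => simpa using star_one
  | cons i l ih => simp [star_mul, ih, star_gen]

end Hecke

/-! ### Inverses, left multiplication and linear independence of the `T_w` -/

theorem IsExpression.reverse {n : ℕ} {l : List (Fin (n - 1))} {p : Equiv.Perm (Fin n)}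
    (h : IsExpression l p) : IsExpression l.reverse p⁻¹ := by
  unfold IsExpression at h ⊢
  rw [← h, List.prod_inv_reverse, List.map_reverse, List.reverse_reverse, List.map_reverse,
    List.reverse_reverse]
  congr 1
  rw [List.map_map]
  exact List.map_congr_left fun i _ => (simpleSwap_inv i).symm

theorem invCount_inv {n : ℕ} (p : Equiv.Perm (Fin n)) : invCount p⁻¹ = invCount p := by
  have : ∀ p : Equiv.Perm (Fin n), invCount p⁻¹ ≤ invCount p := by
    intro p
    obtain ⟨l, hl, hl'⟩ := exists_expression_length_eq p
    rw [← hl', ← List.length_reverse]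
    exact hl.reverse.invCount_le
  exact le_antisymm (this p) (by simpa using this p⁻¹)

namespace Hecke

variable {R : Type*} [CommRing R] {q : Rˣ} {n : ℕ}

theorem star_T (p : Equiv.Perm (Fin n)) : star (T p : Hecke R q n) = T p⁻¹ := by
  obtain ⟨l, hl, hl'⟩ := exists_expression_length_eq p
  rw [T_eq_prod (isReducedExpression_iff.2 ⟨hl, hl'⟩), star_prod_gen,
    T_eq_prod (isReducedExpression_iff.2 ⟨hl.reverse, ?_⟩)]
  rw [List.length_reverse, hl', invCount_inv]

theorem gen_mul_T {p : Equiv.Perm (Fin n)} {i : Fin (n - 1)} (h : p (lo i) < p (hi i)) :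
    (gen i * T p : Hecke R q n) = T (p * simpleSwap i) := by
  have := congrArg star (T_mul_gen (R := R) (q := q) (p := p⁻¹) (i := i) (by rwa [inv_inv]))
  rwa [star_mul, star_gen, star_T, star_T, inv_inv, mul_inv_rev, inv_inv, simpleSwap_inv] at this

theorem leftReg_T (p : Equiv.Perm (Fin n)) :
    leftReg R q n (T p) (Finsupp.single 1 1) = Finsupp.single p 1 := by
  -- Passing to inverses turns the left multiplications of `perm_induction` into the right
  -- multiplications by which `leftOp` acts.
  suffices ∀ p : Equiv.Perm (Fin n),
      leftReg R q n (T p⁻¹) (Finsupp.single 1 1) = Finsupp.single p⁻¹ 1 by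
    simpa using this p⁻¹
  intro p
  induction p using perm_induction with
  | one => rw [inv_one, T_one, map_one]; rfl
  | step p i hi ih =>
    rw [mul_inv_rev, simpleSwap_inv, ← gen_mul_T hi, map_mul, Module.End.mul_apply, ih, leftReg_gen,
      leftOp_single, swapCoeff, if_neg hi.le.not_gt, zero_smul, add_zero]

/-- Applying the regular representation to the vector of the identity sends the `T_p` to distinct
basis vectors. -/
theorem linearIndependent_T : LinearIndependent R (T (R := R) (q := q) (n := n)) := by
  refine LinearIndependent.of_comp
    ((LinearMap.applyₗ (Finsupp.single 1 1)).comp (leftReg R q n).toLinearMap) ?_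
  have : (⇑((LinearMap.applyₗ (Finsupp.single 1 1)).comp (leftReg R q n).toLinearMap) ∘ T) =
      fun p : Equiv.Perm (Fin n) => (Finsupp.single p 1 : Equiv.Perm (Fin n) →₀ R) :=
    funext leftReg_T
  rw [this]
  exact Finsupp.linearIndependent_single_one R _

/-- The basis of the Hecke algebra that consists of the elements `T_w`. -/
noncomputable def basisT : Module.Basis (Equiv.Perm (Fin n)) R (Hecke R q n) :=
  Module.Basis.mk linearIndependent_T span_T.ge

end Hecke

/-! ## The inclusion -/

/-- The extension of a permutation by a fixed point at the end. -/
def extendPerm {n : ℕ} (p : Equiv.Perm (Fin n)) : Equiv.Perm (Fin (n + 1)) where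
  toFun := Fin.lastCases (Fin.last n) fun i => (p i).castSucc
  invFun := Fin.lastCases (Fin.last n) fun i => (p⁻¹ i).castSucc
  left_inv x := by
    cases x using Fin.lastCases with
    | last => simp
    | cast i => simp
  right_inv x := by
    cases x using Fin.lastCases with
    | last => simp
    | cast i => simp

section ExtendPerm

variable {n : ℕ}

@[simp] theorem extendPerm_castSucc (p : Equiv.Perm (Fin n)) (i : Fin n) :
    extendPerm p i.castSucc = (p i).castSucc := by simp [extendPerm]

@[simp] theorem extendPerm_last (p : Equiv.Perm (Fin n)) :
    extendPerm p (Fin.last n) = Fin.last n := by simp [extendPerm]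

theorem extendPerm_mul (p p' : Equiv.Perm (Fin n)) :
    extendPerm (p * p') = extendPerm p * extendPerm p' := by
  ext x
  cases x using Fin.lastCases with
  | last => simp
  | cast i => simp

theorem extendPerm_one : extendPerm (1 : Equiv.Perm (Fin n)) = 1 := by
  ext x
  cases x using Fin.lastCases with
  | last => simp
  | cast i => simp

theorem extendPerm_inv (p : Equiv.Perm (Fin n)) : extendPerm p⁻¹ = (extendPerm p)⁻¹ := by
  rw [eq_inv_iff_mul_eq_one, ← extendPerm_mul, inv_mul_cancel, extendPerm_one]

/-- A generator index of the smaller algebra, as a generator index of the larger one. -/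
def castGen (i : Fin (n - 1)) : Fin (n + 1 - 1) := i.castLE (by omega)

theorem lo_castGen (i : Fin (n - 1)) : lo (castGen i) = (lo i).castSucc := rfl

theorem hi_castGen (i : Fin (n - 1)) : hi (castGen i) = (hi i).castSucc := rfl

theorem extendPerm_simpleSwap (i : Fin (n - 1)) :
    extendPerm (simpleSwap i) = simpleSwap (castGen i) := by
  ext x
  cases x using Fin.lastCases with
  | last =>
    simp only [extendPerm_last, simpleSwap_val, Fin.val_last, castGen, Fin.val_castLE]
    have := i.2
    split_ifs <;> omega
  | cast i => simp [simpleSwap_val, castGen]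

end ExtendPerm

namespace Hecke

variable {R : Type*} [CommRing R] {q : Rˣ} {n : ℕ}

theorem incl_gen (i : Fin (n - 1)) :
    incl n (gen i : Hecke R q n) = gen (castGen i) := lift_gen _ _ _ _ i

end Hecke

/-! ## Words and the elements attached to them -/

namespace Hecke

variable {R : Type*} [CommRing R] {q : Rˣ} {n : ℕ}

section Words

variable (R q n)

/-- The element `q^{l(p)} T_p`. -/
noncomputable def weightedT (p : Equiv.Perm (Fin n)) : Hecke R q n := (q : R) ^ invCount p • T p

variable {R q n}

/-- The weight `q^{l(p)}` makes the scalar independent of `p`, which is what allows these formulas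
to be summed over cosets. -/
theorem weightedT_mul_gen {p : Equiv.Perm (Fin n)} {i : Fin (n - 1)}
    (h : p⁻¹ (lo i) < p⁻¹ (hi i)) :
    weightedT R q n p * gen i = ((q⁻¹ : Rˣ) : R) • weightedT R q n (simpleSwap i * p) := by
  rw [weightedT, weightedT, smul_mul_assoc, T_mul_gen h, invCount_simpleSwap_mul h, smul_smul,
    pow_succ', ← mul_assoc, Units.inv_mul, one_mul]

theorem weightedT_mul_gen' {p : Equiv.Perm (Fin n)} {i : Fin (n - 1)}
    (h : p⁻¹ (hi i) < p⁻¹ (lo i)) :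
    weightedT R q n p * gen i =
      (q : R) • weightedT R q n (simpleSwap i * p) + zeta q • weightedT R q n p := by
  rw [weightedT, weightedT, smul_mul_assoc, T_mul_gen' h, ← invCount_simpleSwap_mul' h, smul_smul,
    pow_succ', smul_add, smul_smul, smul_smul, mul_comm (zeta q)]

/-- The permutations `p` with `g = f ∘ p`. -/
def matching (g f : Fin n → ℕ) : Finset (Equiv.Perm (Fin n)) :=
  Finset.univ.filter fun p : Equiv.Perm (Fin n) => f ∘ p = g

theorem mem_matching {g f : Fin n → ℕ} {p : Equiv.Perm (Fin n)} :
    p ∈ matching g f ↔ f ∘ p = g := by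
  simp [matching]

variable (R q) in
/-- For words `g`, `f`, the sum of the elements `q^{l(p)} T_p` over the permutations `p`
with `g = f ∘ p`. -/
noncomputable def wordSum (g f : Fin n → ℕ) : Hecke R q n :=
  ∑ p ∈ matching g f, weightedT R q n p

theorem comp_simpleSwap_comp (f : Fin n → ℕ) (i : Fin (n - 1)) :
    (f ∘ simpleSwap i) ∘ simpleSwap i = f :=
  funext fun x => congrArg f (simpleSwap_simpleSwap i x)

theorem comp_comp_simpleSwap_mul (f : Fin n → ℕ) (i : Fin (n - 1)) (p : Equiv.Perm (Fin n)) :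
    (f ∘ simpleSwap i) ∘ ⇑(simpleSwap i * p) = f ∘ p :=
  funext fun x => congrArg f (simpleSwap_simpleSwap i (p x))

/-- Monotonicity of `f0` enters here: if two neighbouring letters of `f` differ, all `p` in the sum
for `f` are raised by the swap, or all are lowered. -/
theorem inv_lt_inv_of_lt {f0 f : Fin n → ℕ} (h0 : Monotone f0) {p : Equiv.Perm (Fin n)}
    (hp : f ∘ p = f0) {a b : Fin n} (h : f a < f b) : p⁻¹ a < p⁻¹ b := by
  refine h0.reflect_lt ?_
  rw [← hp]
  simpa only [Function.comp_apply, perm_apply_inv] using h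

theorem wordSum_mul_gen_of_lt {f0 f : Fin n → ℕ} (h0 : Monotone f0) {i : Fin (n - 1)}
    (h : f (lo i) < f (hi i)) :
    wordSum R q f0 f * gen i = ((q⁻¹ : Rˣ) : R) • wordSum R q f0 (f ∘ simpleSwap i) := by
  rw [wordSum, wordSum, Finset.sum_mul, Finset.smul_sum]
  refine Finset.sum_equiv (Equiv.mulLeft (simpleSwap i)) ?_ ?_
  · intro p
    simp only [mem_matching, Equiv.coe_mulLeft,
      comp_comp_simpleSwap_mul]
  · intro p hp
    exact weightedT_mul_gen (inv_lt_inv_of_lt h0 (mem_matching.1 hp) h)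

theorem inv_add_zeta : ((q⁻¹ : Rˣ) : R) + zeta q = q := by rw [zeta]; ring

/-- Left multiplication by `s_i` is an involution of the index set that exchanges ascents and
descents. After reindexing, an ascent receives `q` from its partner and a descent receives `q⁻¹ + (q
- q⁻¹) = q`. -/
theorem wordSum_mul_gen_of_eq {f0 f : Fin n → ℕ} {i : Fin (n - 1)} (h : f (lo i) = f (hi i)) :
    wordSum R q f0 f * gen i = (q : R) • wordSum R q f0 f := by
  have hs : f ∘ simpleSwap i = f := by
    funext x
    by_cases h1 : x = lo i
    · rw [h1, Function.comp_apply, simpleSwap_lo, h]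
    by_cases h2 : x = hi i
    · rw [h2, Function.comp_apply, simpleSwap_hi, h]
    · rw [Function.comp_apply, simpleSwap_of_ne h1 h2]
  let up : Equiv.Perm (Fin n) → Prop := fun p => p⁻¹ (lo i) < p⁻¹ (hi i)
  have hup : ∀ p, up (simpleSwap i * p) ↔ ¬ up p := by
    intro p
    change (simpleSwap i * p)⁻¹ (lo i) < (simpleSwap i * p)⁻¹ (hi i) ↔ ¬ (p⁻¹ (lo i) < p⁻¹ (hi i))
    simp only [mul_inv_rev, simpleSwap_inv, Equiv.Perm.mul_apply, simpleSwap_lo, simpleSwap_hi]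
    rcases inv_apply_lo_lt_or p⁻¹ i with h | h
    · simp only [h, h.le.not_gt, not_true_eq_false]
    · simp only [h, h.le.not_gt, not_false_eq_true]
  classical
  have h1 : ∀ p, weightedT R q n p * gen i =
      (if up p then ((q⁻¹ : Rˣ) : R) else q) • weightedT R q n (simpleSwap i * p) +
        (if up p then (0 : R) else zeta q) • weightedT R q n p := by
    intro p
    rcases inv_apply_lo_lt_or p⁻¹ i with h | h
    · have : up p := h
      simp only [this, if_true, zero_smul, add_zero]
      exact weightedT_mul_gen h
    · have : ¬ up p := h.le.not_gt
      simp only [this, if_false]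
      exact weightedT_mul_gen' h
  have h2 : ∑ p ∈ matching f0 f,
      (if up p then ((q⁻¹ : Rˣ) : R) else q) • weightedT R q n (simpleSwap i * p) =
      ∑ p ∈ matching f0 f,
        (if up p then (q : R) else ((q⁻¹ : Rˣ) : R)) • weightedT R q n p := by
    refine Finset.sum_equiv (Equiv.mulLeft (simpleSwap i)) ?_ ?_
    · intro p
      simp only [mem_matching, Equiv.coe_mulLeft]
      have := comp_comp_simpleSwap_mul f i p
      rw [hs] at this
      rw [this]
    · intro p _
      simp only [Equiv.coe_mulLeft, hup]
      by_cases hp : up p <;> simp [hp]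
  rw [wordSum, Finset.sum_mul, Finset.sum_congr rfl fun p _ => h1 p, Finset.sum_add_distrib, h2,
    ← Finset.sum_add_distrib, Finset.smul_sum]
  refine Finset.sum_congr rfl fun p _ => ?_
  by_cases hp : up p
  · simp [hp]
  · simp only [hp, if_false]
    rw [← add_smul, inv_add_zeta]

theorem wordSum_eq_of_gt {f0 f : Fin n → ℕ} (h0 : Monotone f0) {i : Fin (n - 1)}
    (h : f (hi i) < f (lo i)) :
    wordSum R q f0 f = (q : R) • (wordSum R q f0 (f ∘ simpleSwap i) * gen i) := by
  rw [wordSum_mul_gen_of_lt h0, smul_smul, Units.mul_inv, one_smul, comp_simpleSwap_comp]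
  simpa only [Function.comp_apply, simpleSwap_lo, simpleSwap_hi] using h

theorem wordSum_mul_gen_of_gt {f0 f : Fin n → ℕ} (h0 : Monotone f0) {i : Fin (n - 1)}
    (h : f (hi i) < f (lo i)) :
    wordSum R q f0 f * gen i =
      (q : R) • wordSum R q f0 (f ∘ simpleSwap i) + zeta q • wordSum R q f0 f := by
  rw [wordSum_eq_of_gt h0 h, smul_mul_assoc, mul_assoc, gen_mul_gen, mul_add, mul_one,
    mul_smul_comm, smul_add, smul_comm (zeta q)]

theorem star_wordSum (g f : Fin n → ℕ) : star (wordSum R q g f) = wordSum R q f g := by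
  rw [wordSum, wordSum, map_sum]
  refine Finset.sum_equiv (Equiv.inv _) ?_ ?_
  · intro p
    simp only [mem_matching, Equiv.inv_apply]
    constructor
    · rintro rfl
      exact funext fun x => congrArg f (perm_apply_inv p x)
    · rintro rfl
      exact funext fun x => congrArg g (perm_inv_apply p x)
  · intro p _
    rw [weightedT, map_smul, star_T, Equiv.inv_apply, weightedT, invCount_inv]

/-! ### The formal action on words -/

variable (q) in
/-- The action of a generator on formal linear combinations of words. -/
noncomputable def wordOp (i : Fin (n - 1)) : ((Fin n → ℕ) →₀ R) →ₗ[R] ((Fin n → ℕ) →₀ R) :=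
  Finsupp.linearCombination R fun f =>
    if f (lo i) < f (hi i) then ((q⁻¹ : Rˣ) : R) • Finsupp.single (f ∘ simpleSwap i) 1
    else if f (lo i) = f (hi i) then (q : R) • Finsupp.single f 1
    else (q : R) • Finsupp.single (f ∘ simpleSwap i) 1 + zeta q • Finsupp.single f 1

theorem wordOp_single (i : Fin (n - 1)) (f : Fin n → ℕ) :
    wordOp q i (Finsupp.single f 1) =
    if f (lo i) < f (hi i) then ((q⁻¹ : Rˣ) : R) • Finsupp.single (f ∘ simpleSwap i) 1
    else if f (lo i) = f (hi i) then (q : R) • Finsupp.single f 1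
    else (q : R) • Finsupp.single (f ∘ simpleSwap i) 1 + zeta q • Finsupp.single f 1 := by
  rw [wordOp, Finsupp.linearCombination_single, one_smul]

/-- A linear map out of the words intertwines the formal action of a generator with a linear
map if it does so on all words. -/
theorem comp_wordOp {N : Type*} [AddCommGroup N] [Module R N] {i : Fin (n - 1)}
    {y : (Fin n → ℕ) → N} {g : N →ₗ[R] N}
    (hlt : ∀ f, f (lo i) < f (hi i) → g (y f) = ((q⁻¹ : Rˣ) : R) • y (f ∘ simpleSwap i))
    (heq : ∀ f, f (lo i) = f (hi i) → g (y f) = (q : R) • y f)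
    (hgt : ∀ f, f (hi i) < f (lo i) →
      g (y f) = (q : R) • y (f ∘ simpleSwap i) + zeta q • y f) (c : (Fin n → ℕ) →₀ R) :
    Finsupp.linearCombination R y (wordOp q i c) = g (Finsupp.linearCombination R y c) := by
  have : Finsupp.linearCombination R y ∘ₗ wordOp q i = g ∘ₗ Finsupp.linearCombination R y := by
    refine Finsupp.lhom_ext' fun f => LinearMap.ext_ring ?_
    simp only [LinearMap.comp_apply, Finsupp.lsingle_apply, wordOp_single,
      Finsupp.linearCombination_single, one_smul]
    rcases lt_trichotomy (f (lo i)) (f (hi i)) with h | h | h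
    · rw [if_pos h, hlt f h, map_smul, Finsupp.linearCombination_single, one_smul]
    · rw [if_neg h.not_lt, if_pos h, heq f h, map_smul, Finsupp.linearCombination_single, one_smul]
    · rw [if_neg h.le.not_gt, if_neg h.ne', hgt f h, map_add, map_smul, map_smul,
        Finsupp.linearCombination_single, Finsupp.linearCombination_single, one_smul, one_smul]
  exact LinearMap.congr_fun this c

variable (R q) in
/-- The linear extension of `wordSum f0` to formal linear combinations of words. -/
noncomputable def wordLin (f0 : Fin n → ℕ) : ((Fin n → ℕ) →₀ R) →ₗ[R] Hecke R q n :=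
  Finsupp.linearCombination R (wordSum R q f0)

theorem wordLin_single (f0 f : Fin n → ℕ) :
    wordLin R q f0 (Finsupp.single f 1) = wordSum R q f0 f := by
  rw [wordLin, Finsupp.linearCombination_single, one_smul]

/-- The formal action models right multiplication for every monotone `f0` at once, since `wordOp`
does not depend on `f0`. This lets words of different shapes be compared before anything is
evaluated. -/
theorem wordLin_wordOp {f0 : Fin n → ℕ} (h0 : Monotone f0) (i : Fin (n - 1))
    (c : (Fin n → ℕ) →₀ R) : wordLin R q f0 (wordOp q i c) = wordLin R q f0 c * gen i :=
  comp_wordOp (g := LinearMap.mulRight R (gen i)) (fun _ h => wordSum_mul_gen_of_lt h0 h)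
    (fun _ h => wordSum_mul_gen_of_eq h) (fun _ h => wordSum_mul_gen_of_gt h0 h) c

/-- The word `f` is a rearrangement of `f0`. -/
def IsRearrangement (f0 f : Fin n → ℕ) : Prop := ∃ p : Equiv.Perm (Fin n), f ∘ p = f0

theorem IsRearrangement.refl (f0 : Fin n → ℕ) : IsRearrangement f0 f0 := ⟨1, rfl⟩

theorem IsRearrangement.comp {f0 f : Fin n → ℕ} (h : IsRearrangement f0 f)
    (σ : Equiv.Perm (Fin n)) : IsRearrangement f0 (f ∘ σ) := by
  obtain ⟨p, rfl⟩ := h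
  exact ⟨σ⁻¹ * p, funext fun x => congrArg f (perm_apply_inv σ (p x))⟩

theorem IsRearrangement.symm {f0 f : Fin n → ℕ} (h : IsRearrangement f0 f) :
    IsRearrangement f f0 := by
  obtain ⟨p, rfl⟩ := h
  exact ⟨p⁻¹, funext fun x => congrArg f (perm_apply_inv p x)⟩

theorem IsRearrangement.trans {f0 f g : Fin n → ℕ} (h : IsRearrangement f0 f)
    (h' : IsRearrangement f g) : IsRearrangement f0 g := by
  obtain ⟨p, rfl⟩ := h
  obtain ⟨p', rfl⟩ := h'
  exact ⟨p' * p, rfl⟩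

/-- Induction along simple transpositions on the rearrangements of a word. -/
theorem IsRearrangement.induction {f0 : Fin n → ℕ} {P : (Fin n → ℕ) → Prop} (base : P f0)
    (step : ∀ f i, P f → P (f ∘ simpleSwap i)) {f : Fin n → ℕ} (h : IsRearrangement f0 f) :
    P f := by
  obtain ⟨p, hp⟩ := h
  induction p using perm_induction generalizing f with
  | one =>
    have : f = f0 := hp
    rwa [this]
  | step p i _ ih =>
    have := step (f ∘ simpleSwap i) i (ih hp)
    rwa [comp_simpleSwap_comp] at this

/-- Since `q` is a unit, the formula for the action of a generator on a word can be solved for the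
swapped word. -/
theorem exists_mul_eq_wordSum {f0 f : Fin n → ℕ} (h0 : Monotone f0) (h : IsRearrangement f0 f) :
    ∃ x, wordSum R q f0 f0 * x = wordSum R q f0 f := by
  refine h.induction (P := fun f => ∃ x, wordSum R q f0 f0 * x = wordSum R q f0 f)
    ⟨1, mul_one _⟩ ?_
  rintro f i ⟨x, hx⟩
  rcases lt_trichotomy (f (lo i)) (f (hi i)) with h | h | h
  · refine ⟨(q : R) • (x * gen i), ?_⟩
    rw [mul_smul_comm, ← mul_assoc, hx, wordSum_mul_gen_of_lt h0 h, smul_smul, Units.mul_inv,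
      one_smul]
  · refine ⟨x, ?_⟩
    rw [hx]
    congr 1
    funext x
    by_cases h1 : x = lo i
    · rw [h1, Function.comp_apply, simpleSwap_lo, h]
    by_cases h2 : x = hi i
    · rw [h2, Function.comp_apply, simpleSwap_hi, h]
    · rw [Function.comp_apply, simpleSwap_of_ne h1 h2]
  · refine ⟨((q⁻¹ : Rˣ) : R) • (x * gen i - zeta q • x), ?_⟩
    rw [mul_smul_comm, mul_sub, ← mul_assoc, mul_smul_comm, hx, wordSum_mul_gen_of_gt h0 h,
      add_sub_cancel_right, smul_smul, Units.inv_mul, one_smul]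

theorem wordSum_of_not_isRearrangement {f0 f : Fin n → ℕ} (h : ¬ IsRearrangement f0 f) :
    wordSum R q f0 f = 0 := by
  rw [wordSum, Finset.sum_eq_zero]
  intro p hp
  exact absurd ⟨p, mem_matching.1 hp⟩ h

/-- The right ideal generated by `wordSum f0 f0` is spanned by the elements `wordSum f0 f`. -/
theorem exists_wordLin_eq {f0 : Fin n → ℕ} (h0 : Monotone f0) (x : Hecke R q n) :
    ∃ c, wordLin R q f0 c = wordSum R q f0 f0 * x := by
  refine induction_gen (P := (LinearMap.range (wordLin R q f0)).comap
    (LinearMap.mulLeft R (wordSum R q f0 f0))) ?_ ?_ x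
  · exact ⟨Finsupp.single f0 1, by rw [wordLin_single]; exact (mul_one _).symm⟩
  · rintro x ⟨c, hc⟩ i
    refine ⟨wordOp q i c, ?_⟩
    rw [wordLin_wordOp h0, hc]
    exact mul_assoc _ _ _

/-- A permutation that increases on the positions of every letter of `f0`. -/
def RowIncreasing (f0 : Fin n → ℕ) (d : Equiv.Perm (Fin n)) : Prop :=
  ∀ a b, f0 a = f0 b → a < b → d a < d b

/-- A permutation increasing on rows is a minimal coset representative. Along a reduced word of it
every generator exchanges two distinct letters in increasing order, and each such exchange
contributes `q⁻¹`. -/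
theorem wordSum_mul_T {f0 : Fin n → ℕ} (h0 : Monotone f0) {d : Equiv.Perm (Fin n)}
    (hd : RowIncreasing f0 d) :
    wordSum R q f0 f0 * T d = ((q⁻¹ : Rˣ) : R) ^ invCount d • wordSum R q f0 (f0 ∘ ⇑d⁻¹) := by
  induction d using perm_induction with
  | one => rw [T_one, mul_one, invCount_one, pow_zero, one_smul]; rfl
  | step d i hdi ih =>
    have hlt : f0 (d⁻¹ (lo i)) < f0 (d⁻¹ (hi i)) := by
      refine (h0 hdi.le).lt_of_ne fun he => ?_
      have := hd _ _ he hdi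
      simp only [Equiv.Perm.mul_apply, perm_apply_inv, simpleSwap_lo, simpleSwap_hi] at this
      exact lt_asymm this (lo_lt_hi i)
    have hd' : RowIncreasing f0 d := by
      intro a b hab h
      have := hd a b hab h
      rw [Equiv.Perm.mul_apply, Equiv.Perm.mul_apply, simpleSwap_lt_iff] at this
      · exact this
      · rintro ⟨ha, hb⟩
        rw [← ha, ← hb, perm_inv_apply, perm_inv_apply] at hlt
        exact hlt.ne hab
      · rintro ⟨ha, hb⟩
        rw [← ha, ← hb, perm_inv_apply, perm_inv_apply] at hlt
        exact hlt.ne' hab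
    rw [← T_mul_gen hdi, ← mul_assoc, ih hd', smul_mul_assoc, wordSum_mul_gen_of_lt h0 hlt,
      smul_smul, invCount_simpleSwap_mul hdi, pow_succ, mul_inv_rev, simpleSwap_inv]
    rfl

end Words

end Hecke

namespace Hecke

variable {R : Type*} [CommRing R] {q : Rˣ} {n : ℕ}

/-! ## Two-sided ideals attached to monotone words -/

section Ideals

variable (R q) in
/-- The two-sided ideal generated by the elements `wordSum f f` for the monotone words `f`
that are pointwise smaller than `f0`. -/
noncomputable def idealAbove (f0 : Fin n → ℕ) : Submodule R (Hecke R q n) :=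
  Submodule.span R {x | ∃ f, Monotone f ∧ f < f0 ∧ ∃ a b, x = a * wordSum R q f f * b}

theorem mul_mem_idealAbove {f0 : Fin n → ℕ} {x : Hecke R q n} (hx : x ∈ idealAbove R q f0)
    (a b : Hecke R q n) : a * x * b ∈ idealAbove R q f0 := by
  induction hx using Submodule.span_induction with
  | mem x hx =>
    obtain ⟨f, hf, hf', a', b', rfl⟩ := hx
    exact Submodule.subset_span ⟨f, hf, hf', a * a', b' * b, by simp only [mul_assoc]⟩
  | zero => rw [mul_zero, zero_mul]; exact Submodule.zero_mem _
  | add x y _ _ hx hy => rw [mul_add, add_mul]; exact Submodule.add_mem _ hx hy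
  | smul r x _ hx => rw [mul_smul_comm, smul_mul_assoc]; exact Submodule.smul_mem _ _ hx

theorem mul_right_mem_idealAbove {f0 : Fin n → ℕ} {x : Hecke R q n}
    (hx : x ∈ idealAbove R q f0) (b : Hecke R q n) : x * b ∈ idealAbove R q f0 := by
  simpa using mul_mem_idealAbove hx 1 b

theorem mul_left_mem_idealAbove {f0 : Fin n → ℕ} {x : Hecke R q n}
    (hx : x ∈ idealAbove R q f0) (a : Hecke R q n) : a * x ∈ idealAbove R q f0 := by
  simpa using mul_mem_idealAbove hx a 1

theorem star_mem_idealAbove {f0 : Fin n → ℕ} {x : Hecke R q n}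
    (hx : x ∈ idealAbove R q f0) : star x ∈ idealAbove R q f0 := by
  induction hx using Submodule.span_induction with
  | mem x hx =>
    obtain ⟨f, hf, hf', a, b, rfl⟩ := hx
    refine Submodule.subset_span ⟨f, hf, hf', star b, star a, ?_⟩
    rw [star_mul, star_mul, star_wordSum, mul_assoc]
  | zero => rw [map_zero]; exact Submodule.zero_mem _
  | add x y _ _ hx hy => rw [map_add]; exact Submodule.add_mem _ hx hy
  | smul r x _ hx => rw [map_smul]; exact Submodule.smul_mem _ _ hx

theorem mem_of_unit_smul_mem {N : Type*} [AddCommGroup N] [Module R N] {P : Submodule R N}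
    {x : N} (u : Rˣ) (h : (u : R) • x ∈ P) : x ∈ P := by
  have := P.smul_mem ((u⁻¹ : Rˣ) : R) h
  rwa [smul_smul, Units.inv_mul, one_smul] at this

/-- If a set `E` of words is closed under the stabiliser of the monotone word `f`, the sum of
`wordSum f0 w` over `E` lies in the left ideal generated by `wordSum f f`. -/
theorem exists_mul_eq_sum_wordSum {f0 f : Fin n → ℕ} (hf : Monotone f)
    (E : Finset (Fin n → ℕ))
    (hE : ∀ w ∈ E, ∀ σ : Equiv.Perm (Fin n), f ∘ σ = f → w ∘ σ ∈ E) :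
    ∃ a, ∑ w ∈ E, wordSum R q f0 w = a * wordSum R q f f := by
  classical
  let S : Finset (Equiv.Perm (Fin n)) :=
    Finset.univ.filter fun p : Equiv.Perm (Fin n) => f0 ∘ ⇑p⁻¹ ∈ E
  -- The sum runs over the set `S` of all `p` with `f0 ∘ p⁻¹ ∈ E`. The closure of `E` makes `S` a
  -- union of full fibres of `p ↦ f ∘ p`, so the same sum can be regrouped as a sum of elements
  -- `wordSum R q g f`. Each of these is the image under `star` of an element of the right ideal of
  -- `wordSum R q f f`.
  have h1 : ∑ w ∈ E, wordSum R q f0 w = ∑ p ∈ S, weightedT R q n p := by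
    rw [← Finset.sum_fiberwise_of_maps_to (t := E) (g := fun p : Equiv.Perm (Fin n) => f0 ∘ ⇑p⁻¹)
      (fun p hp => (Finset.mem_filter.1 hp).2)]
    refine Finset.sum_congr rfl fun w hw => ?_
    rw [wordSum]
    refine Finset.sum_congr ?_ fun _ _ => rfl
    ext p
    rw [mem_matching, Finset.mem_filter, Finset.mem_filter]
    constructor
    · rintro rfl
      have : (w ∘ ⇑p) ∘ ⇑p⁻¹ = w := funext fun x => congrArg w (perm_apply_inv p x)
      rw [this]
      exact ⟨⟨Finset.mem_univ _, hw⟩, rfl⟩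
    · rintro ⟨_, rfl⟩
      exact funext fun x => congrArg f0 (perm_inv_apply p x)
  have h2 : ∀ p ∈ S, ∀ p' : Equiv.Perm (Fin n), f ∘ p' = f ∘ p → p' ∈ S := by
    intro p hp p' hpp
    rw [Finset.mem_filter] at hp ⊢
    refine ⟨Finset.mem_univ _, ?_⟩
    have := hE _ hp.2 (p * p'⁻¹) (by
      funext x
      have := congrFun hpp (p'⁻¹ x)
      simp only [Function.comp_apply, perm_apply_inv] at this
      simpa using this.symm)
    convert this using 1
    funext x
    simp only [Function.comp_apply, Equiv.Perm.mul_apply, perm_inv_apply]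
  have h3 : ∑ p ∈ S, weightedT R q n p =
      ∑ g ∈ S.image (fun p : Equiv.Perm (Fin n) => f ∘ p), wordSum R q g f := by
    rw [← Finset.sum_fiberwise_of_maps_to (t := S.image (fun p : Equiv.Perm (Fin n) => f ∘ p))
      (g := fun p : Equiv.Perm (Fin n) => f ∘ ⇑p) (fun p hp => Finset.mem_image_of_mem _ hp)]
    refine Finset.sum_congr rfl fun g hg => ?_
    rw [wordSum]
    refine Finset.sum_congr ?_ fun _ _ => rfl
    ext p
    rw [mem_matching, Finset.mem_filter]
    refine ⟨fun h => h.2, fun h => ⟨?_, h⟩⟩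
    obtain ⟨p', hp', rfl⟩ := Finset.mem_image.1 hg
    exact h2 p' hp' p h
  rw [h1, h3]
  have h4 : ∀ g ∈ S.image (fun p : Equiv.Perm (Fin n) => f ∘ p), ∃ a, wordSum R q g f = a * wordSum R q f f := by
    intro g hg
    obtain ⟨p, _, rfl⟩ := Finset.mem_image.1 hg
    obtain ⟨x, hx⟩ := exists_mul_eq_wordSum (R := R) (q := q) hf ((IsRearrangement.refl f).comp p)
    refine ⟨star x, ?_⟩
    rw [← star_wordSum, ← hx, star_mul, star_wordSum]
  choose! a ha using h4
  refine ⟨∑ g ∈ S.image (fun p : Equiv.Perm (Fin n) => f ∘ p), a g, ?_⟩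
  rw [Finset.sum_mul]
  exact Finset.sum_congr rfl ha

end Ideals

/-! ## Garnir sums -/

section Garnir

open Classical in
/-- The rearrangements of `f0` that agree with `f0` outside the window `[x, y)`. -/
noncomputable def windowWords (f0 : Fin n → ℕ) (x y : ℕ) : Finset (Fin n → ℕ) :=
  (Finset.univ.image fun p : Equiv.Perm (Fin n) => f0 ∘ p).filter
    fun w => ∀ i : Fin n, i.1 < x ∨ y ≤ i.1 → w i = f0 i

theorem mem_windowWords {f0 w : Fin n → ℕ} {x y : ℕ} : w ∈ windowWords f0 x y ↔
    IsRearrangement f0 w ∧ ∀ i : Fin n, i.1 < x ∨ y ≤ i.1 → w i = f0 i := by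
  rw [windowWords, Finset.mem_filter, Finset.mem_image]
  refine and_congr_left fun _ => ?_
  constructor
  · rintro ⟨p, _, rfl⟩
    exact (IsRearrangement.refl f0).comp p
  · intro h
    obtain ⟨p, hp⟩ := h.symm
    exact ⟨p, Finset.mem_univ _, hp⟩

/-- The letters `r` and `r + 1` occupy the positions `[s, t)` and `[t, z)` of the monotone
word `f0`. -/
structure IsBlock (f0 : Fin n → ℕ) (r s t z : ℕ) : Prop where
  le_mid : s ≤ t
  mid_le : t ≤ z
  le_card : z ≤ n
  of_lt : ∀ i : Fin n, i.1 < s → f0 i < r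
  of_left : ∀ i : Fin n, s ≤ i.1 → i.1 < t → f0 i = r
  of_right : ∀ i : Fin n, t ≤ i.1 → i.1 < z → f0 i = r + 1
  of_ge : ∀ i : Fin n, z ≤ i.1 → r + 1 < f0 i

theorem IsRearrangement.card_filter {f0 w : Fin n → ℕ} (h : IsRearrangement f0 w)
    (P : ℕ → Prop) [DecidablePred P] :
    (Finset.univ.filter fun i => P (w i)).card = (Finset.univ.filter fun i => P (f0 i)).card := by
  obtain ⟨p, rfl⟩ := h
  symm
  refine Finset.card_equiv p fun i => ?_
  simp

theorem card_window_eq {f0 w : Fin n → ℕ} {x y : ℕ} (h : w ∈ windowWords f0 x y) (c : ℕ) :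
    (Finset.univ.filter fun i : Fin n => (x ≤ i.1 ∧ i.1 < y) ∧ w i = c).card =
      (Finset.univ.filter fun i : Fin n => (x ≤ i.1 ∧ i.1 < y) ∧ f0 i = c).card := by
  rw [mem_windowWords] at h
  have h1 := h.1.card_filter (fun a => a = c)
  have split : ∀ g : Fin n → ℕ, (Finset.univ.filter fun i => g i = c).card =
      (Finset.univ.filter fun i : Fin n => (x ≤ i.1 ∧ i.1 < y) ∧ g i = c).card +
      (Finset.univ.filter fun i : Fin n => ¬ (x ≤ i.1 ∧ i.1 < y) ∧ g i = c).card := by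
    intro g
    rw [← Finset.card_filter_add_card_filter_not (fun i : Fin n => x ≤ i.1 ∧ i.1 < y),
      Finset.filter_filter, Finset.filter_filter]
    simp only [and_comm]
  rw [split w, split f0] at h1
  have h2 : (Finset.univ.filter fun i : Fin n => ¬ (x ≤ i.1 ∧ i.1 < y) ∧ w i = c) =
      (Finset.univ.filter fun i : Fin n => ¬ (x ≤ i.1 ∧ i.1 < y) ∧ f0 i = c) := by
    refine Finset.filter_congr fun i _ => and_congr_right fun hi => ?_
    rw [h.2 i (by omega)]
  rw [h2] at h1
  omega

theorem windowWords_letter {f0 w : Fin n → ℕ} {r s t z x y : ℕ} (hb : IsBlock f0 r s t z)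
    (hsx : s ≤ x) (hyz : y ≤ z) (h : w ∈ windowWords f0 x y) {i : Fin n} (hx : x ≤ i.1)
    (hy : i.1 < y) : w i = r ∨ w i = r + 1 := by
  have h1 := card_window_eq h (w i)
  have h2 : 0 < (Finset.univ.filter fun j : Fin n => (x ≤ j.1 ∧ j.1 < y) ∧ w j = w i).card :=
    Finset.card_pos.2 ⟨i, by simp [hx, hy]⟩
  rw [h1, Finset.card_pos] at h2
  obtain ⟨j, hj⟩ := h2
  simp only [Finset.mem_filter, Finset.mem_univ, true_and] at hj
  rw [← hj.2]
  rcases lt_or_ge j.1 t with hjt | hjt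
  · exact Or.inl (hb.of_left j (by omega) hjt)
  · exact Or.inr (hb.of_right j hjt (by omega))

theorem windowWords_mono (f0 : Fin n → ℕ) {x y x' y' : ℕ} (hx : x ≤ x') (hy : y' ≤ y) :
    windowWords f0 x' y' ⊆ windowWords f0 x y := by
  intro w hw
  rw [mem_windowWords] at hw ⊢
  exact ⟨hw.1, fun i hi => hw.2 i (by omega)⟩

variable (R q) in
/-- The sum, over the window words with letter `r + 1` in position `k`, weighted by the number
of letters `r + 1` behind position `k` in the window. -/
noncomputable def shiftedSum (f0 : Fin n → ℕ) (r x y : ℕ) (k : Fin n) : Hecke R q n :=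
  ∑ w ∈ (windowWords f0 x y).filter (fun w => w k = r + 1),
    (q : R) ^ (2 * (Finset.univ.filter fun i : Fin n => (k < i ∧ i.1 < y) ∧ w i = r + 1).card) •
      wordSum R q f0 w

/-- If the letter before is `r`, the generator moves `r + 1` to the left with factor `q⁻¹` and no
change of weight. If it is also `r + 1`, the word is an eigenvector with eigenvalue `q = q⁻¹ q²`,
and one more letter `r + 1` is counted behind the new position; the weight base `q²` is chosen for
this. -/
theorem shiftedSum_mul_gen {f0 : Fin n → ℕ} (h0 : Monotone f0) {r s t z x y : ℕ}
    (hb : IsBlock f0 r s t z) (hsx : s ≤ x) (hyz : y ≤ z) (i : Fin (n - 1)) (hx : x ≤ i.1)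
    (hy : i.1 + 1 < y) :
    shiftedSum R q f0 r x y (hi i) * gen i =
      ((q⁻¹ : Rˣ) : R) • shiftedSum R q f0 r x y (lo i) := by
  have hlo : (lo i).1 = i.1 := rfl
  have hhi : (hi i).1 = i.1 + 1 := rfl
  rw [shiftedSum, shiftedSum, Finset.sum_mul, Finset.smul_sum]
  have hmem : ∀ w ∈ windowWords f0 x y, w ∘ simpleSwap i ∈ windowWords f0 x y := by
    intro w hw
    rw [mem_windowWords] at hw ⊢
    refine ⟨hw.1.comp _, fun j hj => ?_⟩
    rw [Function.comp_apply, simpleSwap_of_ne, hw.2 j hj]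
    · rintro rfl; omega
    · rintro rfl; omega
  refine Finset.sum_bij' (fun w _ => w ∘ simpleSwap i) (fun w _ => w ∘ simpleSwap i) ?_ ?_ ?_ ?_ ?_
  · intro w hw
    rw [Finset.mem_filter] at hw ⊢
    exact ⟨hmem w hw.1, by rw [Function.comp_apply, simpleSwap_lo, hw.2]⟩
  · intro w hw
    rw [Finset.mem_filter] at hw ⊢
    exact ⟨hmem w hw.1, by rw [Function.comp_apply, simpleSwap_hi, hw.2]⟩
  · intro w _; exact comp_simpleSwap_comp w i
  · intro w _; exact comp_simpleSwap_comp w i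
  · intro w hw
    rw [Finset.mem_filter] at hw
    have hcount : ∀ j, hi i < j → (w ∘ simpleSwap i) j = w j := by
      intro j hj
      rw [Function.comp_apply, simpleSwap_of_ne (((lo_lt_hi i).trans hj).ne') hj.ne']
    have hgt : ∀ j, lo i < j ↔ j = hi i ∨ hi i < j := by
      intro j
      rw [Fin.lt_def, Fin.lt_def, Fin.ext_iff, hlo, hhi]
      omega
    rw [smul_mul_assoc]
    rcases windowWords_letter hb hsx hyz hw.1 (i := lo i) (by omega) (by omega) with h | h
    · have hc : (Finset.univ.filter fun j : Fin n => (hi i < j ∧ j.1 < y) ∧ w j = r + 1) =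
          Finset.univ.filter fun j : Fin n =>
            (lo i < j ∧ j.1 < y) ∧ (w ∘ simpleSwap i) j = r + 1 := by
        refine Finset.filter_congr fun j _ => ?_
        rw [hgt]
        constructor
        · rintro ⟨⟨hj, hj'⟩, hj2⟩
          exact ⟨⟨Or.inr hj, hj'⟩, by rw [hcount j hj, hj2]⟩
        · rintro ⟨⟨rfl | hj, hj'⟩, hj2⟩
          · rw [Function.comp_apply, simpleSwap_hi, h] at hj2; omega
          · exact ⟨⟨hj, hj'⟩, by rw [← hcount j hj, hj2]⟩
      rw [wordSum_mul_gen_of_lt h0 (by rw [h, hw.2]; omega), smul_comm, hc]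
    · have hs : w ∘ simpleSwap i = w := by
        funext j
        by_cases h1 : j = lo i
        · rw [h1, Function.comp_apply, simpleSwap_lo, h, hw.2]
        by_cases h2 : j = hi i
        · rw [h2, Function.comp_apply, simpleSwap_hi, h, hw.2]
        · rw [Function.comp_apply, simpleSwap_of_ne h1 h2]
      rw [hs, wordSum_mul_gen_of_eq (by rw [h, hw.2])]
      have hc : (Finset.univ.filter fun j : Fin n => (lo i < j ∧ j.1 < y) ∧ w j = r + 1) =
          insert (hi i) (Finset.univ.filter fun j : Fin n => (hi i < j ∧ j.1 < y) ∧ w j = r + 1) := by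
        ext j
        simp only [Finset.mem_filter, Finset.mem_univ, true_and, Finset.mem_insert, hgt]
        constructor
        · rintro ⟨⟨rfl | hj, hj'⟩, hj2⟩
          · exact Or.inl rfl
          · exact Or.inr ⟨⟨hj, hj'⟩, hj2⟩
        · rintro (rfl | ⟨⟨hj, hj'⟩, hj2⟩)
          · exact ⟨⟨Or.inl rfl, by omega⟩, hw.2⟩
          · exact ⟨⟨Or.inr hj, hj'⟩, hj2⟩
      rw [hc, Finset.card_insert_of_notMem (by simp), smul_smul, smul_smul]
      congr 1
      rw [mul_add, pow_add, mul_left_comm, mul_one, pow_two, ← mul_assoc ((q⁻¹ : Rˣ) : R),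
        Units.inv_mul, one_mul]

variable (R) in
/-- The Garnir sum of a window. -/
noncomputable def garnirSum (f0 : Fin n → ℕ) (x y : ℕ) : (Fin n → ℕ) →₀ R :=
  ∑ w ∈ windowWords f0 x y, Finsupp.single w 1

theorem wordLin_garnirSum (f0 : Fin n → ℕ) (x y : ℕ) :
    wordLin R q f0 (garnirSum R f0 x y) = ∑ w ∈ windowWords f0 x y, wordSum R q f0 w := by
  rw [garnirSum, map_sum]
  exact Finset.sum_congr rfl fun w _ => wordLin_single f0 w

/-- The inequality says that the window is longer than the row of the letter `r`. Induction on the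
left end of the window: a window that contains the whole row is a coset sum for a larger Young
subgroup. To shrink `[x, y)` to `[x + 1, y)`, remove the words with `r + 1` at position `x`; their
sum is obtained, up to a unit, from the window `[x, y - 1)` by moving its trailing letter `r + 1` to
the front with generators. -/
theorem wordLin_garnirSum_mem {f0 : Fin n → ℕ} (h0 : Monotone f0) {r s t z x y : ℕ}
    (hb : IsBlock f0 r s t z) (hsx : s ≤ x) (hxt : x ≤ t) (hty : t ≤ y) (hyz : y ≤ z)
    (hlt : x + t < y + s) : wordLin R q f0 (garnirSum R f0 x y) ∈ idealAbove R q f0 := by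
  have hst := hb.le_mid
  have hzn := hb.le_card
  rw [wordLin_garnirSum]
  induction x, hsx using Nat.le_induction generalizing y with
  | base =>
    -- In `f` the letter `r` occupies exactly the window `[s, y)`, so the stabiliser of `f`
    -- preserves the set of window words. The inequality forces `t < y`, hence `f < f0`.
    let f : Fin n → ℕ := fun i => if t ≤ i.1 ∧ i.1 < y then r else f0 i
    have hf : Monotone f := by
      intro i j hij
      have hij' : i.1 ≤ j.1 := hij
      have := h0 hij
      simp only [f]
      by_cases h1 : t ≤ i.1 ∧ i.1 < y <;> by_cases h2 : t ≤ j.1 ∧ j.1 < y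
      · rw [if_pos h1, if_pos h2]
      · rw [if_pos h1, if_neg h2]
        have := hb.of_right i h1.1 (by omega)
        omega
      · rw [if_neg h1, if_pos h2]
        rcases lt_or_ge i.1 s with h | h
        · exact (hb.of_lt i h).le
        · exact (hb.of_left i h (by omega)).le
      · rwa [if_neg h1, if_neg h2]
    have hlt : f < f0 := by
      rw [Pi.lt_def]
      refine ⟨fun i => ?_, ⟨t, by omega⟩, ?_⟩
      · simp only [f]
        split_ifs with h
        · have := hb.of_right i h.1 (by omega); omega
        · exact le_rfl
      · simp only [f]
        rw [if_pos ⟨le_rfl, by omega⟩, hb.of_right _ le_rfl (by simp only; omega)]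
        exact Nat.lt_succ_self r
    obtain ⟨a, ha⟩ := exists_mul_eq_sum_wordSum (R := R) (q := q) (f0 := f0) hf
      (windowWords f0 s y) (by
        intro w hw σ hσ
        rw [mem_windowWords] at hw ⊢
        refine ⟨hw.1.comp σ, fun i hi => ?_⟩
        have h1 : f i = f0 i := if_neg (by omega)
        have h2 : f0 i ≠ r := by
          rcases hi with hi | hi
          · exact (hb.of_lt i hi).ne
          · rcases lt_or_ge i.1 z with h | h
            · rw [hb.of_right i (by omega) h]; omega
            · have := hb.of_ge i h; omega
        have h3 : f (σ i) = f0 i := (congrFun hσ i).trans h1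
        have h4 : ¬ (s ≤ (σ i).1 ∧ (σ i).1 < y) := by
          rintro ⟨h, h'⟩
          rcases lt_or_ge (σ i).1 t with h5 | h5
          · have h6 : f (σ i) = f0 (σ i) := if_neg (by omega)
            rw [h6, hb.of_left _ h h5] at h3
            exact h2 h3.symm
          · have h6 : f (σ i) = r := if_pos ⟨h5, h'⟩
            exact h2 (h3.symm.trans h6)
        have h6 : f (σ i) = f0 (σ i) := if_neg (by omega)
        rw [Function.comp_apply, hw.2 _ (by omega), ← h6, h3])
    rw [ha]
    exact Submodule.subset_span ⟨f, hf, hlt, a, 1, (mul_one _).symm⟩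
  | succ x hsx ih =>
    have hxn : x < n := by omega
    have hyn : y - 1 < n := by omega
    -- the words with letter `r + 1` in the last position of the window
    have hlast : shiftedSum R q f0 r x y ⟨y - 1, hyn⟩ ∈ idealAbove R q f0 := by
      have h1 := ih (by omega) (y := y - 1) (by omega) (by omega) (by omega)
      convert h1 using 1
      rw [shiftedSum]
      refine Finset.sum_congr ?_ ?_
      · ext w
        rw [Finset.mem_filter]
        constructor
        · rintro ⟨hw, hw'⟩
          rw [mem_windowWords] at hw ⊢
          refine ⟨hw.1, fun i hi => ?_⟩
          by_cases h : i.1 = y - 1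
          · have : i = ⟨y - 1, hyn⟩ := Fin.ext h
            rw [this, hw', hb.of_right _ (by simp only; omega) (by simp only; omega)]
          · exact hw.2 i (by omega)
        · intro hw
          refine ⟨windowWords_mono f0 le_rfl (by omega) hw, ?_⟩
          rw [mem_windowWords] at hw
          rw [hw.2 _ (Or.inr le_rfl), hb.of_right _ (by simp only; omega) (by simp only; omega)]
      · intro w _
        have : (Finset.univ.filter fun i : Fin n =>
            ((⟨y - 1, hyn⟩ : Fin n) < i ∧ i.1 < y) ∧ w i = r + 1) = ∅ := by
          rw [Finset.filter_eq_empty_iff]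
          rintro i _ ⟨⟨h1, h2⟩, _⟩
          rw [Fin.lt_def] at h1
          simp only at h1
          omega
        rw [this, Finset.card_empty, mul_zero, pow_zero, one_smul]
    -- The marked letter `r + 1` travels from the last position of the window to the first, one
    -- generator at a time.
    have hall : ∀ d k (hk : k < n), k + d = y - 1 → x ≤ k →
        shiftedSum R q f0 r x y ⟨k, hk⟩ ∈ idealAbove R q f0 := by
      intro d
      induction d with
      | zero =>
        intro k hk hkd _
        have : (⟨k, hk⟩ : Fin n) = ⟨y - 1, hyn⟩ := Fin.ext (by simpa using hkd)
        rw [this]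
        exact hlast
      | succ d ihd =>
        intro k hk hkd hxk
        have h1 := ihd (k + 1) (by omega) (by omega) (by omega)
        have h2 := shiftedSum_mul_gen (R := R) (q := q) h0 hb hsx hyz ⟨k, by omega⟩ hxk
          (by simp only; omega)
        refine mem_of_unit_smul_mem q⁻¹ ?_
        change ((q⁻¹ : Rˣ) : R) • shiftedSum R q f0 r x y (lo ⟨k, by omega⟩) ∈ _
        rw [← h2]
        exact mul_right_mem_idealAbove h1 _
    have hfirst := hall (y - 1 - x) x hxn (by omega) le_rfl
    -- With the marked letter in the first position of the window, all other letters `r + 1` of the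
    -- window lie behind it. The weights are then one common power of `q`, which can be divided out.
    have hconst : ∀ w ∈ (windowWords f0 x y).filter (fun w => w ⟨x, hxn⟩ = r + 1),
        (Finset.univ.filter fun i : Fin n =>
          ((⟨x, hxn⟩ : Fin n) < i ∧ i.1 < y) ∧ w i = r + 1).card + 1 =
        (Finset.univ.filter fun i : Fin n => (x ≤ i.1 ∧ i.1 < y) ∧ f0 i = r + 1).card := by
      intro w hw
      rw [Finset.mem_filter] at hw
      rw [← card_window_eq hw.1, ← Finset.card_insert_of_notMem (a := (⟨x, hxn⟩ : Fin n)) (by simp)]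
      congr 1
      ext i
      simp only [Finset.mem_filter, Finset.mem_univ, true_and, Finset.mem_insert, Fin.lt_def,
        Fin.ext_iff]
      constructor
      · rintro (h | h)
        · have : i = ⟨x, hxn⟩ := Fin.ext h
          refine ⟨⟨by omega, by omega⟩, this ▸ hw.2⟩
        · exact ⟨⟨by omega, h.1.2⟩, h.2⟩
      · intro h
        by_cases hi : i.1 = x
        · exact Or.inl hi
        · exact Or.inr ⟨⟨by omega, h.1.2⟩, h.2⟩
    have hsecond : ∑ w ∈ (windowWords f0 x y).filter (fun w => w ⟨x, hxn⟩ = r + 1),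
        wordSum R q f0 w ∈ idealAbove R q f0 := by
      set N := (Finset.univ.filter fun i : Fin n => (x ≤ i.1 ∧ i.1 < y) ∧ f0 i = r + 1).card
      refine mem_of_unit_smul_mem (q ^ (2 * (N - 1))) ?_
      convert hfirst using 1
      rw [shiftedSum, Finset.smul_sum]
      refine Finset.sum_congr rfl fun w hw => ?_
      rw [Units.val_pow_eq_pow_val, ← hconst w hw, Nat.add_sub_cancel]
    have htotal := ih (by omega) hty hyz (by omega)
    rw [← Finset.sum_filter_add_sum_filter_not _ (fun w => w ⟨x, hxn⟩ = r + 1)] at htotal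
    have := Submodule.sub_mem _ htotal hsecond
    rw [add_sub_cancel_left] at this
    convert this using 1
    refine Finset.sum_congr ?_ fun _ _ => rfl
    ext w
    rw [Finset.mem_filter]
    have hx0 := hb.of_left ⟨x, hxn⟩ (by simp only; omega) (by simp only; omega)
    constructor
    · intro hw
      refine ⟨windowWords_mono f0 (by omega) le_rfl hw, ?_⟩
      rw [mem_windowWords] at hw
      rw [hw.2 _ (Or.inl (Nat.lt_succ_self x)), hx0]
      omega
    · rintro ⟨hw, hw'⟩
      have h1 := (windowWords_letter hb hsx hyz hw (i := ⟨x, hxn⟩) le_rfl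
        (by simp only; omega)).resolve_right hw'
      rw [mem_windowWords] at hw ⊢
      refine ⟨hw.1, fun i hi => ?_⟩
      by_cases h : i.1 = x
      · have : i = ⟨x, hxn⟩ := Fin.ext h
        rw [this, h1, hx0]
      · exact hw.2 i (by omega)

end Garnir

end Hecke

namespace Hecke

variable {R : Type*} [CommRing R] {q : Rˣ} {n : ℕ}

/-! ## Dominance order on words and straightening -/

section Dominance

/-- The number of letters smaller than `c` among the first `k` letters. -/
def countLt (f : Fin n → ℕ) (k c : ℕ) : ℕ :=
  (Finset.univ.filter fun i : Fin n => i.1 < k ∧ f i < c).card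

/-- The number of letters `c` among the first `k` letters. -/
def countEq (f : Fin n → ℕ) (k c : ℕ) : ℕ :=
  (Finset.univ.filter fun i : Fin n => i.1 < k ∧ f i = c).card

/-- The word `g` dominates the word `f`. -/
def Dominates (g f : Fin n → ℕ) : Prop := ∀ k c, countLt f k c ≤ countLt g k c

/-- In every initial segment, every letter occurs at least as often as the next one. -/
def IsLattice (f : Fin n → ℕ) : Prop := ∀ k c, countEq f k (c + 1) ≤ countEq f k c

theorem Dominates.refl (f : Fin n → ℕ) : Dominates f f := fun _ _ => le_rfl

theorem Dominates.trans {f g h : Fin n → ℕ} (h1 : Dominates f g) (h2 : Dominates g h) :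
    Dominates f h := fun k c => (h2 k c).trans (h1 k c)

theorem card_filter_lt_succ (P : Fin n → Prop) [DecidablePred P] {k : ℕ} (hk : k < n) :
    (Finset.univ.filter fun i : Fin n => i.1 < k + 1 ∧ P i).card =
      (Finset.univ.filter fun i : Fin n => i.1 < k ∧ P i).card +
        if P ⟨k, hk⟩ then 1 else 0 := by
  split_ifs with h
  · rw [← Finset.card_insert_of_notMem (a := (⟨k, hk⟩ : Fin n)) (by simp)]
    congr 1
    ext i
    simp only [Finset.mem_filter, Finset.mem_univ, true_and, Finset.mem_insert, Fin.ext_iff]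
    constructor
    · rintro ⟨h1, h2⟩
      by_cases hi : i.1 = k
      · exact Or.inl hi
      · exact Or.inr ⟨by omega, h2⟩
    · rintro (h1 | h1)
      · have : i = ⟨k, hk⟩ := Fin.ext h1
        exact ⟨by omega, this ▸ h⟩
      · exact ⟨by omega, h1.2⟩
  · rw [add_zero]
    congr 1
    refine Finset.filter_congr fun i _ => ⟨?_, fun h1 => ⟨by omega, h1.2⟩⟩
    rintro ⟨h1, h2⟩
    refine ⟨?_, h2⟩
    by_contra hi
    have : i = ⟨k, hk⟩ := Fin.ext (by simp only; omega)
    exact h (this ▸ h2)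

theorem countLt_succ (f : Fin n → ℕ) {k : ℕ} (hk : k < n) (c : ℕ) :
    countLt f (k + 1) c = countLt f k c + if f ⟨k, hk⟩ < c then 1 else 0 :=
  card_filter_lt_succ (fun i => f i < c) hk

theorem countEq_succ (f : Fin n → ℕ) {k : ℕ} (hk : k < n) (c : ℕ) :
    countEq f (k + 1) c = countEq f k c + if f ⟨k, hk⟩ = c then 1 else 0 :=
  card_filter_lt_succ (fun i => f i = c) hk

theorem card_filter_comp_simpleSwap (f : Fin n → ℕ) (P : ℕ → Prop) [DecidablePred P]
    (i : Fin (n - 1)) {k : ℕ} (hk : k ≠ i.1 + 1) :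
    (Finset.univ.filter fun j : Fin n => j.1 < k ∧ P ((f ∘ simpleSwap i) j)).card =
      (Finset.univ.filter fun j : Fin n => j.1 < k ∧ P (f j)).card := by
  refine Finset.card_equiv (simpleSwap i) fun j => ?_
  simp only [Finset.mem_filter, Finset.mem_univ, true_and, Function.comp_apply]
  refine and_congr_left fun _ => ?_
  rw [simpleSwap_val]
  split_ifs <;> omega

theorem countLt_comp_simpleSwap (f : Fin n → ℕ) (i : Fin (n - 1)) {k : ℕ} (hk : k ≠ i.1 + 1)
    (c : ℕ) : countLt (f ∘ simpleSwap i) k c = countLt f k c :=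
  card_filter_comp_simpleSwap f (· < c) i hk

theorem countEq_comp_simpleSwap (f : Fin n → ℕ) (i : Fin (n - 1)) {k : ℕ} (hk : k ≠ i.1 + 1)
    (c : ℕ) : countEq (f ∘ simpleSwap i) k c = countEq f k c :=
  card_filter_comp_simpleSwap f (· = c) i hk

theorem countLt_lo (f : Fin n → ℕ) (i : Fin (n - 1)) (c : ℕ) :
    countLt f (i.1 + 1) c = countLt f i.1 c + if f (lo i) < c then 1 else 0 :=
  countLt_succ f (lo i).2 c

theorem countLt_hi (f : Fin n → ℕ) (i : Fin (n - 1)) (c : ℕ) :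
    countLt f (i.1 + 1 + 1) c = countLt f (i.1 + 1) c + if f (hi i) < c then 1 else 0 :=
  countLt_succ f (hi i).2 c

theorem countLt_comp_simpleSwap_self (f : Fin n → ℕ) (i : Fin (n - 1)) (c : ℕ) :
    countLt (f ∘ simpleSwap i) (i.1 + 1) c = countLt f i.1 c + if f (hi i) < c then 1 else 0 := by
  rw [countLt_lo, countLt_comp_simpleSwap f i (by omega), Function.comp_apply, simpleSwap_lo]

theorem Dominates.antisymm {f g : Fin n → ℕ} (h1 : Dominates f g) (h2 : Dominates g f) :
    f = g := by
  have h : ∀ k c, countLt f k c = countLt g k c := fun k c => le_antisymm (h2 k c) (h1 k c)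
  have h3 : ∀ (i : Fin n) (c : ℕ), f i < c ↔ g i < c := by
    intro i c
    have e := h (i.1 + 1) c
    rw [countLt_succ f i.2, countLt_succ g i.2, h i.1 c] at e
    simp only [Fin.eta] at e
    split_ifs at e <;> omega
  funext i
  have a1 := (h3 i (f i + 1)).1 (Nat.lt_succ_self _)
  have a2 := (h3 i (g i + 1)).2 (Nat.lt_succ_self _)
  omega

theorem dominates_comp_simpleSwap {v : Fin n → ℕ} {i : Fin (n - 1)} (h : v (lo i) < v (hi i)) :
    Dominates v (v ∘ simpleSwap i) := by
  intro k c
  by_cases hk : k = i.1 + 1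
  · rw [hk, countLt_comp_simpleSwap_self, countLt_lo]
    split_ifs <;> omega
  · exact (countLt_comp_simpleSwap v i hk c).le

theorem not_dominates_comp_simpleSwap {v : Fin n → ℕ} {i : Fin (n - 1)}
    (h : v (lo i) < v (hi i)) : ¬ Dominates (v ∘ simpleSwap i) v := by
  intro hd
  have := hd (i.1 + 1) (v (hi i))
  rw [countLt_comp_simpleSwap_self, countLt_lo, if_pos h, if_neg (lt_irrefl _)] at this
  omega

/-- Only the prefix of length `i + 1` is affected, and there the inequality follows from those for
the lengths `i` and `i + 2`, because `v` rises at `i`. Nothing is needed about `t` at `i`. -/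
theorem Dominates.comp_simpleSwap {t v : Fin n → ℕ} {i : Fin (n - 1)} (ht : Dominates t v)
    (h : v (lo i) < v (hi i)) : Dominates (t ∘ simpleSwap i) (v ∘ simpleSwap i) := by
  intro k c
  by_cases hk : k = i.1 + 1
  · rw [hk, countLt_comp_simpleSwap_self, countLt_comp_simpleSwap_self]
    have h1 := ht i.1 c
    have h2 := ht (i.1 + 1 + 1) c
    rw [countLt_hi, countLt_hi, countLt_lo, countLt_lo] at h2
    split_ifs at h2 ⊢ <;> omega
  · rw [countLt_comp_simpleSwap v i hk, countLt_comp_simpleSwap t i hk]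
    exact ht k c

theorem countLt_add_countEq (f : Fin n → ℕ) (k c : ℕ) :
    countLt f k (c + 1) = countLt f k c + countEq f k c := by
  rw [countLt, countLt, countEq, ← Finset.card_union_of_disjoint]
  · congr 1
    ext i
    simp only [Finset.mem_filter, Finset.mem_univ, true_and, Finset.mem_union]
    omega
  · rw [Finset.disjoint_left]
    intro i
    simp only [Finset.mem_filter, Finset.mem_univ, true_and]
    omega

theorem countEq_mono (f : Fin n → ℕ) (c : ℕ) {k k' : ℕ} (h : k ≤ k') :
    countEq f k c ≤ countEq f k' c := by
  refine Finset.card_le_card fun i => ?_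
  simp only [Finset.mem_filter, Finset.mem_univ, true_and]
  omega

theorem card_interval {a b : ℕ} (hb : b ≤ n) :
    (Finset.univ.filter fun i : Fin n => a ≤ i.1 ∧ i.1 < b).card = b - a := by
  rw [← Nat.card_Ico]
  refine Finset.card_nbij (fun i => i.1) ?_ ?_ ?_
  · intro i hi
    simpa using hi
  · intro i _ j _ hij
    exact Fin.ext hij
  · intro k hk
    simp only [Finset.coe_Ico, Set.mem_Ico] at hk
    exact ⟨⟨k, by omega⟩, by simpa using hk, rfl⟩

/-- In an interval on which a word is weakly increasing, the letters smaller than `c` form an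
initial segment. -/
theorem lt_iff_of_monotoneOn {f : Fin n → ℕ} {a b : ℕ}
    (hf : ∀ i j : Fin n, a ≤ i.1 → i ≤ j → j.1 < b → f i ≤ f j) {i : Fin n} (hai : a ≤ i.1)
    (hib : i.1 < b) (c : ℕ) :
    f i < c ↔ i.1 < a + (Finset.univ.filter fun j : Fin n =>
      (a ≤ j.1 ∧ j.1 < b) ∧ f j < c).card := by
  constructor
  · intro h
    have h1 : (Finset.univ.filter fun j : Fin n => a ≤ j.1 ∧ j.1 < i.1 + 1) ⊆
        Finset.univ.filter fun j : Fin n => (a ≤ j.1 ∧ j.1 < b) ∧ f j < c := by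
      intro j hj
      simp only [Finset.mem_filter, Finset.mem_univ, true_and] at hj ⊢
      exact ⟨⟨hj.1, by omega⟩, (hf j i hj.1 (Fin.le_def.2 (by omega)) hib).trans_lt h⟩
    have h2 := Finset.card_le_card h1
    rw [card_interval (by omega)] at h2
    omega
  · intro h
    by_contra hc
    have h1 : (Finset.univ.filter fun j : Fin n => (a ≤ j.1 ∧ j.1 < b) ∧ f j < c) ⊆
        Finset.univ.filter fun j : Fin n => a ≤ j.1 ∧ j.1 < i.1 := by
      intro j hj
      simp only [Finset.mem_filter, Finset.mem_univ, true_and] at hj ⊢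
      refine ⟨hj.1.1, ?_⟩
      by_contra hji
      exact hc ((hf i j hai (Fin.le_def.2 (by omega)) hj.1.2).trans_lt hj.2)
    have h2 := Finset.card_le_card h1
    rw [card_interval (by omega)] at h2
    omega

theorem card_interval_countLt (f : Fin n → ℕ) {a b : ℕ} (hab : a ≤ b) (c : ℕ) :
    countLt f a c + (Finset.univ.filter fun j : Fin n => (a ≤ j.1 ∧ j.1 < b) ∧ f j < c).card =
      countLt f b c := by
  rw [countLt, countLt, ← Finset.card_union_of_disjoint]
  · congr 1
    ext i
    simp only [Finset.mem_filter, Finset.mem_univ, true_and, Finset.mem_union]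
    omega
  · rw [Finset.disjoint_left]
    intro i
    simp only [Finset.mem_filter, Finset.mem_univ, true_and]
    omega

theorem Monotone.lt_iff_countLt {f0 : Fin n → ℕ} (h0 : Monotone f0) (i : Fin n) (c : ℕ) :
    f0 i < c ↔ i.1 < countLt f0 n c := by
  rw [lt_iff_of_monotoneOn (b := n) (fun i j _ hij _ => h0 hij) (Nat.zero_le i.1) i.2]
  have := card_interval_countLt f0 (Nat.zero_le n) c
  have h1 : countLt f0 0 c = 0 := by simp [countLt]
  rw [h1] at this
  rw [this]

theorem IsRearrangement.countLt_eq {f0 f : Fin n → ℕ} (h : IsRearrangement f0 f) (c : ℕ) :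
    countLt f n c = countLt f0 n c := by
  simpa [countLt] using h.card_filter (· < c)

theorem Monotone.eq_of_countLt_eq {f0 f : Fin n → ℕ} (h0 : Monotone f0) (hf : Monotone f)
    (h : ∀ c, countLt f n c = countLt f0 n c) : f = f0 := by
  funext i
  have h1 : ∀ c, f i < c ↔ f0 i < c := fun c => by
    rw [Monotone.lt_iff_countLt hf, Monotone.lt_iff_countLt h0, h]
  have a1 := (h1 (f i + 1)).1 (Nat.lt_succ_self _)
  have a2 := (h1 (f0 i + 1)).2 (Nat.lt_succ_self _)
  omega

theorem Monotone.eq_of_isRearrangement {f0 f : Fin n → ℕ} (h0 : Monotone f0) (hf : Monotone f)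
    (h : IsRearrangement f0 f) : f = f0 := Monotone.eq_of_countLt_eq h0 hf h.countLt_eq

theorem countLt_le (f : Fin n → ℕ) (k c : ℕ) (hk : k ≤ n) : countLt f k c ≤ k := by
  have : countLt f k c ≤ (Finset.univ.filter fun i : Fin n => 0 ≤ i.1 ∧ i.1 < k).card := by
    refine Finset.card_le_card fun i => ?_
    simp only [Finset.mem_filter, Finset.mem_univ, true_and]
    omega
  rwa [card_interval hk] at this

theorem Monotone.isBlock {f0 : Fin n → ℕ} (h0 : Monotone f0) (r : ℕ) :
    IsBlock f0 r (countLt f0 n r) (countLt f0 n (r + 1)) (countLt f0 n (r + 2)) where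
  le_mid := by rw [countLt_add_countEq]; exact Nat.le_add_right _ _
  mid_le := by rw [countLt_add_countEq f0 n (r + 1)]; exact Nat.le_add_right _ _
  le_card := countLt_le f0 n _ le_rfl
  of_lt i hi := (Monotone.lt_iff_countLt h0 i r).2 hi
  of_left i h1 h2 := by
    rw [← Monotone.lt_iff_countLt h0] at h2
    rw [← not_lt, ← Monotone.lt_iff_countLt h0] at h1
    omega
  of_right i h1 h2 := by
    rw [← Monotone.lt_iff_countLt h0] at h2
    rw [← not_lt, ← Monotone.lt_iff_countLt h0] at h1
    omega
  of_ge i h1 := by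
    rw [← not_lt, ← Monotone.lt_iff_countLt h0] at h1
    omega

theorem le_of_lo_le_hi_on {f : Fin n → ℕ} {a b : ℕ}
    (h : ∀ i : Fin (n - 1), a ≤ i.1 → i.1 + 1 < b → f (lo i) ≤ f (hi i)) :
    ∀ i j : Fin n, a ≤ i.1 → i ≤ j → j.1 < b → f i ≤ f j := by
  intro i j hai hij hjb
  obtain ⟨d, hd⟩ := Nat.exists_eq_add_of_le (Fin.le_def.1 hij)
  induction d generalizing j with
  | zero => exact (congrArg f (Fin.ext (by omega))).le
  | succ d ih =>
    have hj := j.2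
    have h1 := ih ⟨i.1 + d, by omega⟩ (Fin.le_def.2 (by simp)) (by simp only; omega) rfl
    have h2 := h ⟨i.1 + d, by omega⟩ (by simp only; omega) (by simp only; omega)
    refine h1.trans (h2.trans (congrArg f (Fin.ext ?_)).le)
    simp only [hi]
    omega

/-- A word that is weakly increasing on both sides of position `k`, where the letters `r + 1`
and `r` meet after the `j`-th letter `r + 1` and before the `j`-th letter `r`, is the most
decreasing word of a window. -/
theorem mem_windowWords_of_cut {f0 f : Fin n → ℕ} (h0 : Monotone f0) (hf : IsRearrangement f0 f)
    {r j k : ℕ} (hk0 : 0 < k) (hkn : k ≤ n)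
    (hleft : ∀ i i' : Fin n, i ≤ i' → i'.1 < k → f i ≤ f i')
    (hright : ∀ i i' : Fin n, k ≤ i.1 → i ≤ i' → f i ≤ f i')
    (hlast : f ⟨k - 1, by omega⟩ = r + 1) (hge : ∀ i : Fin n, k ≤ i.1 → r ≤ f i)
    (hr : countEq f k r + 1 = j) (hr1 : countEq f k (r + 1) = j) :
    ∃ x y, countLt f0 n r ≤ x ∧ x ≤ countLt f0 n (r + 1) ∧ countLt f0 n (r + 1) ≤ y ∧
      y ≤ countLt f0 n (r + 2) ∧ x + countLt f0 n (r + 1) < y + countLt f0 n r ∧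
      f ∈ windowWords f0 x y ∧ ∀ g ∈ windowWords f0 x y, Dominates g f := by
  have hb := Monotone.isBlock h0 r
  have hfull : ∀ c ≤ r, countLt f k c = countLt f0 n c := by
    intro c hc
    rw [← hf.countLt_eq]
    refine congrArg Finset.card (Finset.filter_congr fun i _ => and_congr_left fun h => ?_)
    refine ⟨fun _ => i.2, fun _ => ?_⟩
    by_contra hki
    have := hge i (by omega)
    omega
  have hle : ∀ i : Fin n, i.1 < k → f i ≤ r + 1 := by
    intro i hi
    rw [← hlast]
    exact hleft _ _ (Fin.le_def.2 (by simp only; omega)) (by simp only; omega)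
  have hk1 : ∀ c, r + 2 ≤ c → countLt f k c = k := by
    intro c hc
    have : countLt f k c = (Finset.univ.filter fun i : Fin n => 0 ≤ i.1 ∧ i.1 < k).card := by
      refine congrArg Finset.card (Finset.filter_congr fun i _ => ?_)
      refine ⟨fun h => ⟨Nat.zero_le _, h.1⟩, fun h => ⟨h.2, ?_⟩⟩
      have := hle i h.2
      omega
    rw [this, card_interval hkn, Nat.sub_zero]
  have e1 := countLt_add_countEq f k r
  have e2 : countLt f k (r + 2) = _ := countLt_add_countEq f k (r + 1)
  rw [hfull r le_rfl] at e1
  rw [hk1 _ le_rfl, hr1] at e2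
  have b1 : countEq f k r ≤ countEq f n r := countEq_mono f r hkn
  have b2 : countEq f k (r + 1) ≤ countEq f n (r + 1) := countEq_mono f (r + 1) hkn
  have t1 := countLt_add_countEq f n r
  have t2 : countLt f n (r + 2) = _ := countLt_add_countEq f n (r + 1)
  rw [hf.countLt_eq, hf.countLt_eq] at t1 t2
  have segl : ∀ i : Fin n, i.1 < k → ∀ c, f i < c ↔ i.1 < countLt f k c := by
    intro i hi c
    rw [lt_iff_of_monotoneOn (fun i j _ hij hj => hleft i j hij hj) (Nat.zero_le _) hi]
    have := card_interval_countLt f (Nat.zero_le k) c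
    have h1 : countLt f 0 c = 0 := by simp [countLt]
    rw [h1] at this
    rw [this]
  have segr : ∀ i : Fin n, k ≤ i.1 → ∀ c, f i < c ↔ i.1 + countLt f k c < k + countLt f0 n c := by
    intro i hi c
    rw [lt_iff_of_monotoneOn (b := n) (fun i j hi hij _ => hright i j hi hij) hi i.2]
    have := card_interval_countLt f hkn c
    rw [hf.countLt_eq] at this
    omega
  obtain ⟨s, hs⟩ : ∃ s, s = countLt f0 n r := ⟨_, rfl⟩
  obtain ⟨t, ht⟩ : ∃ t, t = countLt f0 n (r + 1) := ⟨_, rfl⟩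
  have seg0 := Monotone.lt_iff_countLt h0
  -- From position `s` on, `f` has `j - 1` letters `r`, then `j` letters `r + 1` up to the cut `k`,
  -- then the remaining `t - s - (j - 1)` letters `r`, which end at `t + j`. This dictates the
  -- window `[s + j - 1, t + j)`, whose length exceeds `t - s` by one.
  have hx : countLt f k (r + 1) = s + j - 1 := by omega
  have hkx : k = s + j - 1 + j := by omega
  have key1 : ∀ i : Fin n, i.1 < s + j - 1 → f i = f0 i := by
    intro i hi
    have h1 : f i < r + 1 := (segl i (by omega) (r + 1)).2 (by omega)
    have h2 : f0 i < r + 1 := (seg0 i (r + 1)).2 (by omega)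
    have h3 : ∀ c ≤ r, f i < c ↔ f0 i < c := fun c hc => by
      rw [segl i (by omega) c, seg0 i c, hfull c hc]
    have a1 := h3 (f i + 1)
    have a2 := h3 (f0 i + 1)
    omega
  have key2 : ∀ i : Fin n, s + j - 1 ≤ i.1 → i.1 < k → f i = r + 1 := by
    intro i hi hi'
    have h1 := hle i hi'
    have h2 := (segl i hi' (r + 1)).1
    omega
  have key3 : ∀ i : Fin n, k ≤ i.1 → i.1 < t + j → f i = r := by
    intro i hi hi'
    have h1 := hge i hi
    have h2 := (segr i hi (r + 1)).2
    omega
  have key4 : ∀ i : Fin n, t + j ≤ i.1 → f i = f0 i := by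
    intro i hi
    have hki : k ≤ i.1 := by omega
    have h1 := (segr i hki (r + 1)).1
    have h2 := (seg0 i (r + 1)).1
    have h3 : ∀ c, r + 2 ≤ c → (f i < c ↔ f0 i < c) := fun c hc => by
      rw [segr i hki c, seg0 i c, hk1 c hc]
      omega
    have a1 := h3 (f i + 1)
    have a2 := h3 (f0 i + 1)
    omega
  have hmem : f ∈ windowWords f0 (s + j - 1) (t + j) := by
    rw [mem_windowWords]
    refine ⟨hf, fun i hi => ?_⟩
    rcases hi with hi | hi
    · exact key1 i hi
    · exact key4 i hi
  refine ⟨s + j - 1, t + j, by omega, by omega, by omega, by omega, by omega, hmem, ?_⟩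
  intro g hg
  have hg' := mem_windowWords.1 hg
  have hlet : ∀ w ∈ windowWords f0 (s + j - 1) (t + j), ∀ i : Fin n, s + j - 1 ≤ i.1 →
      i.1 < t + j → w i = r ∨ w i = r + 1 :=
    fun w hw i hi hi' => windowWords_letter hb (by omega) (by omega) hw hi hi'
  intro k' c
  by_cases hc : c = r + 1
  · subst hc
    by_cases hk' : k' ≤ k
    · refine Finset.card_le_card fun i => ?_
      simp only [Finset.mem_filter, Finset.mem_univ, true_and]
      rintro ⟨hi, hi'⟩
      refine ⟨hi, ?_⟩
      by_cases h1 : i.1 < s + j - 1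
      · rwa [hg'.2 i (Or.inl h1), ← key1 i h1]
      · have := key2 i (by omega) (by omega)
        omega
    -- Behind the cut, suffixes are compared instead of prefixes: the total number of letters at
    -- most `r` is fixed, and in the suffix inside the window `f` has nothing but letters `r`.
    · have h1 : ∀ h : Fin n → ℕ, IsRearrangement f0 h → countLt h k' (r + 1) +
          (Finset.univ.filter fun i : Fin n => ¬ i.1 < k' ∧ h i < r + 1).card =
          countLt f0 n (r + 1) := by
        intro h hh
        rw [← hh.countLt_eq, countLt, countLt,
          ← Finset.card_filter_add_card_filter_not (s := Finset.univ.filter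
            fun i : Fin n => i.1 < n ∧ h i < r + 1) (fun i : Fin n => i.1 < k'),
          Finset.filter_filter, Finset.filter_filter]
        congr 2
        · refine Finset.filter_congr fun i _ => ?_
          have := i.2
          omega
        · refine Finset.filter_congr fun i _ => ?_
          have := i.2
          omega
      have h2 := h1 f hf
      have h3 := h1 g hg'.1
      have h4 : (Finset.univ.filter fun i : Fin n => ¬ i.1 < k' ∧ g i < r + 1).card ≤
          (Finset.univ.filter fun i : Fin n => ¬ i.1 < k' ∧ f i < r + 1).card := by
        refine Finset.card_le_card fun i => ?_
        simp only [Finset.mem_filter, Finset.mem_univ, true_and]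
        rintro ⟨hi, hi'⟩
        refine ⟨hi, ?_⟩
        by_cases h5 : i.1 < t + j
        · have := key3 i (by omega) h5
          omega
        · rw [key4 i (by omega), ← hg'.2 i (by omega)]
          exact hi'
      omega
  · refine Finset.card_le_card fun i => ?_
    simp only [Finset.mem_filter, Finset.mem_univ, true_and]
    rintro ⟨hi, hi'⟩
    refine ⟨hi, ?_⟩
    by_cases h1 : s + j - 1 ≤ i.1 ∧ i.1 < t + j
    · have a1 := hlet f hmem i h1.1 h1.2
      have a2 := hlet g hg i h1.1 h1.2
      omega
    · rwa [hg'.2 i (by omega), ← (mem_windowWords.1 hmem).2 i (by omega)]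

/-- The span of the words in a set, together with `Q`. -/
theorem wordOp_mem_span_sup {S S' : Set (Fin n → ℕ)}
    {Q : Submodule R ((Fin n → ℕ) →₀ R)} {i : Fin (n - 1)}
    (hQ : ∀ c ∈ Q, wordOp q i c ∈ Q) (hS : ∀ g ∈ S, g ∈ S') (hS' : ∀ g ∈ S, g ∘ simpleSwap i ∈ S')
    {c : (Fin n → ℕ) →₀ R}
    (hc : c ∈ Submodule.span R ((fun g => Finsupp.single g (1 : R)) '' S) ⊔ Q) :
    wordOp q i c ∈ Submodule.span R ((fun g => Finsupp.single g (1 : R)) '' S') ⊔ Q := by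
  suffices Submodule.span R ((fun g => Finsupp.single g (1 : R)) '' S) ⊔ Q ≤
      (Submodule.span R ((fun g => Finsupp.single g (1 : R)) '' S') ⊔ Q).comap (wordOp q i) from
    this hc
  refine sup_le (Submodule.span_le.2 ?_) fun c hc => Submodule.mem_sup_right (hQ c hc)
  rintro _ ⟨g, hg, rfl⟩
  refine Submodule.mem_sup_left ?_
  have h1 : Finsupp.single g (1 : R) ∈
      Submodule.span R ((fun g => Finsupp.single g (1 : R)) '' S') :=
    Submodule.subset_span ⟨g, hS g hg, rfl⟩
  have h2 : Finsupp.single (g ∘ simpleSwap i) (1 : R) ∈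
      Submodule.span R ((fun g => Finsupp.single g (1 : R)) '' S') :=
    Submodule.subset_span ⟨_, hS' g hg, rfl⟩
  change wordOp q i (Finsupp.single g 1) ∈ _
  rw [wordOp_single]
  split_ifs
  · exact Submodule.smul_mem _ _ h2
  · exact Submodule.smul_mem _ _ h1
  · exact Submodule.add_mem _ (Submodule.smul_mem _ _ h2) (Submodule.smul_mem _ _ h1)

/-- The hypothesis that `Q` contains all Garnir sums of rearrangements of `f0`. -/
def ContainsGarnir (f0 : Fin n → ℕ) (Q : Submodule R ((Fin n → ℕ) →₀ R)) : Prop :=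
  ∀ r x y, countLt f0 n r ≤ x → x ≤ countLt f0 n (r + 1) → countLt f0 n (r + 1) ≤ y →
    y ≤ countLt f0 n (r + 2) → x + countLt f0 n (r + 1) < y + countLt f0 n r →
    garnirSum R f0 x y ∈ Q

/-- A violation of the lattice condition means that the `j`-th letter `r + 1` precedes the `j`-th
letter `r`. As long as `f` has a descent whose removal keeps this violation, sort it, use induction
on the length of `p`, and carry the relation back with the generator. Otherwise `f` is increasing on
both sides of the cut, and it is the least dominant word of a Garnir window. The bound on `j` admits
the case in which the `j`-th letter `r` does not exist, but no larger `j`. -/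
theorem single_mem_of_violation {f0 : Fin n → ℕ} (h0 : Monotone f0)
    {Q : Submodule R ((Fin n → ℕ) →₀ R)} (hQ : ∀ i, ∀ c ∈ Q, wordOp q i c ∈ Q)
    (hG : ContainsGarnir f0 Q) (r j : ℕ) (p : Equiv.Perm (Fin n)) :
    ∀ f : Fin n → ℕ, f ∘ p = f0 → j ≤ countEq f n r + 1 →
      (∃ k ≤ n, j ≤ countEq f k (r + 1) ∧ countEq f k r < j) →
      Finsupp.single f (1 : R) ∈ Submodule.span R ((fun g => Finsupp.single g (1 : R)) ''
        {g | IsRearrangement f0 g ∧ Dominates g f ∧ g ≠ f}) ⊔ Q := by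
  induction hN : invCount p using Nat.strong_induction_on generalizing p with
  | _ N ih =>
  intro f hf hj hex
  have hre : IsRearrangement f0 f := ⟨p, hf⟩
  obtain ⟨k1, hk1n, hk1, hk1'⟩ := hex
  have hfind : ∃ k, j ≤ countEq f k (r + 1) := ⟨k1, hk1⟩
  -- The shortest prefix with `j` letters `r + 1` ends in such a letter and contains exactly `j` of
  -- them.
  obtain ⟨k, hk, hmin⟩ : ∃ k, j ≤ countEq f k (r + 1) ∧ ∀ m < k, ¬ j ≤ countEq f m (r + 1) :=
    ⟨Nat.find hfind, Nat.find_spec hfind, fun m hm => Nat.find_min hfind hm⟩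
  have hkk1 : k ≤ k1 := by
    by_contra h
    exact hmin k1 (by omega) hk1
  have hkn : k ≤ n := hkk1.trans hk1n
  have hkr : countEq f k r < j := (countEq_mono f r hkk1).trans_lt hk1'
  have hk0 : 0 < k := by
    rcases Nat.eq_zero_or_pos k with h | h
    · subst h
      have : countEq f 0 (r + 1) = 0 := by simp [countEq]
      omega
    · exact h
  have hstep := countEq_succ f (k := k - 1) (by omega) (r + 1)
  rw [Nat.sub_add_cancel hk0] at hstep
  have hprev := hmin (k - 1) (by omega)
  have hlast : f ⟨k - 1, by omega⟩ = r + 1 := by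
    by_contra h
    rw [if_neg h] at hstep
    omega
  rw [if_pos hlast] at hstep
  have hkeq : countEq f k (r + 1) = j := by omega
  by_cases hdes : ∃ i : Fin (n - 1), f (hi i) < f (lo i) ∧
      (i.1 + 1 ≠ k ∨ f (hi i) ≠ r ∨ countEq f k r + 1 < j)
  · obtain ⟨i, hlt, hor⟩ := hdes
    have hi2 := i.2
    have hlt' : (f ∘ simpleSwap i) (lo i) < (f ∘ simpleSwap i) (hi i) := by
      simpa only [Function.comp_apply, simpleSwap_lo, simpleSwap_hi] using hlt
    have h1 := ih (invCount (simpleSwap i * p))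
      (by have := invCount_simpleSwap_mul' (inv_lt_inv_of_lt h0 hf hlt); omega) _ rfl
      (f ∘ simpleSwap i) (by rw [comp_comp_simpleSwap_mul, hf])
      (by rwa [countEq_comp_simpleSwap f i (by omega)]) (by
        -- A swap across the cut may destroy the violation in the prefix of length `k`; the prefix
        -- of length `k + 1` still shows it, by the choice of the descent.
        by_cases hik : i.1 + 1 = k
        · refine ⟨k + 1, by omega, ?_⟩
          rw [countEq_comp_simpleSwap f i (by omega), countEq_comp_simpleSwap f i (by omega)]
          have s1 := countEq_succ f (k := k) (by omega) r
          have s2 := countEq_mono f (r + 1) (show k ≤ k + 1 by omega)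
          have e : (⟨k, by omega⟩ : Fin n) = hi i := Fin.ext hik.symm
          rw [e] at s1
          refine ⟨by omega, ?_⟩
          split_ifs at s1 with h
          · rcases hor with hor | hor | hor
            · exact absurd hik hor
            · exact absurd h hor
            · omega
          · omega
        · refine ⟨k, hkn, ?_⟩
          rw [countEq_comp_simpleSwap f i (by omega), countEq_comp_simpleSwap f i (by omega)]
          exact ⟨hk, hkr⟩)
    -- Since `f ∘ simpleSwap i` rises at `i`, the generator turns it into a unit multiple of `f`,
    -- and the words of its relation, swapped or not, still strictly dominate `f`.
    have h2 := wordOp_mem_span_sup (q := q) (S' := {g | IsRearrangement f0 g ∧ Dominates g f ∧ g ≠ f})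
      (hQ i) (by
        rintro g ⟨hg1, hg2, hg3⟩
        have hd := dominates_comp_simpleSwap hlt'
        have hnd := not_dominates_comp_simpleSwap hlt'
        rw [comp_simpleSwap_comp] at hd hnd
        refine ⟨hg1, hg2.trans hd, ?_⟩
        rintro rfl
        exact hnd hg2) (by
        rintro g ⟨hg1, hg2, hg3⟩
        have hd := hg2.comp_simpleSwap hlt'
        rw [comp_simpleSwap_comp] at hd
        refine ⟨hg1.comp _, hd, ?_⟩
        rintro rfl
        exact hg3 (comp_simpleSwap_comp g i).symm) h1
    rw [wordOp_single, if_pos hlt', comp_simpleSwap_comp] at h2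
    exact mem_of_unit_smul_mem q⁻¹ h2
  · push Not at hdes
    have hleft : ∀ i i' : Fin n, i ≤ i' → i'.1 < k → f i ≤ f i' := by
      intro i i' hii hi'
      refine le_of_lo_le_hi_on (a := 0) (b := k) ?_ i i' (Nat.zero_le _) hii hi'
      intro m _ hm
      by_contra h
      exact absurd (hdes m (not_le.1 h)).1 (by omega)
    have hright : ∀ i i' : Fin n, k ≤ i.1 → i ≤ i' → f i ≤ f i' := by
      intro i i' hi hii
      refine le_of_lo_le_hi_on (a := k) (b := n) ?_ i i' hi hii i'.2
      intro m hm _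
      by_contra h
      exact absurd (hdes m (not_le.1 h)).1 (by omega)
    have hge : ∀ i : Fin n, k ≤ i.1 → r ≤ f i := by
      intro i hi
      have hkn' : k < n := lt_of_le_of_lt hi i.2
      refine le_trans ?_ (hright ⟨k, hkn'⟩ i le_rfl (Fin.le_def.2 hi))
      have e1 : lo (⟨k - 1, by omega⟩ : Fin (n - 1)) = ⟨k - 1, by omega⟩ := rfl
      have e2 : _root_.hi (⟨k - 1, by omega⟩ : Fin (n - 1)) = ⟨k, hkn'⟩ :=
        Fin.ext (Nat.sub_add_cancel hk0)
      have := hdes ⟨k - 1, by omega⟩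
      rw [e1, e2, hlast] at this
      by_contra h
      have := (this (by omega)).2.1
      omega
    have hr : countEq f k r + 1 = j := by
      -- A remaining descent can only be the letters `r + 1`, `r` at the cut, and it gives the
      -- equality. Without descents all letters `r` precede the cut, and the equality comes from the
      -- bound on `j`.
      by_cases hd : ∃ i : Fin (n - 1), f (hi i) < f (lo i)
      · obtain ⟨i, hi⟩ := hd
        have := (hdes i hi).2.2
        omega
      · push Not at hd
        have hm : Monotone f := monotone_of_lo_le_hi hd
        have : countEq f n r ≤ countEq f k r := by
          refine Finset.card_le_card fun i => ?_
          simp only [Finset.mem_filter, Finset.mem_univ, true_and]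
          rintro ⟨_, hi⟩
          refine ⟨?_, hi⟩
          by_contra hik
          have : f ⟨k - 1, by omega⟩ ≤ f i := hm (Fin.le_def.2 (by simp only; omega))
          omega
        omega
    obtain ⟨x, y, h1, h2, h3, h4, h5, hmem, hdom⟩ :=
      mem_windowWords_of_cut h0 hre hk0 hkn hleft hright hlast hge hr hkeq
    have hgs := hG r x y h1 h2 h3 h4 h5
    rw [garnirSum, ← Finset.add_sum_erase _ _ hmem] at hgs
    have h6 : ∑ w ∈ (windowWords f0 x y).erase f, Finsupp.single w (1 : R) ∈
        Submodule.span R ((fun g => Finsupp.single g (1 : R)) ''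
          {g | IsRearrangement f0 g ∧ Dominates g f ∧ g ≠ f}) := by
      refine Submodule.sum_mem _ fun w hw => Submodule.subset_span ⟨w, ?_, rfl⟩
      rw [Finset.mem_erase] at hw
      exact ⟨(mem_windowWords.1 hw.2).1, hdom w hw.2, hw.1⟩
    have := Submodule.sub_mem _ (Submodule.mem_sup_right hgs) (Submodule.mem_sup_left (T := Q) h6)
    rwa [add_sub_cancel_right] at this

theorem finite_rearrangements (f0 : Fin n → ℕ) : {g | IsRearrangement f0 g}.Finite := by
  refine (Set.finite_range fun p : Equiv.Perm (Fin n) => f0 ∘ p).subset ?_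
  intro g hg
  obtain ⟨p, hp⟩ := IsRearrangement.symm hg
  exact ⟨p, hp⟩

/-- Modulo Garnir sums, every word is a linear combination of lattice words that dominate it. -/
theorem single_mem_span_lattice {f0 : Fin n → ℕ} (h0 : Monotone f0)
    {Q : Submodule R ((Fin n → ℕ) →₀ R)} (hQ : ∀ i, ∀ c ∈ Q, wordOp q i c ∈ Q)
    (hG : ContainsGarnir f0 Q) {f : Fin n → ℕ} (hf : IsRearrangement f0 f) :
    Finsupp.single f (1 : R) ∈ Submodule.span R ((fun g => Finsupp.single g (1 : R)) ''
        {g | IsRearrangement f0 g ∧ IsLattice g ∧ Dominates g f}) ⊔ Q := by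
  have hfin : ∀ f, {g | IsRearrangement f0 g ∧ Dominates g f}.Finite := fun f =>
    (finite_rearrangements f0).subset fun g hg => hg.1
  induction hN : {g | IsRearrangement f0 g ∧ Dominates g f}.ncard using Nat.strong_induction_on
    generalizing f with
  | _ N ih =>
  by_cases hl : IsLattice f
  · exact Submodule.mem_sup_left (Submodule.subset_span ⟨f, ⟨hf, hl, Dominates.refl f⟩, rfl⟩)
  · unfold IsLattice at hl
    push Not at hl
    obtain ⟨k, r, hkr⟩ := hl
    have hkn : ∃ k ≤ n, countEq f k r < countEq f k (r + 1) := by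
      rcases le_or_gt k n with h | h
      · exact ⟨k, h, hkr⟩
      · have e : ∀ c, countEq f n c = countEq f k c := fun c =>
          congrArg Finset.card (Finset.filter_congr fun i _ => by have := i.2; omega)
        exact ⟨n, le_rfl, by rwa [e, e]⟩
    obtain ⟨k, hkn, hkr⟩ := hkn
    obtain ⟨p, hp⟩ := id hf
    have h1 := single_mem_of_violation h0 hQ hG r (countEq f k r + 1) p f hp
      (Nat.succ_le_succ (countEq_mono f r hkn)) ⟨k, hkn, hkr, Nat.lt_succ_self _⟩
    suffices Submodule.span R ((fun g => Finsupp.single g (1 : R)) ''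
          {g | IsRearrangement f0 g ∧ Dominates g f ∧ g ≠ f}) ⊔ Q ≤
        Submodule.span R ((fun g => Finsupp.single g (1 : R)) ''
          {g | IsRearrangement f0 g ∧ IsLattice g ∧ Dominates g f}) ⊔ Q from this h1
    refine sup_le (Submodule.span_le.2 ?_) le_sup_right
    rintro _ ⟨g, ⟨hg1, hg2, hg3⟩, rfl⟩
    -- The set for `g` is strictly smaller than the set for `f`, because `f` belongs to the latter
    -- and, by antisymmetry, not to the former.
    have h2 := ih {h | IsRearrangement f0 h ∧ Dominates h g}.ncard (by
      rw [← hN]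
      refine Set.ncard_lt_ncard ⟨fun h hh => ⟨hh.1, hh.2.trans hg2⟩, fun hsub => ?_⟩ (hfin f)
      exact hg3 ((hsub ⟨hf, Dominates.refl f⟩).2.antisymm hg2).symm) hg1 rfl
    refine sup_le_sup_right (Submodule.span_mono (Set.image_mono ?_)) Q h2
    rintro h ⟨hh1, hh2, hh3⟩
    exact ⟨hh1, hh2, hh3.trans hg2⟩

end Dominance

end Hecke

/-! ## Tableaux and words -/

namespace Tableau

variable {n : ℕ}

/-- The word that records the rows of the entries of a tableau. -/
def rowWord {lam : Shape n} (t : Tableau lam) (k : Fin n) : ℕ := (t.symm k).1.1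

theorem initial_val {lam : Shape n} (p : lam.Node) :
    (initial lam p).1 = lam.rowStart p.1.1 + p.1.2 := rfl

theorem initial_symm_val (lam : Shape n) (k : Fin n) :
    lam.rowStart ((initial lam).symm k).1.1 + ((initial lam).symm k).1.2 = k.1 := by
  rw [← initial_val, Equiv.apply_symm_apply]

theorem monotone_rowWord_initial (lam : Shape n) : Monotone (rowWord (initial lam)) := by
  intro k k' h
  by_contra hlt
  have := entry_lt_of_row_lt (not_le.1 hlt)
  rw [initial_symm_val, initial_symm_val] at this
  exact absurd h (not_le.2 this)

theorem rowWord_comp_perm {lam : Shape n} (t : Tableau lam) :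
    rowWord t ∘ t.perm = rowWord (initial lam) := by
  funext k
  simp [rowWord, perm]

theorem rowWord_eq {lam : Shape n} (t : Tableau lam) :
    rowWord t = rowWord (initial lam) ∘ ⇑t.perm⁻¹ := by
  rw [← rowWord_comp_perm t]
  exact funext fun k => (congrArg (rowWord t) (perm_apply_inv t.perm k)).symm

theorem isRearrangement_rowWord {lam : Shape n} (t : Tableau lam) :
    Hecke.IsRearrangement (rowWord (initial lam)) (rowWord t) := ⟨t.perm, rowWord_comp_perm t⟩

theorem IsStandard.rowIncreasing {lam : Shape n} {t : Tableau lam} (ht : t.IsStandard) :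
    Hecke.RowIncreasing (rowWord (initial lam)) t.perm := by
  intro a b hab hlt
  have h1 := initial_symm_val lam a
  have h2 := initial_symm_val lam b
  refine ht.1 _ _ hab ?_
  have hab' : ((initial lam).symm a).1.1 = ((initial lam).symm b).1.1 := hab
  rw [hab'] at h1
  rw [Fin.lt_def] at hlt
  omega

theorem perm_initial (lam : Shape n) : (initial lam).perm = 1 := Equiv.symm_trans_self _

theorem countEq_rowWord {lam : Shape n} (t : Tableau lam) (r : ℕ) :
    Hecke.countEq (rowWord t) n r = lam.diagram.rowLen r := by
  rw [YoungDiagram.rowLen_eq_card]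
  refine Finset.card_bij (fun k _ => (t.symm k).1) ?_ ?_ ?_
  · intro k hk
    simp only [Finset.mem_filter, Finset.mem_univ, true_and] at hk
    rw [YoungDiagram.mem_row_iff]
    exact ⟨(t.symm k).2, hk.2⟩
  · intro k _ k' _ h
    exact t.symm.injective (Subtype.ext h)
  · intro p hp
    rw [YoungDiagram.mem_row_iff] at hp
    refine ⟨t ⟨p, hp.1⟩, Finset.mem_filter.2 ⟨Finset.mem_univ _, Fin.is_lt _, ?_⟩, by simp⟩
    rw [rowWord, Equiv.symm_apply_apply]
    exact hp.2

theorem countLt_rowWord {lam : Shape n} (t : Tableau lam) (j : ℕ) :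
    Hecke.countLt (rowWord t) n j = lam.rowStart j := by
  induction j with
  | zero => simp [Hecke.countLt, Shape.rowStart]
  | succ j ih => rw [Hecke.countLt_add_countEq, ih, countEq_rowWord, Shape.rowStart_succ]

end Tableau

namespace Shape

variable {n : ℕ}

open Tableau

/-- Smaller letters mean more nodes in the upper rows. This converts the pointwise order on words,
which governs the Garnir ideals, into dominance. -/
theorem le_of_rowWord_le {lam μ : Shape n} (h : rowWord (initial μ) ≤ rowWord (initial lam)) :
    lam ≤ μ := by
  intro j
  rw [← countLt_rowWord (initial lam), ← countLt_rowWord (initial μ)]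
  refine Finset.card_le_card fun k => ?_
  simp only [Finset.mem_filter, Finset.mem_univ, true_and]
  exact fun hk => ⟨hk.1, (h k).trans_lt hk.2⟩

theorem lt_of_rowWord_lt {lam μ : Shape n} (h : rowWord (initial μ) < rowWord (initial lam)) :
    lam < μ := by
  refine (le_of_rowWord_le h.le).lt_of_ne ?_
  rintro rfl
  exact lt_irrefl _ h

instance finite : Finite (Shape n) := by
  have h1 : ∀ lam : Shape n, lam.diagram.cells ⊆ Finset.range n ×ˢ Finset.range n := by
    rintro lam ⟨i, j⟩ hp
    rw [YoungDiagram.mem_cells] at hp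
    have h1 : (lam.diagram.row i).card ≤ n :=
      (Finset.card_le_card (Finset.filter_subset _ _)).trans lam.card_eq.le
    have h2 : (lam.diagram.col j).card ≤ n :=
      (Finset.card_le_card (Finset.filter_subset _ _)).trans lam.card_eq.le
    rw [← YoungDiagram.rowLen_eq_card] at h1
    rw [← YoungDiagram.colLen_eq_card] at h2
    rw [Finset.mem_product, Finset.mem_range, Finset.mem_range]
    exact ⟨(YoungDiagram.mem_iff_lt_colLen.1 hp).trans_le h2,
      (YoungDiagram.mem_iff_lt_rowLen.1 hp).trans_le h1⟩
  refine Finite.of_injective (β := (Finset.range n ×ˢ Finset.range n).powerset)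
    (fun lam => ⟨lam.diagram.cells, Finset.mem_powerset.2 (h1 lam)⟩) ?_
  intro lam μ h
  exact Shape.ext (YoungDiagram.ext (Subtype.ext_iff.1 h))

end Shape

/-! ### Lattice words are the row words of standard tableaux -/

section Lattice

variable {n : ℕ}

open Hecke Tableau

theorem countEq_lt_of_lt {f : Fin n → ℕ} {k : Fin n} {m : ℕ} (h : k.1 < m) :
    countEq f k.1 (f k) < countEq f m (f k) := by
  have h1 := countEq_succ f k.2 (f k)
  simp only [Fin.eta, if_true] at h1
  have h2 := countEq_mono f (f k) (show k.1 + 1 ≤ m by omega)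
  omega

theorem exists_countEq_eq (f : Fin n → ℕ) (r : ℕ) {c m : ℕ} (hm : m ≤ n)
    (h : c < countEq f m r) : ∃ k : Fin n, f k = r ∧ countEq f k.1 r = c := by
  induction m with
  | zero => simp [countEq] at h
  | succ m ih =>
    have h1 := countEq_succ f (k := m) (by omega) r
    by_cases hc : c < countEq f m r
    · exact ih (by omega) hc
    · split_ifs at h1 with hf
      · exact ⟨⟨m, by omega⟩, hf, by simp only; omega⟩
      · omega

theorem Hecke.IsLattice.countEq_anti {f : Fin n → ℕ} (hf : IsLattice f) (k : ℕ) {r r' : ℕ}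
    (h : r ≤ r') : countEq f k r' ≤ countEq f k r := by
  induction r', h using Nat.le_induction with
  | base => exact le_rfl
  | succ r' _ ih => exact (hf k r').trans ih

/-- A lattice word is the row word of a standard tableau of every shape whose row lengths are
the multiplicities of the letters. -/
theorem Hecke.IsLattice.exists_stdTableau {f : Fin n → ℕ} (hf : IsLattice f) {lam : Shape n}
    (hlam : ∀ r, lam.diagram.rowLen r = countEq f n r) :
    ∃ t : StdTableau lam, rowWord t.1 = f := by
  -- The entry `k` goes to the first free column of row `f k`; the number of earlier letters equal
  -- to `f k` is this column.
  let nd : Fin n → lam.Node := fun k => ⟨(f k, countEq f k.1 (f k)), by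
    rw [YoungDiagram.mem_cells, YoungDiagram.mem_iff_lt_rowLen, hlam]
    exact countEq_lt_of_lt k.2⟩
  have hinj : Function.Injective nd := by
    intro k k' h
    have h1 : f k = f k' := congrArg (fun p : lam.Node => p.1.1) h
    have h2 : countEq f k.1 (f k) = countEq f k'.1 (f k') := congrArg (fun p : lam.Node => p.1.2) h
    rcases lt_trichotomy k k' with h3 | h3 | h3
    · have := countEq_lt_of_lt (f := f) (Fin.lt_def.1 h3)
      rw [← h1] at h2
      omega
    · exact h3
    · have := countEq_lt_of_lt (f := f) (Fin.lt_def.1 h3)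
      rw [h1] at h2
      omega
  let e : Fin n ≃ lam.Node := Equiv.ofBijective nd
    ((Fintype.bijective_iff_injective_and_card nd).2
      ⟨hinj, by rw [lam.card_node, Fintype.card_fin]⟩)
  have he : ∀ p : lam.Node, (f (e.symm p), countEq f (e.symm p).1 (f (e.symm p))) = p.1 :=
    fun p => congrArg Subtype.val (e.apply_symm_apply p)
  refine ⟨⟨e.symm, ?_, ?_⟩, rfl⟩
  · intro p p' h1 h2
    rw [← he p, ← he p'] at h1 h2
    simp only at h1 h2
    by_contra h
    rw [h1] at h2
    have := countEq_mono f (f (e.symm p')) (Fin.le_def.1 (not_lt.1 h))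
    omega
  · intro p p' h1 h2
    rw [← he p, ← he p'] at h1 h2
    simp only at h1 h2
    by_contra h
    have h3 : e.symm p' < e.symm p := (not_lt.1 h).lt_of_ne (by
      intro h'
      rw [h'] at h2
      exact lt_irrefl _ h2)
    -- When the lower node of a column is filled, the lattice condition says that every row above is
    -- already at least as long, so the upper node was filled earlier.
    have h4 := countEq_lt_of_lt (f := f) (Nat.lt_succ_self (e.symm p').1)
    have h5 := hf.countEq_anti ((e.symm p').1 + 1) h2.le
    have h6 := countEq_mono f (f (e.symm p)) (show (e.symm p').1 + 1 ≤ (e.symm p).1 from h3)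
    have h7 : (e.symm p').1.succ = (e.symm p').1 + 1 := rfl
    rw [h7] at h4
    omega

theorem Hecke.IsLattice.exists_shape {f : Fin n → ℕ} (hf : IsLattice f) :
    ∃ lam : Shape n, ∀ r, lam.diagram.rowLen r = countEq f n r := by
  let cells : Finset (ℕ × ℕ) := Finset.univ.image fun k : Fin n => (f k, countEq f k.1 (f k))
  have hmem : ∀ r c, (r, c) ∈ cells ↔ c < countEq f n r := by
    intro r c
    rw [Finset.mem_image]
    constructor
    · rintro ⟨k, _, hk⟩
      rw [Prod.mk.injEq] at hk
      rw [← hk.1, ← hk.2]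
      exact countEq_lt_of_lt k.2
    · intro h
      obtain ⟨k, h1, h2⟩ := exists_countEq_eq f r le_rfl h
      exact ⟨k, Finset.mem_univ _, by rw [h1, h2]⟩
  have hinj : Function.Injective fun k : Fin n => (f k, countEq f k.1 (f k)) := by
    intro k k' h
    rw [Prod.mk.injEq] at h
    rcases lt_trichotomy k k' with h3 | h3 | h3
    · have := countEq_lt_of_lt (f := f) (Fin.lt_def.1 h3)
      rw [h.2, h.1] at this
      exact absurd this (lt_irrefl _)
    · exact h3
    · have := countEq_lt_of_lt (f := f) (Fin.lt_def.1 h3)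
      rw [← h.2, ← h.1] at this
      exact absurd this (lt_irrefl _)
  let Y : YoungDiagram :=
    { cells := cells
      isLowerSet := by
        rintro ⟨r, c⟩ ⟨r', c'⟩ h hp
        rw [Finset.mem_coe, hmem] at hp ⊢
        exact (h.2.trans_lt hp).trans_le (hf.countEq_anti n h.1) }
  refine ⟨⟨Y, ?_⟩, fun r => ?_⟩
  · change cells.card = n
    rw [Finset.card_image_of_injective _ hinj, Finset.card_univ, Fintype.card_fin]
  · have : ∀ c, c < Y.rowLen r ↔ c < countEq f n r := fun c => by
      rw [← YoungDiagram.mem_iff_lt_rowLen, ← hmem]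
      exact Iff.rfl
    have a1 := this (Y.rowLen r)
    have a2 := this (countEq f n r)
    change Y.rowLen r = _
    omega

theorem Hecke.IsRearrangement.countEq_eq {f0 f : Fin n → ℕ} (h : IsRearrangement f0 f) (c : ℕ) :
    countEq f n c = countEq f0 n c := by
  simpa [countEq] using h.card_filter (· = c)

theorem Hecke.IsLattice.exists_of_isRearrangement {f : Fin n → ℕ} (hf : IsLattice f)
    {lam : Shape n} (h : IsRearrangement (rowWord (initial lam)) f) :
    ∃ t : StdTableau lam, rowWord t.1 = f :=
  hf.exists_stdTableau fun r => by rw [h.countEq_eq, countEq_rowWord]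

/-- The auxiliary monotone words need not come from partitions. If one does not, it has no lattice
rearrangement, and straightening places its whole right ideal in the ideal of the smaller words. -/
theorem Hecke.IsLattice.exists_shape_of_isRearrangement {f f0 : Fin n → ℕ} (hf : IsLattice f)
    (h0 : Monotone f0) (h : IsRearrangement f0 f) :
    ∃ lam : Shape n, rowWord (initial lam) = f0 := by
  obtain ⟨lam, hlam⟩ := hf.exists_shape
  obtain ⟨t, ht⟩ := hf.exists_stdTableau hlam
  refine ⟨lam, Monotone.eq_of_isRearrangement h0 (monotone_rowWord_initial lam) ?_⟩
  have := (isRearrangement_rowWord t.1).symm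
  rw [ht] at this
  exact h.trans this

end Lattice

/-! ## The Murphy elements span -/

namespace Hecke

open Tableau

variable {R : Type*} [CommRing R] {q : Rˣ} {n : ℕ}

/-- The row word of the initial tableau. -/
noncomputable abbrev _root_.Shape.word (lam : Shape n) : Fin n → ℕ := rowWord (initial lam)

theorem m_eq_wordSum (lam : Shape n) : (m lam : Hecke R q n) = wordSum R q lam.word lam.word := by
  classical
  rw [m, wordSum]
  refine Finset.sum_congr ?_ fun p _ => by rw [permLength_eq, weightedT]
  ext p
  rw [mem_matching, Finset.mem_filter, funext_iff]
  exact ⟨fun h => h.2, fun h => ⟨Finset.mem_univ _, h⟩⟩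

theorem m_mul_T (lam : Shape n) (t : StdTableau lam) :
    (m lam * T t.1.perm : Hecke R q n) =
      ((q⁻¹ : Rˣ) : R) ^ invCount t.1.perm • wordSum R q lam.word (rowWord t.1) := by
  rw [m_eq_wordSum, wordSum_mul_T (monotone_rowWord_initial lam) t.2.rowIncreasing,
    ← rowWord_eq]

theorem wordSum_rowWord (lam : Shape n) (t : StdTableau lam) :
    wordSum R q lam.word (rowWord t.1) = (q : R) ^ invCount t.1.perm • (m lam * T t.1.perm) := by
  rw [m_mul_T, smul_smul, ← mul_pow, Units.mul_inv, one_pow, one_smul]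

theorem star_m (lam : Shape n) : star (m lam : Hecke R q n) = m lam := by
  rw [m_eq_wordSum, star_wordSum]

theorem containsGarnir_comap {f0 : Fin n → ℕ} (h0 : Monotone f0) :
    ContainsGarnir f0 ((idealAbove R q f0).comap (wordLin R q f0)) :=
  fun _ _ _ h1 h2 h3 h4 h5 =>
    wordLin_garnirSum_mem h0 (Monotone.isBlock h0 _) h1 h2 h3 h4 h5

theorem wordOp_mem_comap {f0 : Fin n → ℕ} (h0 : Monotone f0) (i : Fin (n - 1))
    {c : (Fin n → ℕ) →₀ R} (hc : c ∈ (idealAbove R q f0).comap (wordLin R q f0)) :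
    wordOp q i c ∈ (idealAbove R q f0).comap (wordLin R q f0) := by
  rw [Submodule.mem_comap] at hc ⊢
  rw [wordLin_wordOp h0]
  exact mul_right_mem_idealAbove hc _

theorem wordSum_mem_span_lattice {f0 f : Fin n → ℕ} (h0 : Monotone f0)
    (hf : IsRearrangement f0 f) : wordSum R q f0 f ∈
      Submodule.span R (wordSum R q f0 '' {g | IsRearrangement f0 g ∧ IsLattice g ∧ Dominates g f}) ⊔
        idealAbove R q f0 := by
  have h := single_mem_span_lattice h0 (fun i c hc => wordOp_mem_comap (R := R) (q := q) h0 i hc)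
    (containsGarnir_comap h0) hf
  have h2 := Submodule.mem_map_of_mem (f := wordLin R q f0) h
  rw [wordLin_single, Submodule.map_sup, Submodule.map_span, ← Set.image_comp] at h2
  refine SetLike.le_def.1 (sup_le_sup (Submodule.span_mono ?_) (Submodule.map_comap_le _ _)) h2
  rintro _ ⟨g, hg, rfl⟩
  exact ⟨g, hg, (wordLin_single _ _).symm⟩

theorem wordSum_mul_mem {f0 : Fin n → ℕ} (h0 : Monotone f0) (b : Hecke R q n) :
    wordSum R q f0 f0 * b ∈
      Submodule.span R (wordSum R q f0 '' {g | IsRearrangement f0 g ∧ IsLattice g}) ⊔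
        idealAbove R q f0 := by
  obtain ⟨c, hc⟩ := exists_wordLin_eq (R := R) (q := q) h0 b
  rw [← hc, wordLin, Finsupp.linearCombination_apply]
  refine Submodule.sum_mem _ fun f _ => Submodule.smul_mem _ _ ?_
  by_cases hf : IsRearrangement f0 f
  · refine SetLike.le_def.1 (sup_le_sup_right (Submodule.span_mono (Set.image_mono ?_)) _)
      (wordSum_mem_span_lattice h0 hf)
    exact fun g hg => ⟨hg.1, hg.2.1⟩
  · rw [wordSum_of_not_isRearrangement hf]
    exact Submodule.zero_mem _

theorem m_mul_mem (lam : Shape n) (b : Hecke R q n) : m lam * b ∈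
    Submodule.span R (Set.range fun t : StdTableau lam => (m lam * T t.1.perm : Hecke R q n)) ⊔
      idealAbove R q lam.word := by
  rw [m_eq_wordSum]
  refine SetLike.le_def.1 (sup_le_sup_right (Submodule.span_le.2 ?_) _)
    (wordSum_mul_mem (monotone_rowWord_initial lam) b)
  rintro _ ⟨g, ⟨hg, hl⟩, rfl⟩
  obtain ⟨t, rfl⟩ := hl.exists_of_isRearrangement hg
  rw [SetLike.mem_coe, ← Shape.word, wordSum_rowWord, m_eq_wordSum]
  exact Submodule.smul_mem _ _ (Submodule.subset_span ⟨t, rfl⟩)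

variable (R q) in
/-- The span of the Murphy elements for the shapes with initial word at most `f0`. -/
noncomputable def murphySpan (f0 : Fin n → ℕ) : Submodule R (Hecke R q n) :=
  Submodule.span R {x | ∃ μ : Shape n, μ.word ≤ f0 ∧ ∃ s t : StdTableau μ, x = murphy μ s t}

/-- Well-founded induction on the pointwise order of words. Straighten `b` to the right of the
generator, then apply `star` and straighten `a`; all errors lie in the ideal of strictly smaller
words. -/
theorem mul_wordSum_mul_mem_murphySpan {f0 : Fin n → ℕ} (h0 : Monotone f0) (a b : Hecke R q n) :
    a * wordSum R q f0 f0 * b ∈ murphySpan R q f0 := by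
  induction f0 using WellFoundedLT.induction generalizing a b with
  | _ f0 ih =>
  have hJ : idealAbove R q f0 ≤ murphySpan R q f0 := by
    refine Submodule.span_le.2 ?_
    rintro _ ⟨f, hf, hlt, a, b, rfl⟩
    refine Submodule.span_mono ?_ (ih f hlt hf a b)
    rintro _ ⟨μ, hμ, s, t, rfl⟩
    exact ⟨μ, hμ.trans hlt.le, s, t, rfl⟩
  have h1 := wordSum_mul_mem (R := R) (q := q) h0 b
  rw [mul_assoc]
  suffices hle : Submodule.span R (wordSum R q f0 '' {g | IsRearrangement f0 g ∧ IsLattice g}) ⊔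
      idealAbove R q f0 ≤ (murphySpan R q f0).comap (LinearMap.mulLeft R a) from hle h1
  refine sup_le (Submodule.span_le.2 ?_) ?_
  swap
  · intro x hx
    exact hJ (mul_left_mem_idealAbove hx a)
  rintro _ ⟨g, ⟨hg, hl⟩, rfl⟩
  obtain ⟨lam, rfl⟩ := hl.exists_shape_of_isRearrangement h0 hg
  obtain ⟨t, rfl⟩ := hl.exists_of_isRearrangement hg
  change a * wordSum R q lam.word (rowWord t.1) ∈ murphySpan R q lam.word
  rw [wordSum_rowWord, mul_smul_comm]
  refine Submodule.smul_mem _ _ ?_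
  rw [← mul_assoc]
  have h2 := Submodule.mem_map_of_mem (f := star) (m_mul_mem (R := R) (q := q) lam (star a))
  rw [star_mul, star_star, star_m] at h2
  suffices (Submodule.span R (Set.range fun t : StdTableau lam =>
      (m lam * T t.1.perm : Hecke R q n)) ⊔ idealAbove R q lam.word).map star ≤
      (murphySpan R q lam.word).comap (LinearMap.mulRight R (T t.1.perm)) from this h2
  rw [Submodule.map_sup, Submodule.map_span]
  refine sup_le (Submodule.span_le.2 ?_) ?_
  · rintro _ ⟨_, ⟨s, rfl⟩, rfl⟩
    refine Submodule.subset_span ⟨lam, le_rfl, s, t, ?_⟩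
    rw [star_mul, star_m, LinearMap.mulRight_apply, murphy]
  · rintro _ ⟨x, hx, rfl⟩
    exact hJ (mul_right_mem_idealAbove (star_mem_idealAbove hx) _)

theorem idealAbove_le_cellAbove (lam : Shape n) :
    idealAbove R q lam.word ≤ cellAbove R (murphy (R := R) (q := q)) lam := by
  refine Submodule.span_le.2 ?_
  rintro _ ⟨f, hf, hlt, a, b, rfl⟩
  refine Submodule.span_mono ?_ (mul_wordSum_mul_mem_murphySpan hf a b)
  rintro _ ⟨μ, hμ, s, t, rfl⟩
  exact ⟨μ, Shape.lt_of_rowWord_lt (hμ.trans_lt hlt), s, t, rfl⟩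

theorem span_murphy : Submodule.span R (Set.range
    (fun i : (Σ lam : Shape n, StdTableau lam × StdTableau lam) =>
      (murphy i.1 i.2.1 i.2.2 : Hecke R q n))) = ⊤ := by
  rw [eq_top_iff]
  intro x _
  -- The word without repeated letters has trivial stabiliser, so its two-sided ideal is the whole
  -- algebra.
  have h1 : wordSum R q (fun i : Fin n => i.1) (fun i => i.1) = 1 := by
    rw [wordSum, Finset.sum_eq_single 1]
    · rw [weightedT, invCount_one, pow_zero, one_smul, T_one]
    · intro p hp hp1
      refine absurd (Equiv.ext fun i => Fin.ext ?_) hp1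
      exact congrFun (mem_matching.1 hp) i
    · intro h
      exact absurd (mem_matching.2 rfl) h
  have h2 := mul_wordSum_mul_mem_murphySpan (R := R) (q := q) (f0 := fun i : Fin n => i.1)
    (fun i j h => h) 1 x
  rw [h1, one_mul, one_mul] at h2
  refine Submodule.span_mono ?_ h2
  rintro _ ⟨μ, _, s, t, rfl⟩
  exact ⟨⟨μ, s, t⟩, rfl⟩

/-- Straightening takes place before the left factor of `s` is multiplied on, so the coefficients
cannot depend on `s`. -/
theorem murphy_mul (lam : Shape n) (t : StdTableau lam) (a : Hecke R q n) :
    ∃ r : StdTableau lam → R, ∀ s : StdTableau lam,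
      murphy lam s t * a - ∑ v, r v • murphy lam s v ∈
        cellAbove R (murphy (R := R) (q := q)) lam := by
  have h := m_mul_mem (R := R) (q := q) lam (T t.1.perm * a)
  obtain ⟨y, hy, j, hj, hyj⟩ := Submodule.mem_sup.1 h
  obtain ⟨r, rfl⟩ := (Submodule.mem_span_range_iff_exists_fun R).1 hy
  refine ⟨r, fun s => ?_⟩
  have : murphy lam s t * a - ∑ v, r v • murphy lam s v = star (T s.1.perm) * j := by
    simp only [murphy, mul_assoc]
    rw [← hyj, mul_add, Finset.mul_sum, add_sub_assoc]
    simp only [mul_smul_comm]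
    abel
  rw [this]
  exact idealAbove_le_cellAbove lam (mul_left_mem_idealAbove hj _)

theorem star_murphy (lam : Shape n) (s t : StdTableau lam) :
    star (murphy lam s t : Hecke R q n) = murphy lam t s := by
  rw [murphy, murphy, star_mul, star_mul, star_star, star_m, mul_assoc]

end Hecke

/-! ## Young's lattice -/

namespace Shape

variable {n : ℕ}

theorem mem_cells_iff {lam : Shape n} {p : ℕ × ℕ} :
    p ∈ lam.diagram.cells ↔ p.2 < lam.diagram.rowLen p.1 :=
  YoungDiagram.mem_iff_lt_rowLen

theorem ext_rowLen {lam μ : Shape n} (h : ∀ i, lam.diagram.rowLen i = μ.diagram.rowLen i) :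
    lam = μ := ext_rowStart fun _ => Finset.sum_congr rfl fun i _ => h i

theorem ext_cells {lam μ : Shape n} (h : lam.diagram.cells = μ.diagram.cells) : lam = μ :=
  Shape.ext (YoungDiagram.ext h)

/-- `lam` is obtained from `μ` by adding a node in row `r`. -/
def EdgeAt (μ : Shape n) (lam : Shape (n + 1)) (r : ℕ) : Prop :=
  ∀ i, lam.diagram.rowLen i = μ.diagram.rowLen i + if i = r then 1 else 0

theorem EdgeAt.cells {μ : Shape n} {lam : Shape (n + 1)} {r : ℕ} (h : μ.EdgeAt lam r) :
    lam.diagram.cells = insert (r, μ.diagram.rowLen r) μ.diagram.cells := by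
  ext ⟨i, j⟩
  rw [Finset.mem_insert, mem_cells_iff, mem_cells_iff, h i, Prod.mk.injEq]
  simp only
  split_ifs with hi
  · subst hi
    omega
  · simp [hi]

theorem EdgeAt.notMem {μ : Shape n} (r : ℕ) : (r, μ.diagram.rowLen r) ∉ μ.diagram.cells := by
  rw [mem_cells_iff]
  exact lt_irrefl _

theorem EdgeAt.edge {μ : Shape n} {lam : Shape (n + 1)} {r : ℕ} (h : μ.EdgeAt lam r) :
    μ.Edge lam := ⟨_, EdgeAt.notMem r, h.cells⟩

theorem Edge.edgeAt {μ : Shape n} {lam : Shape (n + 1)} {α : ℕ × ℕ} (hα : α ∉ μ.diagram.cells)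
    (h : lam.diagram.cells = insert α μ.diagram.cells) : μ.EdgeAt lam α.1 := by
  intro i
  rw [YoungDiagram.rowLen_eq_card, YoungDiagram.rowLen_eq_card, YoungDiagram.row,
    YoungDiagram.row]
  rw [h, Finset.filter_insert]
  split_ifs with h1 h2 h2
  · rw [Finset.card_insert_of_notMem]
    exact fun h3 => hα (Finset.mem_filter.1 h3).1
  · exact absurd h1.symm h2
  · exact absurd h2.symm h1
  · rfl

theorem Edge.exists_edgeAt {μ : Shape n} {lam : Shape (n + 1)} (h : μ.Edge lam) :
    ∃ r, μ.EdgeAt lam r := by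
  obtain ⟨α, hα, h⟩ := h
  exact ⟨_, Edge.edgeAt hα h⟩

theorem Edge.subset {μ : Shape n} {lam : Shape (n + 1)} (h : μ.Edge lam) :
    μ.diagram.cells ⊆ lam.diagram.cells := by
  obtain ⟨α, hα, h⟩ := h
  rw [h]
  exact Finset.subset_insert _ _

theorem EdgeAt.eq_right {μ : Shape n} {lam lam' : Shape (n + 1)} {r : ℕ} (h : μ.EdgeAt lam r)
    (h' : μ.EdgeAt lam' r) : lam = lam' := ext_rowLen fun i => by rw [h i, h' i]

theorem EdgeAt.eq_left {μ μ' : Shape n} {lam : Shape (n + 1)} {r : ℕ} (h : μ.EdgeAt lam r)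
    (h' : μ'.EdgeAt lam r) : μ = μ' := ext_rowLen fun i => by
  have h1 := h i
  have h2 := h' i
  omega

theorem EdgeAt.rowStart {μ : Shape n} {lam : Shape (n + 1)} {r : ℕ} (h : μ.EdgeAt lam r)
    (j : ℕ) : lam.rowStart j = μ.rowStart j + if r < j then 1 else 0 := by
  simp only [Shape.rowStart]
  rw [Finset.sum_congr rfl fun i _ => h i, Finset.sum_add_distrib, Finset.sum_ite_eq']
  simp only [Finset.mem_range]

/-- Partial row sums drop by one only behind the removed row. This makes the filtration by the row
of the largest entry order preserving. -/
theorem EdgeAt.le_iff {μ μ' : Shape n} {lam : Shape (n + 1)} {r r' : ℕ} (h : μ.EdgeAt lam r)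
    (h' : μ'.EdgeAt lam r') : μ ≤ μ' ↔ r ≤ r' := by
  constructor
  · intro hle
    by_contra hlt
    have h1 := h.rowStart (r' + 1)
    have h2 := h'.rowStart (r' + 1)
    have h3 := hle (r' + 1)
    rw [if_neg (by omega)] at h1
    rw [if_pos (by omega)] at h2
    omega
  · intro hr j
    have h1 := h.rowStart j
    have h2 := h'.rowStart j
    split_ifs at h1 h2 <;> omega

theorem EdgeAt.row_eq {μ : Shape n} {lam : Shape (n + 1)} {r r' : ℕ} (h : μ.EdgeAt lam r)
    (h' : μ.EdgeAt lam r') : r = r' := by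
  by_contra hr
  have h1 := h r
  have h2 := h' r
  rw [if_pos rfl] at h1
  rw [if_neg hr] at h2
  omega

theorem EdgeAt.rowLen_lt {μ : Shape n} {lam : Shape (n + 1)} {r : ℕ} (h : μ.EdgeAt lam (r + 1)) :
    μ.diagram.rowLen (r + 1) < μ.diagram.rowLen r := by
  have h1 := h r
  have h2 := h (r + 1)
  have h3 := lam.diagram.rowLen_anti r (r + 1) (Nat.le_succ r)
  rw [if_neg (by omega)] at h1
  rw [if_pos rfl] at h2
  omega

theorem exists_edgeAt_of_rowLen_lt {μ : Shape (n + 1)} {r : ℕ}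
    (h : μ.diagram.rowLen (r + 1) < μ.diagram.rowLen r) : ∃ ν : Shape n, ν.EdgeAt μ r := by
  have hmem : (r, μ.diagram.rowLen r - 1) ∈ μ.diagram.cells := by
    rw [mem_cells_iff]
    simp only
    omega
  let Y : YoungDiagram :=
    { cells := μ.diagram.cells.erase (r, μ.diagram.rowLen r - 1)
      isLowerSet := by
        rintro ⟨i, j⟩ ⟨i', j'⟩ hle hp
        rw [Finset.mem_coe, Finset.mem_erase] at hp ⊢
        refine ⟨?_, μ.diagram.isLowerSet hle hp.2⟩
        intro heq
        rw [Prod.mk.injEq] at heq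
        have h1 : i' ≤ i := hle.1
        have h2 : j' ≤ j := hle.2
        have h3 := mem_cells_iff.1 hp.2
        simp only at h3
        rcases (show r ≤ i by omega).eq_or_lt with h4 | h4
        · subst h4
          exact hp.1 (Prod.ext rfl (by simp only; omega))
        · have := μ.diagram.rowLen_anti (r + 1) i h4
          omega }
  have hY : Y.cells = μ.diagram.cells.erase (r, μ.diagram.rowLen r - 1) := rfl
  refine ⟨⟨Y, ?_⟩, ?_⟩
  · rw [YoungDiagram.card, hY, Finset.card_erase_of_mem hmem]
    have : μ.diagram.cells.card = n + 1 := μ.card_eq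
    omega
  · refine Edge.edgeAt (α := (r, μ.diagram.rowLen r - 1)) ?_ ?_
    · simp only [hY]
      exact Finset.notMem_erase _ _
    · simp only [hY]
      exact (Finset.insert_erase hmem).symm

noncomputable instance : Fintype (Shape n) := Fintype.ofFinite _

-- A node can be added in row `r + 1` only if row `r` is strictly longer than row `r + 1`, and then
-- a node can be removed from row `r`. Row `0` is the only addable row not accounted for in this
-- way.
open Classical in
theorem card_upper_le (μ : Shape (n + 1)) :
    (Finset.univ.filter fun lam : Shape (n + 2) => μ.Edge lam).card ≤
      (Finset.univ.filter fun ν : Shape n => ν.Edge μ).card + 1 := by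
  -- The bound serves finiteness only: such a row is nonempty, and a shape with `n + 1` nodes has at
  -- most `n + 1` rows.
  let D : Finset ℕ := (Finset.range (n + 2)).filter fun r =>
    μ.diagram.rowLen (r + 1) < μ.diagram.rowLen r
  have h1 : D.card ≤ (Finset.univ.filter fun ν : Shape n => ν.Edge μ).card := by
    have hD : ∀ r ∈ D, ∃ ν : Shape n, ν.EdgeAt μ r := fun r hr =>
      exists_edgeAt_of_rowLen_lt (Finset.mem_filter.1 hr).2
    have hne : D.Nonempty → Nonempty (Shape n) := fun ⟨r, hr⟩ => ⟨(hD r hr).choose⟩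
    rcases D.eq_empty_or_nonempty with h0 | h0
    · rw [h0]
      exact Nat.zero_le _
    have := hne h0
    choose! g hg using hD
    refine Finset.card_le_card_of_injOn g (fun r hr => ?_) ?_
    · exact Finset.mem_coe.2 (Finset.mem_filter.2 ⟨Finset.mem_univ _, (hg r hr).edge⟩)
    · intro r hr r' hr' h
      have := hg r hr
      rw [h] at this
      exact this.row_eq (hg r' hr')
  have h2 : (Finset.univ.filter fun lam : Shape (n + 2) => μ.Edge lam).card ≤
      (insert 0 (D.image (· + 1))).card := by
    have hU : ∀ lam ∈ Finset.univ.filter fun lam : Shape (n + 2) => μ.Edge lam,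
        ∃ r, μ.EdgeAt lam r := fun lam hlam => (Finset.mem_filter.1 hlam).2.exists_edgeAt
    choose! g hg using hU
    refine Finset.card_le_card_of_injOn g (fun lam hlam => ?_) ?_
    · have h3 := hg lam hlam
      rw [Finset.mem_coe, Finset.mem_insert, Finset.mem_image]
      cases h4 : g lam with
      | zero => exact Or.inl rfl
      | succ r =>
        rw [h4] at h3
        refine Or.inr ⟨r, Finset.mem_filter.2 ⟨Finset.mem_range.2 ?_, h3.rowLen_lt⟩, rfl⟩
        by_contra h5
        have h6 : (r, 0) ∈ μ.diagram.cells := by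
          rw [mem_cells_iff]
          exact (Nat.zero_le _).trans_lt h3.rowLen_lt
        have h7 : (μ.diagram.col 0).card ≤ n + 1 :=
          (Finset.card_le_card (Finset.filter_subset _ _)).trans μ.card_eq.le
        rw [← YoungDiagram.colLen_eq_card] at h7
        have h8 := YoungDiagram.mem_iff_lt_colLen.1 ((YoungDiagram.mem_cells _).1 h6)
        omega
    · intro lam hlam lam' hlam' h
      have := hg lam hlam
      rw [h] at this
      exact this.eq_right (hg lam' hlam')
  refine h2.trans ((Finset.card_insert_le _ _).trans ?_)
  exact Nat.add_le_add_right (Finset.card_image_le.trans h1) 1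

-- A common cover of two distinct shapes must be their union, and when it exists their intersection
-- is covered by both.
open Classical in
theorem card_common_upper_le {μ ν : Shape (n + 1)} (hne : μ ≠ ν) :
    (Finset.univ.filter fun lam : Shape (n + 2) => μ.Edge lam ∧ ν.Edge lam).card ≤
      (Finset.univ.filter fun κ : Shape n => κ.Edge μ ∧ κ.Edge ν).card := by
  have key : ∀ lam : Shape (n + 2), μ.Edge lam → ν.Edge lam → ∃ α β, α ∈ μ.diagram.cells ∧
      β ∉ μ.diagram.cells ∧ β ∈ ν.diagram.cells ∧ α ∉ ν.diagram.cells ∧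
      lam.diagram.cells = insert β μ.diagram.cells ∧
      lam.diagram.cells = insert α ν.diagram.cells := by
    rintro lam ⟨β, hβ, h1⟩ ⟨α, hα, h2⟩
    have hαβ : α ≠ β := by
      rintro rfl
      refine hne (ext_cells ?_)
      rw [← Finset.erase_insert hβ, ← h1, h2, Finset.erase_insert hα]
    refine ⟨α, β, ?_, hβ, ?_, hα, h1, h2⟩
    · have : α ∈ lam.diagram.cells := h2 ▸ Finset.mem_insert_self _ _
      rw [h1] at this
      exact (Finset.mem_insert.1 this).resolve_left hαβ
    · have : β ∈ lam.diagram.cells := h1 ▸ Finset.mem_insert_self _ _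
      rw [h2] at this
      exact (Finset.mem_insert.1 this).resolve_left hαβ.symm
  rcases Finset.eq_empty_or_nonempty
    (Finset.univ.filter fun lam : Shape (n + 2) => μ.Edge lam ∧ ν.Edge lam) with h | ⟨lam, hlam⟩
  · rw [h]
    exact Nat.zero_le _
  · have h1 : (Finset.univ.filter fun lam : Shape (n + 2) => μ.Edge lam ∧ ν.Edge lam).card ≤ 1 := by
      rw [Finset.card_le_one]
      have hU : ∀ l ∈ Finset.univ.filter fun lam : Shape (n + 2) => μ.Edge lam ∧ ν.Edge lam,
          l.diagram.cells = μ.diagram.cells ∪ ν.diagram.cells := by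
        intro l hl
        have hl := (Finset.mem_filter.1 hl).2
        obtain ⟨α, β, hα, hβ, hβ', hα', h1, h2⟩ := key l hl.1 hl.2
        refine Finset.Subset.antisymm ?_ (Finset.union_subset hl.1.subset hl.2.subset)
        rw [h1]
        exact Finset.insert_subset (Finset.mem_union_right _ hβ') Finset.subset_union_left
      intro a ha b hb
      exact ext_cells ((hU a ha).trans (hU b hb).symm)
    refine h1.trans (Finset.card_pos.2 ?_)
    have hlam := (Finset.mem_filter.1 hlam).2
    obtain ⟨α, β, hα, hβ, hβ', hα', h1, h2⟩ := key lam hlam.1 hlam.2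
    have h3 : (μ.diagram ⊓ ν.diagram).cells = μ.diagram.cells ∩ ν.diagram.cells :=
      YoungDiagram.cells_inf _ _
    have h4 : μ.diagram.cells = insert α (μ.diagram.cells ∩ ν.diagram.cells) := by
      refine Finset.Subset.antisymm (fun p hp => ?_)
        (Finset.insert_subset hα Finset.inter_subset_left)
      have : p ∈ lam.diagram.cells := hlam.1.subset hp
      rw [h2, Finset.mem_insert] at this
      rw [Finset.mem_insert, Finset.mem_inter]
      exact this.imp id fun h => ⟨hp, h⟩
    have h5 : ν.diagram.cells = insert β (μ.diagram.cells ∩ ν.diagram.cells) := by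
      refine Finset.Subset.antisymm (fun p hp => ?_)
        (Finset.insert_subset hβ' Finset.inter_subset_right)
      have : p ∈ lam.diagram.cells := hlam.2.subset hp
      rw [h1, Finset.mem_insert] at this
      rw [Finset.mem_insert, Finset.mem_inter]
      exact this.imp id fun h => ⟨h, hp⟩
    have h6 : α ∉ μ.diagram.cells ∩ ν.diagram.cells := fun h => hα' (Finset.mem_inter.1 h).2
    have h7 : β ∉ μ.diagram.cells ∩ ν.diagram.cells := fun h => hβ (Finset.mem_inter.1 h).1
    let κ : Shape n := ⟨μ.diagram ⊓ ν.diagram, by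
      have h8 : μ.diagram.cells.card = n + 1 := μ.card_eq
      rw [h4, Finset.card_insert_of_notMem h6] at h8
      rw [YoungDiagram.card, h3]
      omega⟩
    refine ⟨κ, Finset.mem_filter.2 ⟨Finset.mem_univ _, ⟨α, ?_, ?_⟩, ⟨β, ?_, ?_⟩⟩⟩
    · rw [h3]; exact h6
    · rw [h3]; exact h4
    · rw [h3]; exact h7
    · rw [h3]; exact h5

end Shape

/-! ### Adjoining and removing the largest entry -/

namespace Tableau

variable {n : ℕ} {μ : Shape n} {lam : Shape (n + 1)}

theorem adjoin_apply_of_mem (s : Tableau μ) (h : μ.Edge lam) (p : lam.Node)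
    (hp : p.1 ∈ μ.diagram.cells) : s.adjoin h p = (s ⟨p.1, hp⟩).castSucc := dif_pos hp

theorem adjoin_apply_of_notMem (s : Tableau μ) (h : μ.Edge lam) (p : lam.Node)
    (hp : p.1 ∉ μ.diagram.cells) : s.adjoin h p = Fin.last n := dif_neg hp

theorem adjoin_apply_lt_of_lt {s : Tableau μ} (h : μ.Edge lam) {p p' : lam.Node}
    (hp : p.1 < p'.1) (hs : ∀ (h1 : p.1 ∈ μ.diagram.cells) (h2 : p'.1 ∈ μ.diagram.cells),
      s ⟨p.1, h1⟩ < s ⟨p'.1, h2⟩) : s.adjoin h p < s.adjoin h p' := by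
  by_cases h2 : p'.1 ∈ μ.diagram.cells
  · have h1 : p.1 ∈ μ.diagram.cells := μ.diagram.isLowerSet hp.le h2
    rw [adjoin_apply_of_mem s h p h1, adjoin_apply_of_mem s h p' h2]
    exact Fin.castSucc_lt_castSucc_iff.2 (hs h1 h2)
  · refine lt_of_le_of_ne ?_ fun he => hp.ne (congrArg Subtype.val ((s.adjoin h).injective he))
    rw [adjoin_apply_of_notMem s h p' h2]
    exact Fin.le_last _

theorem IsStandard.adjoin {s : Tableau μ} (hs : s.IsStandard) (h : μ.Edge lam) :
    (s.adjoin h).IsStandard := by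
  refine ⟨fun p p' h1 h2 => ?_, fun p p' h1 h2 => ?_⟩
  · exact adjoin_apply_lt_of_lt h (Prod.lt_iff.2 (Or.inr ⟨h1.le, h2⟩))
      fun h3 h4 => hs.1 ⟨p.1, h3⟩ ⟨p'.1, h4⟩ h1 h2
  · exact adjoin_apply_lt_of_lt h (Prod.lt_iff.2 (Or.inl ⟨h2, h1.le⟩))
      fun h3 h4 => hs.2 ⟨p.1, h3⟩ ⟨p'.1, h4⟩ h1 h2

theorem adjoin_symm_last_notMem (s : Tableau μ) (h : μ.Edge lam) :
    ((s.adjoin h).symm (Fin.last n)).1 ∉ μ.diagram.cells := by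
  intro hp
  have h1 := adjoin_apply_of_mem s h _ hp
  rw [Equiv.apply_symm_apply] at h1
  exact (Fin.castSucc_lt_last _).ne h1.symm

theorem adjoin_symm_castSucc (s : Tableau μ) (h : μ.Edge lam) (k : Fin n) :
    ((s.adjoin h).symm k.castSucc).1 = (s.symm k).1 := by
  have h1 := adjoin_apply_of_mem s h ⟨(s.symm k).1, h.subset (s.symm k).2⟩ (s.symm k).2
  simp only [Subtype.coe_eta, Equiv.apply_symm_apply] at h1
  rw [← h1, Equiv.symm_apply_apply]

theorem adjoin_injective (h : μ.Edge lam) :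
    Function.Injective fun s : Tableau μ => s.adjoin h := by
  intro s s' hss
  refine Equiv.symm_bijective.injective (Equiv.ext fun k => Subtype.ext ?_)
  rw [← adjoin_symm_castSucc s h, ← adjoin_symm_castSucc s' h]
  simp only at hss
  rw [hss]

end Tableau

namespace StdTableau

variable {n : ℕ} {μ : Shape n} {lam : Shape (n + 1)}

/-- The standard tableau `s ∪ α`. -/
noncomputable def adjoin (s : StdTableau μ) (h : μ.Edge lam) : StdTableau lam :=
  ⟨s.1.adjoin h, s.2.adjoin h⟩

theorem adjoin_prev (t : StdTableau lam) : t.prev.adjoin t.prevShape_edge = t := by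
  refine Subtype.ext (Equiv.ext fun p => ?_)
  change t.prev.1.adjoin t.prevShape_edge p = t.1 p
  by_cases hp : p.1 ∈ t.prevShape.diagram.cells
  · rw [Tableau.adjoin_apply_of_mem _ _ _ hp]
    exact Fin.ext rfl
  · rw [Tableau.adjoin_apply_of_notMem _ _ _ hp]
    by_contra hne
    refine hp (Finset.mem_erase.2 ⟨?_, p.2⟩)
    intro he
    rw [Subtype.val_inj] at he
    rw [he, Equiv.apply_symm_apply] at hne
    exact hne rfl

theorem prevShape_adjoin (s : StdTableau μ) (h : μ.Edge lam) : (s.adjoin h).prevShape = μ := by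
  refine Shape.ext_cells ?_
  change lam.diagram.cells.erase _ = _
  have h1 := Tableau.adjoin_symm_last_notMem s.1 h
  obtain ⟨α, hα, hlam⟩ := id h
  have h2 : ((s.adjoin h).1.symm (Fin.last n)).1 = α := by
    have h3 := ((s.adjoin h).1.symm (Fin.last n)).2
    exact (Finset.mem_insert.1 (hlam.subset h3)).resolve_right h1
  rw [h2, hlam, Finset.erase_insert hα]

theorem adjoin_injective (h : μ.Edge lam) :
    Function.Injective fun s : StdTableau μ => s.adjoin h := fun _ _ hss =>
  Subtype.ext (Tableau.adjoin_injective h (congrArg Subtype.val hss))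

theorem exists_adjoin_of_prevShape_eq {t : StdTableau lam} (h : t.prevShape = μ)
    (he : μ.Edge lam) : ∃ s : StdTableau μ, s.adjoin he = t := by
  subst h
  exact ⟨t.prev, t.adjoin_prev⟩

/-! ### Counting standard tableaux in Young's lattice -/

open Classical in
theorem card_eq_sum (lam : Shape (n + 1)) : Fintype.card (StdTableau lam) =
    ∑ μ : Shape n with μ.Edge lam, Fintype.card (StdTableau μ) := by
  rw [← Finset.card_univ, Finset.card_eq_sum_card_fiberwise (f := fun t => t.prevShape)
    (t := Finset.univ.filter fun μ : Shape n => μ.Edge lam)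
    (fun t _ => Finset.mem_coe.2 (Finset.mem_filter.2 ⟨Finset.mem_univ _, t.prevShape_edge⟩))]
  refine Finset.sum_congr rfl fun μ hμ => ?_
  have he := (Finset.mem_filter.1 hμ).2
  rw [← Finset.card_univ]
  symm
  refine Finset.card_bij (fun s _ => s.adjoin he) (fun s _ => ?_) (fun s _ s' _ h => ?_)
    fun t ht => ?_
  · exact Finset.mem_filter.2 ⟨Finset.mem_univ _, prevShape_adjoin s he⟩
  · exact adjoin_injective he h
  · obtain ⟨s, hs⟩ := exists_adjoin_of_prevShape_eq (Finset.mem_filter.1 ht).2 he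
    exact ⟨s, Finset.mem_univ _, hs⟩

-- Going up and then down in Young's lattice exceeds going down and then up by at most the identity,
-- by `Shape.card_upper_le` and `Shape.card_common_upper_le`. Expanding the number of tableaux of
-- each cover over the shapes below it reduces the bound to size `n - 1`.
open Classical in
theorem sum_card_upper_le (n : ℕ) (μ : Shape n) :
    ∑ lam : Shape (n + 1) with μ.Edge lam, Fintype.card (StdTableau lam) ≤
      (n + 1) * Fintype.card (StdTableau μ) := by
  have hsum : ∑ lam : Shape (n + 1) with μ.Edge lam, Fintype.card (StdTableau lam) =
      ∑ ν : Shape n, (Finset.univ.filter fun lam : Shape (n + 1) => μ.Edge lam ∧ ν.Edge lam).card *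
        Fintype.card (StdTableau ν) := by
    simp_rw [card_eq_sum]
    rw [Finset.sum_congr rfl fun lam _ => Finset.sum_filter _ _, Finset.sum_comm]
    refine Finset.sum_congr rfl fun ν _ => ?_
    rw [← Finset.sum_filter, Finset.filter_filter, Finset.sum_const, smul_eq_mul]
  rw [hsum]
  cases n with
  | zero =>
    have hsub : ∀ ν : Shape 0, ν = μ := fun ν => Shape.ext_cells (by
      rw [Finset.card_eq_zero.1 ν.card_eq, Finset.card_eq_zero.1 μ.card_eq])
    have hrow : ∀ i, μ.diagram.rowLen i = 0 := fun i => by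
      rw [YoungDiagram.rowLen_eq_card]
      exact Nat.le_zero.1 ((Finset.card_le_card (Finset.filter_subset _ _)).trans μ.card_eq.le)
    rw [Finset.sum_eq_single μ (fun ν _ h => absurd (hsub ν) h)
      fun h => absurd (Finset.mem_univ _) h]
    refine Nat.mul_le_mul_right _ (Finset.card_le_one.2 fun a ha b hb => ?_)
    have h0 : ∀ lam : Shape 1, μ.Edge lam → μ.EdgeAt lam 0 := by
      intro lam h
      obtain ⟨r, hr⟩ := h.exists_edgeAt
      cases r with
      | zero => exact hr
      | succ r =>
        have := hr.rowLen_lt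
        rw [hrow, hrow] at this
        exact absurd this (lt_irrefl _)
    exact (h0 a (Finset.mem_filter.1 ha).2.1).eq_right (h0 b (Finset.mem_filter.1 hb).2.1)
  | succ n =>
    have hc : ∀ ν : Shape (n + 1),
        (Finset.univ.filter fun lam : Shape (n + 1 + 1) => μ.Edge lam ∧ ν.Edge lam).card ≤
        (Finset.univ.filter fun κ : Shape n => κ.Edge μ ∧ κ.Edge ν).card +
          if ν = μ then 1 else 0 := by
      intro ν
      split_ifs with h
      · subst h
        simpa only [and_self] using Shape.card_upper_le ν
      · exact Shape.card_common_upper_le (Ne.symm h)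
    have h1 : ∑ ν : Shape (n + 1), (Finset.univ.filter fun κ : Shape n => κ.Edge μ ∧ κ.Edge ν).card *
        Fintype.card (StdTableau ν) = ∑ κ : Shape n with κ.Edge μ,
          ∑ ν : Shape (n + 1) with κ.Edge ν, Fintype.card (StdTableau ν) := by
      rw [Finset.sum_congr rfl fun κ _ => Finset.sum_filter _ _, Finset.sum_comm]
      refine Finset.sum_congr rfl fun ν _ => ?_
      rw [← Finset.sum_filter, Finset.filter_filter, Finset.sum_const, smul_eq_mul]
    calc _ ≤ ∑ ν : Shape (n + 1),
          ((Finset.univ.filter fun κ : Shape n => κ.Edge μ ∧ κ.Edge ν).card *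
            Fintype.card (StdTableau ν) + if ν = μ then Fintype.card (StdTableau ν) else 0) := by
          refine Finset.sum_le_sum fun ν _ => (Nat.mul_le_mul_right _ (hc ν)).trans ?_
          rw [add_mul, ite_mul, one_mul, zero_mul]
      _ = ∑ κ : Shape n with κ.Edge μ, ∑ ν : Shape (n + 1) with κ.Edge ν,
            Fintype.card (StdTableau ν) + Fintype.card (StdTableau μ) := by
          rw [Finset.sum_add_distrib, h1, Finset.sum_ite_eq']
          simp
      _ ≤ ∑ κ : Shape n with κ.Edge μ, (n + 1) * Fintype.card (StdTableau κ) +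
            Fintype.card (StdTableau μ) :=
          Nat.add_le_add_right (Finset.sum_le_sum fun κ _ => sum_card_upper_le n κ) _
      _ = (n + 1 + 1) * Fintype.card (StdTableau μ) := by
          rw [← Finset.mul_sum, ← card_eq_sum]
          ring

-- The inequality half of the Robinson-Schensted count suffices, because the Murphy elements are
-- already known to span.
open Classical in
theorem sum_card_mul_card_le (n : ℕ) :
    ∑ lam : Shape n, Fintype.card (StdTableau lam) * Fintype.card (StdTableau lam) ≤
      n.factorial := by
  induction n with
  | zero =>
    have hsub : ∀ μ ν : Shape 0, ν = μ := fun μ ν => Shape.ext_cells (by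
      rw [Finset.card_eq_zero.1 ν.card_eq, Finset.card_eq_zero.1 μ.card_eq])
    have h1 : ∀ μ : Shape 0, Fintype.card (StdTableau μ) ≤ 1 := fun μ =>
      Fintype.card_le_one_iff.2 fun a b => Subtype.ext (Equiv.ext fun p => Subsingleton.elim _ _)
    calc _ ≤ ∑ _μ : Shape 0, 1 := Finset.sum_le_sum fun μ _ => Nat.mul_le_mul (h1 μ) (h1 μ)
      _ ≤ 1 := by
        rw [Finset.sum_const, smul_eq_mul, mul_one]
        exact Finset.card_le_one.2 fun a _ b _ => hsub b a
  | succ n ih =>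
    calc _ = ∑ lam : Shape (n + 1), ∑ μ : Shape n with μ.Edge lam,
          Fintype.card (StdTableau μ) * Fintype.card (StdTableau lam) := by
          refine Finset.sum_congr rfl fun lam _ => ?_
          rw [← Finset.sum_mul, ← card_eq_sum]
      _ = ∑ μ : Shape n, Fintype.card (StdTableau μ) *
          ∑ lam : Shape (n + 1) with μ.Edge lam, Fintype.card (StdTableau lam) := by
          simp_rw [Finset.sum_filter, Finset.mul_sum]
          rw [Finset.sum_comm]
          simp only [mul_ite, mul_zero]
      _ ≤ ∑ μ : Shape n, (n + 1) * (Fintype.card (StdTableau μ) * Fintype.card (StdTableau μ)) :=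
          Finset.sum_le_sum fun μ _ => (Nat.mul_le_mul_left _ (sum_card_upper_le n μ)).trans
            (le_of_eq (by ring))
      _ ≤ _ := by
          rw [← Finset.mul_sum, Nat.factorial_succ]
          exact Nat.mul_le_mul_left _ ih

end StdTableau

/-! ## The Murphy basis is cellular -/

namespace Hecke

variable {R : Type*} [CommRing R] {q : Rˣ} {n : ℕ}

/-- A spanning family with no more elements than the rank of a finite free module over a commutative
ring is a basis. The rank `n!` comes from the basis `T_w`. -/
theorem linearIndependent_murphy : LinearIndependent R
    (fun i : (Σ lam : Shape n, StdTableau lam × StdTableau lam) =>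
      (murphy i.1 i.2.1 i.2.2 : Hecke R q n)) := by
  classical
  rcases subsingleton_or_nontrivial R with hR | hR
  · exact linearIndependent_of_subsingleton
  have hcard : Fintype.card (Σ lam : Shape n, StdTableau lam × StdTableau lam) ≤
      Module.finrank R (Hecke R q n) := by
    rw [Module.finrank_eq_card_basis basisT, Fintype.card_perm, Fintype.card_fin,
      Fintype.card_sigma]
    simp_rw [Fintype.card_prod]
    exact StdTableau.sum_card_mul_card_le n
  have : Module.Finite R (Hecke R q n) := Module.Finite.of_basis basisT
  have : Module.Free R (Hecke R q n) := Module.Free.of_basis basisT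
  exact linearIndependent_of_top_le_span_of_card_le_finrank span_murphy.ge hcard

theorem isCellDatum_murphy : IsCellDatum R (star (R := R) (q := q) (n := n)) murphy where
  star_mul := star_mul
  star_star := star_star
  finite_index := inferInstance
  linearIndependent := linearIndependent_murphy
  span_eq_top := span_murphy
  mul_right := murphy_mul
  star_basis lam s t := by
    rw [star_murphy, sub_self]
    exact Submodule.zero_mem _

end Hecke

/-! ## Descending cycles -/

section Cycles

variable {n : ℕ}

theorem filter_le_finRange (a : Fin n) : (List.finRange n).filter (a ≤ ·) =
    a :: (List.finRange n).filter (a < ·) := by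
  refine List.Pairwise.eq_of_mem_iff (r := (· < ·)) ((List.pairwise_lt_finRange n).filter _) ?_ ?_
  · rw [List.pairwise_cons]
    exact ⟨fun b hb => by simpa using hb, (List.pairwise_lt_finRange n).filter _⟩
  · intro b
    simp only [List.mem_cons, List.mem_filter, List.mem_finRange, true_and, decide_eq_true_eq,
      le_iff_eq_or_lt]
    exact or_congr eq_comm Iff.rfl

theorem filter_castSucc_lt_finRange (i : Fin n) : (List.finRange (n + 1)).filter (i.castSucc < ·) =
    (List.finRange (n + 1)).filter (i.succ ≤ ·) :=
  List.filter_congr fun k _ => by simp only [decide_eq_decide, Fin.lt_def, Fin.le_def]; rfl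

theorem descendingCycle_last : descendingCycle (Fin.last n) = 1 := by
  have h : (List.finRange (n + 1)).filter (Fin.last n < ·) = [] := by
    rw [List.filter_eq_nil_iff]
    intro k _
    simpa using Fin.le_last k
  rw [descendingCycle, filter_le_finRange, h]
  exact List.formPerm_singleton _

theorem descendingCycle_castSucc (i : Fin n) : descendingCycle i.castSucc =
    descendingCycle i.succ * simpleSwap (n := n + 1) i := by
  rw [descendingCycle, descendingCycle, filter_le_finRange, filter_castSucc_lt_finRange,
    filter_le_finRange, List.formPerm_reverse, List.formPerm_reverse, List.formPerm_cons_cons,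
    mul_inv_rev, Equiv.swap_inv]
  rfl

/-- The cycle takes out position `c` and closes the gap, which `Fin.succAbove` describes without
case distinctions. -/
theorem descendingCycle_apply (c : Fin (n + 1)) : descendingCycle c c = Fin.last n ∧
    ∀ a, descendingCycle c (c.succAbove a) = a.castSucc := by
  induction c using Fin.reverseInduction with
  | last =>
    rw [descendingCycle_last]
    exact ⟨rfl, fun a => Fin.succAbove_last_apply a⟩
  | cast i ih =>
    rw [descendingCycle_castSucc]
    refine ⟨?_, fun a => ?_⟩
    · rw [Equiv.Perm.mul_apply]
      exact (congrArg _ (simpleSwap_lo (n := n + 1) i)).trans ih.1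
    · rw [Equiv.Perm.mul_apply]
      rcases lt_trichotomy a i with h | rfl | h
      · rw [Fin.succAbove_of_castSucc_lt _ _ (Fin.castSucc_lt_castSucc_iff.2 h),
          simpleSwap_of_ne (n := n + 1) (Fin.ne_of_lt (Fin.castSucc_lt_castSucc_iff.2 h))
            (Fin.ne_of_lt (Fin.castSucc_lt_succ_iff.2 h.le))]
        exact (congrArg _ (Fin.succAbove_of_castSucc_lt _ _
          (Fin.castSucc_lt_succ_iff.2 h.le)).symm).trans (ih.2 a)
      · rw [Fin.succAbove_of_le_castSucc _ _ le_rfl, ← ih.2 a]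
        refine congrArg _ ((simpleSwap_hi (n := n + 1) a).trans ?_)
        rw [Fin.succAbove_of_castSucc_lt _ _ Fin.castSucc_lt_succ]
        rfl
      · rw [Fin.succAbove_of_le_castSucc _ _ (Fin.castSucc_le_castSucc_iff.2 h.le),
          simpleSwap_of_ne (n := n + 1) (Fin.ne_of_gt (Fin.castSucc_lt_succ_iff.2 h.le))
            (Fin.ne_of_gt (Fin.succ_lt_succ_iff.2 h)), ← ih.2 a,
          Fin.succAbove_of_le_castSucc _ _ (Fin.succ_le_castSucc_iff.2 h)]

theorem eq_descendingCycle {c : Fin (n + 1)} {p : Equiv.Perm (Fin (n + 1))}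
    (h1 : p c = Fin.last n) (h2 : ∀ a, p (c.succAbove a) = a.castSucc) : p = descendingCycle c := by
  refine Equiv.ext fun x => ?_
  rcases Fin.eq_self_or_eq_succAbove c x with rfl | ⟨a, rfl⟩
  · rw [h1, (descendingCycle_apply x).1]
  · rw [h2, (descendingCycle_apply c).2]

theorem descendingCycle_inv_castSucc (c : Fin (n + 1)) (a : Fin n) :
    (descendingCycle c)⁻¹ a.castSucc = c.succAbove a := by
  rw [← (descendingCycle_apply c).2, perm_inv_apply]

/-! ### Descending cycles in the Hecke algebra, and products with additive lengths -/

namespace Hecke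

variable {R : Type*} [CommRing R] {q : Rˣ}

theorem T_descendingCycle (c : Fin (n + 1)) :
    (T (descendingCycle c) : Hecke R q (n + 1)) = TT c (Fin.last n) := by
  induction c using Fin.reverseInduction with
  | last =>
    rw [descendingCycle_last, T_one, TT, if_pos le_rfl]
    have : (List.finRange (n + 1 - 1)).filter
        (fun k => (Fin.last n).1 ≤ k.1 ∧ k.1 < (Fin.last n).1) = [] := by
      rw [List.filter_eq_nil_iff]
      intro k _
      simp only [decide_eq_true_eq]
      omega
    rw [this]
    rfl
  | cast i ih =>
    have h : (gen (n := n + 1) i * T (descendingCycle i.succ) : Hecke R q (n + 1)) =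
        T (descendingCycle i.castSucc) := by
      rw [descendingCycle_castSucc]
      refine gen_mul_T (n := n + 1) ?_
      have h1 : lo (n := n + 1) i = i.succ.succAbove i :=
        (Fin.succAbove_of_castSucc_lt _ _ Fin.castSucc_lt_succ).symm
      have h2 : hi (n := n + 1) i = i.succ := rfl
      rw [h1, h2, (descendingCycle_apply _).1, (descendingCycle_apply _).2]
      exact Fin.castSucc_lt_last _
    rw [← h, ih, TT, TT, if_pos (Fin.le_last _), if_pos (Fin.le_last _), ← List.prod_cons,
      ← List.map_cons]
    congr 2
    have h3 : ∀ a : ℕ, (List.finRange (n + 1 - 1)).filter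
        (fun k => a ≤ k.1 ∧ k.1 < (Fin.last n).1) =
        (List.finRange n).filter (fun k => a ≤ k.1) := fun a =>
      List.filter_congr fun k _ => by
        have : k.1 < n := k.2
        simp [this]
    rw [h3, h3]
    exact (filter_le_finRange i).symm

/-- A permutation that preserves the order of the positions of the first `n` letters can be
multiplied by a permutation of these letters with the lengths adding up. -/
theorem T_extendPerm_mul {d : Equiv.Perm (Fin (n + 1))}
    (hd : StrictMono fun a : Fin n => d⁻¹ a.castSucc) (p : Equiv.Perm (Fin n)) :
    (T d * incl n (T p) : Hecke R q (n + 1)) = T (extendPerm p * d) ∧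
      invCount (extendPerm p * d) = invCount p + invCount d := by
  induction p using perm_induction with
  | one => rw [T_one, map_one, mul_one, extendPerm_one, one_mul, invCount_one, zero_add]; simp
  | step p i h ih =>
    have h1 : (extendPerm p * d)⁻¹ (lo (castGen i)) < (extendPerm p * d)⁻¹ (hi (castGen i)) := by
      rw [mul_inv_rev, ← extendPerm_inv, lo_castGen, hi_castGen, Equiv.Perm.mul_apply,
        Equiv.Perm.mul_apply, extendPerm_castSucc, extendPerm_castSucc]
      exact hd h
    rw [← T_mul_gen h, map_mul, ← mul_assoc, ih.1, incl_gen, T_mul_gen h1, extendPerm_mul,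
      extendPerm_simpleSwap, mul_assoc, invCount_simpleSwap_mul h1, invCount_simpleSwap_mul h, ih.2]
    exact ⟨rfl, by ring⟩

end Hecke

end Cycles

/-! ## Adjoining a node -/

namespace Tableau

variable {n : ℕ} {μ : Shape n} {lam : Shape (n + 1)}

theorem perm_apply {lam : Shape n} (t : Tableau lam) (p : lam.Node) :
    t.perm (initial lam p) = t p := by
  rw [perm, Equiv.trans_apply, Equiv.symm_apply_apply]

/-- First renumber `t^lam` so that the new node gets the largest entry and the others are numbered
as in `t^μ`; then permute the smaller entries by `w(s)`. -/
theorem perm_adjoin (s : Tableau μ) (h : μ.Edge lam) :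
    (s.adjoin h).perm = extendPerm s.perm * ((initial μ).adjoin h).perm := by
  refine Equiv.ext fun k => ?_
  obtain ⟨p, rfl⟩ := (initial lam).surjective k
  rw [Equiv.Perm.mul_apply, perm_apply, perm_apply]
  by_cases hp : p.1 ∈ μ.diagram.cells
  · rw [adjoin_apply_of_mem _ _ _ hp, adjoin_apply_of_mem _ _ _ hp, extendPerm_castSucc,
      perm_apply]
  · rw [adjoin_apply_of_notMem _ _ _ hp, adjoin_apply_of_notMem _ _ _ hp, extendPerm_last]

theorem rowWord_adjoin_castSucc (s : Tableau μ) (h : μ.Edge lam) (k : Fin n) :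
    rowWord (s.adjoin h) k.castSucc = rowWord s k :=
  congrArg Prod.fst (adjoin_symm_castSucc s h k)

theorem rowWord_adjoin_last (s : Tableau μ) (h : μ.Edge lam) {r : ℕ} (hr : μ.EdgeAt lam r) :
    rowWord (s.adjoin h) (Fin.last n) = r := by
  have h1 := ((s.adjoin h).symm (Fin.last n)).2
  have h2 := (Finset.mem_insert.1 (hr.cells.subset h1)).resolve_right (adjoin_symm_last_notMem s h)
  exact congrArg Prod.fst h2

/-- The new node ends row `r`, so the numbering of `lam` along rows agrees with that of `μ` up to
this row and is shifted by one behind it. -/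
theorem initial_of_mem {r : ℕ} (hr : μ.EdgeAt lam r) {α p : lam.Node}
    (hα : α.1 ∉ μ.diagram.cells) (hp : p.1 ∈ μ.diagram.cells) :
    initial lam p = (initial lam α).succAbove (initial μ ⟨p.1, hp⟩) := by
  have hα' : α.1 = (r, μ.diagram.rowLen r) :=
    (Finset.mem_insert.1 (hr.cells.subset α.2)).resolve_right hα
  have h1 : (initial lam α).1 = μ.rowStart (r + 1) := by
    rw [initial_val, hα', hr.rowStart, if_neg (lt_irrefl _), Shape.rowStart_succ, add_zero]
  have h2 := initial_val p
  have h3 := initial_val (lam := μ) ⟨p.1, hp⟩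
  simp only at h3
  rw [hr.rowStart] at h2
  have h4 := entry_lt (lam := μ) ⟨p.1, hp⟩
  simp only at h4
  refine Fin.ext ?_
  rw [h2]
  by_cases hrp : r < p.1.1
  · have h5 := μ.rowStart_mono (show r + 1 ≤ p.1.1 from hrp)
    rw [if_pos hrp, Fin.succAbove_of_le_castSucc, Fin.val_succ, h3]
    · omega
    · rw [Fin.le_def, Fin.val_castSucc, h1, h3]
      omega
  · have h5 := μ.rowStart_mono (show p.1.1 + 1 ≤ r + 1 by omega)
    rw [if_neg hrp, Fin.succAbove_of_castSucc_lt, Fin.val_castSucc, h3]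
    · omega
    · rw [Fin.lt_def, Fin.val_castSucc, h1, h3]
      omega

theorem perm_adjoin_initial (h : μ.Edge lam) {α : lam.Node} (hα : α.1 ∉ μ.diagram.cells) :
    ((initial μ).adjoin h).perm = descendingCycle (initial lam α) := by
  obtain ⟨r, hr⟩ := h.exists_edgeAt
  refine eq_descendingCycle ?_ fun a => ?_
  · rw [perm_apply, adjoin_apply_of_notMem _ _ _ hα]
  · have hp := ((initial μ).symm a).2
    have h1 := initial_of_mem hr hα (p := ⟨((initial μ).symm a).1, h.subset hp⟩) hp
    simp only [Subtype.coe_eta, Equiv.apply_symm_apply] at h1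
    rw [← h1, perm_apply, adjoin_apply_of_mem _ _ _ hp]
    simp only [Subtype.coe_eta, Equiv.apply_symm_apply]

theorem strictMono_perm_adjoin_initial_inv (h : μ.Edge lam) :
    StrictMono fun a : Fin n => (((initial μ).adjoin h).perm)⁻¹ a.castSucc := by
  have h1 := adjoin_symm_last_notMem (initial μ) h
  intro a b hab
  simp only
  rw [perm_adjoin_initial h h1, descendingCycle_inv_castSucc, descendingCycle_inv_castSucc]
  exact Fin.strictMono_succAbove _ hab

end Tableau

/-! ### Branching elements and their products along paths -/

namespace Hecke

open Tableau

variable {R : Type*} [CommRing R] {q : Rˣ}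

theorem dCoeff_mul_incl {n : ℕ} {μ : Shape n} {lam : Shape (n + 1)} (s : Tableau μ)
    (h : μ.Edge lam) : (dCoeff n μ lam h * incl n (T s.perm) : Hecke R q (n + 1)) =
      T (s.adjoin h).perm := by
  rw [dCoeff, perm_adjoin s, (T_extendPerm_mul (strictMono_perm_adjoin_initial_inv h) s.perm).1]

theorem invCount_perm_adjoin {n : ℕ} {μ : Shape n} {lam : Shape (n + 1)} (s : Tableau μ)
    (h : μ.Edge lam) : invCount (s.adjoin h).perm =
      invCount s.perm + invCount ((initial μ).adjoin h).perm := by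
  rw [perm_adjoin s]
  -- The additivity of lengths does not involve the algebra, so any ring and parameter serve.
  exact (T_extendPerm_mul (R := ℤ) (q := 1) (strictMono_perm_adjoin_initial_inv h) s.perm).2

theorem pathProd_dCoeff (n : ℕ) (lam : Shape n) (t : StdTableau lam) :
    pathProd dCoeff n lam t = (T t.1.perm : Hecke R q n) := by
  induction n with
  | zero => rw [pathProd, Subsingleton.elim t.1.perm 1, T_one]
  | succ n ih =>
    rw [pathProd, ih, dCoeff_mul_incl]
    exact congrArg (fun t : StdTableau lam => (T t.1.perm : Hecke R q (n + 1))) t.adjoin_prev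

end Hecke

/-! ## Cell modules and coordinates -/

namespace CellModule

variable {R A L : Type*} {M : L → Type*} [CommRing R] [Ring A] [Algebra R A]
    [PartialOrder L] [∀ lam, Fintype (M lam)] {star : A →ₗ[R] A}
    {c : (lam : L) → M lam → M lam → A} (h : IsCellDatum R star c) (lam : L)

theorem op_smul_apply (a : A) (x : CellModule h lam) (v : M lam) :
    (op a • x : CellModule h lam) v = ∑ t, x t * h.coeff lam t a v := rfl

theorem add_apply (x y : CellModule h lam) (v : M lam) : (x + y) v = x v + y v := rfl

theorem smul_apply (r : R) (x : CellModule h lam) (v : M lam) : (r • x) v = r * x v := rfl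

theorem op_smul_smul (a : A) (r : R) (x : CellModule h lam) : op a • r • x = r • op a • x := by
  funext v
  rw [smul_apply, op_smul_apply, op_smul_apply, Finset.mul_sum]
  exact Finset.sum_congr rfl fun t _ => by rw [smul_apply, mul_assoc]

theorem smul_op_smul (r : R) (a : A) (x : CellModule h lam) : op (r • a) • x = r • op a • x := by
  funext v
  rw [smul_apply, op_smul_apply, op_smul_apply, Finset.mul_sum]
  refine Finset.sum_congr rfl fun t _ => ?_
  rw [h.coeff_eq lam t (r • a) (r • h.coeff lam t a), Pi.smul_apply, smul_eq_mul, mul_left_comm]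
  have := Submodule.smul_mem _ r (h.coeff_spec lam t a t)
  simpa only [Pi.smul_apply, smul_assoc, ← Finset.smul_sum, mul_smul_comm, ← smul_sub] using this

variable {lam} in
theorem basis_apply_self (t : M lam) : (basis h lam t : CellModule h lam) t = 1 := by
  classical
  rw [basis]
  exact (congrFun (Pi.basisFun_apply R (M lam) t) t).trans (Pi.single_eq_same _ _)

variable {lam} in
theorem basis_apply_of_ne {t v : M lam} (hv : v ≠ t) :
    (basis h lam t : CellModule h lam) v = 0 := by
  classical
  rw [basis]
  exact (congrFun (Pi.basisFun_apply R (M lam) t) v).trans (Pi.single_eq_of_ne hv _)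

theorem sum_smul_basis (x : CellModule h lam) : ∑ t, x t • basis h lam t = x :=
  (basis h lam).sum_repr x

/-- The basis of a cellular algebra. -/
noncomputable def cellBasis :
    Module.Basis (Σ lam : L, M lam × M lam) R A :=
  Module.Basis.mk h.linearIndependent h.span_eq_top.ge

theorem cellBasis_apply (i : Σ lam : L, M lam × M lam) : cellBasis h i = c i.1 i.2.1 i.2.2 :=
  Module.Basis.mk_apply _ _ i

/-- The coefficients of the basis elements `c lam s v` in an element of the algebra. -/
noncomputable def coord (s : M lam) : A →ₗ[R] CellModule h lam where
  toFun x := fun v => (cellBasis h).repr x ⟨lam, s, v⟩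
  map_add' x y := funext fun v => by rw [map_add]; rfl
  map_smul' r x := funext fun v => by rw [map_smul]; rfl

theorem coord_apply (s : M lam) (x : A) (v : M lam) :
    coord h lam s x v = (cellBasis h).repr x ⟨lam, s, v⟩ := rfl

theorem coord_self (s t : M lam) : coord h lam s (c lam s t) = basis h lam t := by
  classical
  funext v
  rw [coord_apply, ← cellBasis_apply h ⟨lam, s, t⟩, Module.Basis.repr_self,
    Finsupp.single_apply]
  split_ifs with hv
  · simp only [Sigma.mk.injEq, heq_eq_eq, Prod.mk.injEq, true_and] at hv
    rw [hv, basis_apply_self]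
  · rw [basis_apply_of_ne]
    rintro rfl
    exact hv rfl

theorem coord_of_mem_cellAbove (s : M lam) {x : A} (hx : x ∈ cellAbove R c lam) :
    coord h lam s x = 0 := by
  classical
  induction hx using Submodule.span_induction with
  | mem x hx =>
    obtain ⟨μ, hμ, s', t', rfl⟩ := hx
    funext v
    rw [coord_apply, ← cellBasis_apply h ⟨μ, s', t'⟩, Module.Basis.repr_self,
      Finsupp.single_apply, if_neg]
    · rfl
    · intro he
      exact hμ.ne (congrArg Sigma.fst he).symm
  | zero => exact map_zero _
  | add x y _ _ hx hy => rw [map_add, hx, hy, add_zero]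
  | smul r x _ hx => rw [map_smul, hx, smul_zero]

/-- Multiplication in the algebra stays, modulo more dominant terms, in the row of basis elements
with fixed first index `s`. The action on the cell module can hence be read off there, for any `s`.
-/
theorem op_smul_basis (s t : M lam) (a : A) :
    op a • basis h lam t = coord h lam s (c lam s t * a) := by
  have h1 := coord_of_mem_cellAbove h lam s (h.coeff_spec lam t a s)
  rw [map_sub, sub_eq_zero, map_sum] at h1
  rw [h1]
  simp only [map_smul, coord_self]
  rw [← sum_smul_basis h lam (op a • basis h lam t)]
  refine Finset.sum_congr rfl fun v _ => ?_
  rw [op_smul_apply, Finset.sum_eq_single t, basis_apply_self, one_mul]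
  · intro u _ hu
    rw [basis_apply_of_ne h hu, zero_mul]
  · exact fun ht => absurd (Finset.mem_univ _) ht

theorem op_algebraMap_smul (r : R) (x : CellModule h lam) : op (algebraMap R A r) • x = r • x := by
  rw [Algebra.algebraMap_eq_smul_one, smul_op_smul, op_one, one_smul]

end CellModule

/-! ### Cell modules of the Murphy basis in terms of words -/

namespace Hecke

open Tableau CellModule

variable {R : Type*} [CommRing R] {q : Rˣ} {n : ℕ}

variable (R q) in
/-- The cell modules of the Murphy basis. -/
abbrev Cell (lam : Shape n) : Type _ := CellModule (isCellDatum_murphy (R := R) (q := q)) lam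

variable (R q) in
/-- The standard basis of a cell module. -/
noncomputable abbrev cellVec {lam : Shape n} (t : StdTableau lam) : Cell R q lam :=
  CellModule.basis isCellDatum_murphy lam t

variable (R q) in
/-- The image in the cell module of the combination of words `c`. -/
noncomputable def wordVecLin (lam : Shape n) : ((Fin n → ℕ) →₀ R) →ₗ[R] Cell R q lam :=
  coord isCellDatum_murphy lam (StdTableau.initial lam) ∘ₗ wordLin R q lam.word

variable (R q) in
/-- The image in the cell module of a word. -/
noncomputable def wordVec (lam : Shape n) (f : Fin n → ℕ) : Cell R q lam :=
  coord isCellDatum_murphy lam (StdTableau.initial lam) (wordSum R q lam.word f)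

theorem wordVecLin_single (lam : Shape n) (f : Fin n → ℕ) :
    wordVecLin R q lam (Finsupp.single f 1) = wordVec R q lam f := by
  rw [wordVecLin, LinearMap.comp_apply, wordLin_single, wordVec]

theorem murphy_initial_left (lam : Shape n) (t : StdTableau lam) :
    (murphy lam (StdTableau.initial lam) t : Hecke R q n) = m lam * T t.1.perm := by
  have : (StdTableau.initial lam).1.perm = 1 := perm_initial lam
  rw [murphy, this, T_one, star_one, one_mul]

theorem op_smul_cellVec_initial (lam : Shape n) (a : Hecke R q n) :
    op a • cellVec R q (StdTableau.initial lam) =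
      coord isCellDatum_murphy lam (StdTableau.initial lam) (m lam * a) := by
  rw [cellVec, op_smul_basis _ _ (StdTableau.initial lam), murphy_initial_left]
  have : (StdTableau.initial lam).1.perm = 1 := perm_initial lam
  rw [this, T_one, mul_one]

theorem op_T_smul_cellVec_initial {lam : Shape n} (t : StdTableau lam) :
    op (T t.1.perm : Hecke R q n) • cellVec R q (StdTableau.initial lam) = cellVec R q t := by
  rw [op_smul_cellVec_initial, ← murphy_initial_left, coord_self]

theorem span_cellVec_initial (lam : Shape n) :
    Submodule.span (Hecke R q n)ᵐᵒᵖ {cellVec R q (StdTableau.initial lam)} = ⊤ := by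
  rw [eq_top_iff]
  intro x _
  rw [← sum_smul_basis _ _ x]
  refine Submodule.sum_mem _ fun t _ => ?_
  have h : x t • cellVec R q t = op (algebraMap R (Hecke R q n) (x t)) •
      op (T t.1.perm : Hecke R q n) • cellVec R q (StdTableau.initial lam) := by
    rw [op_T_smul_cellVec_initial, op_algebraMap_smul]
  have h0 : cellVec R q (StdTableau.initial lam) ∈ Submodule.span (Hecke R q n)ᵐᵒᵖ
      {cellVec R q (StdTableau.initial lam)} := Submodule.subset_span rfl
  exact h ▸ Submodule.smul_mem _ _ (Submodule.smul_mem _ _ h0)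

theorem wordLin_mem_range (lam : Shape n) (c : (Fin n → ℕ) →₀ R) :
    ∃ x, wordLin R q lam.word c = m lam * x := by
  suffices h : wordLin R q lam.word c ∈ LinearMap.range (LinearMap.mulLeft R (m lam)) by
    obtain ⟨x, hx⟩ := h
    exact ⟨x, hx.symm⟩
  rw [wordLin, Finsupp.linearCombination_apply]
  refine Submodule.sum_mem _ fun f _ => Submodule.smul_mem _ _ ?_
  by_cases hf : IsRearrangement lam.word f
  · obtain ⟨x, hx⟩ := exists_mul_eq_wordSum (R := R) (q := q) (monotone_rowWord_initial lam) hf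
    exact ⟨x, by rw [LinearMap.mulLeft_apply, m_eq_wordSum, hx]⟩
  · rw [wordSum_of_not_isRearrangement hf]
    exact Submodule.zero_mem _

/-- The evaluation of `c` lies in the right ideal of `m lam`, and reading coordinates there commutes
with right multiplication. The formal action on words thus computes the action on the cell module.
-/
theorem op_gen_smul_wordVecLin (lam : Shape n) (c : (Fin n → ℕ) →₀ R) (i : Fin (n - 1)) :
    op (gen i : Hecke R q n) • wordVecLin R q lam c = wordVecLin R q lam (wordOp q i c) := by
  obtain ⟨x, hx⟩ := wordLin_mem_range (R := R) (q := q) lam c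
  rw [wordVecLin, LinearMap.comp_apply, LinearMap.comp_apply, hx,
    wordLin_wordOp (monotone_rowWord_initial lam), hx, ← op_smul_cellVec_initial, mul_assoc,
    ← op_smul_cellVec_initial, op_mul, mul_smul]

theorem wordVec_rowWord {lam : Shape n} (t : StdTableau lam) :
    wordVec R q lam (rowWord t.1) = (q : R) ^ invCount t.1.perm • cellVec R q t := by
  rw [wordVec, wordSum_rowWord, map_smul, ← murphy_initial_left, coord_self]

theorem wordVec_of_not_isRearrangement {lam : Shape n} {f : Fin n → ℕ}
    (hf : ¬ IsRearrangement lam.word f) : wordVec R q lam f = 0 := by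
  rw [wordVec, wordSum_of_not_isRearrangement hf, map_zero]

theorem coord_of_mem_idealAbove {lam : Shape n} {x : Hecke R q n}
    (hx : x ∈ idealAbove R q lam.word) :
    coord isCellDatum_murphy lam (StdTableau.initial lam) x = 0 :=
  coord_of_mem_cellAbove _ _ _ (idealAbove_le_cellAbove lam hx)

theorem wordVec_mem_span (lam : Shape n) (f : Fin n → ℕ) : wordVec R q lam f ∈
    Submodule.span R (cellVec R q '' {t : StdTableau lam | Dominates (rowWord t.1) f}) := by
  by_cases hf : IsRearrangement lam.word f
  · have h := Submodule.mem_map_of_mem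
      (f := coord isCellDatum_murphy lam (StdTableau.initial lam))
      (wordSum_mem_span_lattice (R := R) (q := q) (monotone_rowWord_initial lam) hf)
    refine SetLike.le_def.1 ?_ h
    rw [Submodule.map_sup, Submodule.map_span]
    refine sup_le (Submodule.span_le.2 ?_) ?_
    · rintro _ ⟨_, ⟨g, ⟨hg1, hg2, hg3⟩, rfl⟩, rfl⟩
      obtain ⟨t, rfl⟩ := hg2.exists_of_isRearrangement hg1
      change wordVec R q lam (rowWord t.1) ∈ _
      rw [wordVec_rowWord]
      exact Submodule.smul_mem _ _ (Submodule.subset_span ⟨t, hg3, rfl⟩)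
    · rintro _ ⟨x, hx, rfl⟩
      rw [coord_of_mem_idealAbove hx]
      exact Submodule.zero_mem _
  · rw [wordVec_of_not_isRearrangement hf]
    exact Submodule.zero_mem _

/-! ### The filtration by the row of the last entry -/

variable (R q) in
/-- The span of the basis elements for the tableaux in which the row of the largest entry
belongs to `P`. -/
def rowSpan (lam : Shape (n + 1)) (P : UpperSet ℕ) : Submodule R (Cell R q lam) where
  carrier := {x | ∀ t : StdTableau lam, rowWord t.1 (Fin.last n) ∉ P → x t = 0}
  zero_mem' _ _ := rfl
  add_mem' {x y} hx hy t ht := by rw [CellModule.add_apply, hx t ht, hy t ht, add_zero]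
  smul_mem' r x hx t ht := by rw [CellModule.smul_apply, hx t ht, mul_zero]

theorem cellVec_mem_rowSpan {lam : Shape (n + 1)} {P : UpperSet ℕ} {t : StdTableau lam}
    (ht : rowWord t.1 (Fin.last n) ∈ P) : cellVec R q t ∈ rowSpan R q lam P := by
  intro v hv
  refine basis_apply_of_ne _ ?_
  rintro rfl
  exact hv ht

theorem rowSpan_le {lam : Shape (n + 1)} {P : UpperSet ℕ} {S : Submodule R (Cell R q lam)}
    (h : ∀ t : StdTableau lam, rowWord t.1 (Fin.last n) ∈ P → cellVec R q t ∈ S) :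
    rowSpan R q lam P ≤ S := by
  intro x hx
  rw [← sum_smul_basis _ _ x]
  refine Submodule.sum_mem _ fun t _ => ?_
  by_cases ht : rowWord t.1 (Fin.last n) ∈ P
  · exact Submodule.smul_mem _ _ (h t ht)
  · rw [hx t ht, zero_smul]
    exact Submodule.zero_mem _

/-- The dominating word has at least as many small letters among the first `n`. The total is the
same for both words, so its last letter cannot be smaller. -/
theorem Dominates.last_le {g f : Fin (n + 1) → ℕ} (h : Dominates g f)
    (hfg : IsRearrangement f g) : f (Fin.last n) ≤ g (Fin.last n) := by
  have h1 := h n (f (Fin.last n))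
  have h2 := countLt_succ f (Nat.lt_succ_self n) (f (Fin.last n))
  have h3 := countLt_succ g (Nat.lt_succ_self n) (f (Fin.last n))
  have h4 := hfg.countLt_eq (f (Fin.last n))
  change _ = _ + if f (Fin.last n) < f (Fin.last n) then 1 else 0 at h2
  change _ = _ + if g (Fin.last n) < f (Fin.last n) then 1 else 0 at h3
  rw [if_neg (lt_irrefl (f (Fin.last n)))] at h2
  by_contra hlt
  rw [if_pos (show g (Fin.last n) < _ from not_le.1 hlt)] at h3
  omega

theorem wordVec_mem_rowSpan {lam : Shape (n + 1)} {P : UpperSet ℕ} {f : Fin (n + 1) → ℕ}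
    (hf : f (Fin.last n) ∈ P) : wordVec R q lam f ∈ rowSpan R q lam P := by
  by_cases h : IsRearrangement lam.word f
  · refine SetLike.le_def.1 (Submodule.span_le.2 ?_) (wordVec_mem_span lam f)
    rintro _ ⟨t, ht, rfl⟩
    exact cellVec_mem_rowSpan
      (P.upper (Dominates.last_le ht (h.symm.trans (isRearrangement_rowWord t.1))) hf)
  · rw [wordVec_of_not_isRearrangement h]
    exact Submodule.zero_mem _

theorem op_gen_smul_wordVec_mem {lam : Shape n} {f : Fin n → ℕ} {i : Fin (n - 1)}
    {S : Submodule R (Cell R q lam)} (h1 : wordVec R q lam f ∈ S)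
    (h2 : wordVec R q lam (f ∘ simpleSwap i) ∈ S) :
    op (gen i : Hecke R q n) • wordVec R q lam f ∈ S := by
  rw [← wordVecLin_single, op_gen_smul_wordVecLin, wordOp_single]
  split_ifs
  · rw [map_smul, wordVecLin_single]
    exact Submodule.smul_mem _ _ h2
  · rw [map_smul, wordVecLin_single]
    exact Submodule.smul_mem _ _ h1
  · rw [map_add, map_smul, map_smul, wordVecLin_single, wordVecLin_single]
    exact Submodule.add_mem _ (Submodule.smul_mem _ _ h2) (Submodule.smul_mem _ _ h1)

variable (R q) in
/-- The action of an element of the Hecke algebra on the cell module, as a linear map. -/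
noncomputable def actLin (lam : Shape n) (a : Hecke R q n) : Cell R q lam →ₗ[R] Cell R q lam where
  toFun x := op a • x
  map_add' := smul_add _
  map_smul' r x := op_smul_smul _ _ a r x

/-- A basis vector is, up to a power of `q`, the image of its row word. A generator of the smaller
algebra leaves the last letter of that word alone, and straightening only increases it. -/
theorem op_incl_gen_smul_mem {lam : Shape (n + 1)} {P : UpperSet ℕ} {x : Cell R q lam}
    (hx : x ∈ rowSpan R q lam P) (i : Fin (n - 1)) :
    op (gen (castGen i) : Hecke R q (n + 1)) • x ∈ rowSpan R q lam P := by
  suffices h : rowSpan R q lam P ≤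
      (rowSpan R q lam P).comap (actLin R q lam (gen (castGen i))) from h hx
  refine rowSpan_le fun t ht => mem_of_unit_smul_mem (q ^ invCount t.1.perm) ?_
  rw [Units.val_pow_eq_pow_val, ← wordVec_rowWord]
  refine op_gen_smul_wordVec_mem (wordVec_mem_rowSpan ht) (wordVec_mem_rowSpan ?_)
  rw [Function.comp_apply, ← extendPerm_simpleSwap, extendPerm_last]
  exact ht

theorem op_incl_smul_mem {lam : Shape (n + 1)} {P : UpperSet ℕ} (a : Hecke R q n)
    {x : Cell R q lam} (hx : x ∈ rowSpan R q lam P) :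
    op (incl n a) • x ∈ rowSpan R q lam P := by
  let S : Submodule R (Hecke R q n) :=
    { carrier := {a | ∀ x ∈ rowSpan R q lam P, op (incl n a) • x ∈ rowSpan R q lam P}
      zero_mem' := fun x _ => by rw [map_zero, op_zero, zero_smul]; exact Submodule.zero_mem _
      add_mem' := fun {a b} ha hb x hx => by
        rw [map_add, op_add, add_smul]
        exact Submodule.add_mem _ (ha x hx) (hb x hx)
      smul_mem' := fun r a ha x hx => by
        rw [map_smul, smul_op_smul]
        exact Submodule.smul_mem _ _ (ha x hx) }
  refine induction_gen (P := S) ?_ ?_ a x hx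
  · intro x hx
    rw [map_one, op_one, one_smul]
    exact hx
  · intro a ha i x hx
    rw [map_mul, op_mul, mul_smul, incl_gen]
    exact op_incl_gen_smul_mem (ha x hx) i

variable (R q) in
/-- The span of the basis elements for the tableaux in which the row of the largest entry
belongs to `P`, as a submodule of the restriction. -/
def rowFiltration (lam : Shape (n + 1)) (P : UpperSet ℕ) :
    Submodule (Hecke R q n)ᵐᵒᵖ (ResModule (incl (R := R) (q := q) n) (Cell R q lam)) where
  carrier := (rowSpan R q lam P : Set (Cell R q lam))
  zero_mem' := (rowSpan R q lam P).zero_mem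
  add_mem' := (rowSpan R q lam P).add_mem
  smul_mem' a x hx := op_incl_smul_mem (R := R) (q := q) (lam := lam) (P := P) (unop a) (x := x) hx

end Hecke

namespace Hecke

open Tableau CellModule

variable {R : Type*} [CommRing R] {q : Rˣ} {n : ℕ}

/-! ## Inserting a letter -/

theorem isRearrangement_iff_countLt {f g : Fin n → ℕ} :
    IsRearrangement f g ↔ ∀ c, countLt g n c = countLt f n c := by
  refine ⟨fun h => h.countLt_eq, fun h => ?_⟩
  have hf := (IsRearrangement.refl f).comp (Tuple.sort f)
  have hg := (IsRearrangement.refl g).comp (Tuple.sort g)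
  have : g ∘ Tuple.sort g = f ∘ Tuple.sort f :=
    Monotone.eq_of_countLt_eq (Tuple.monotone_sort f) (Tuple.monotone_sort g) fun c => by
      rw [hf.countLt_eq, hg.countLt_eq, h]
  exact (this ▸ hf).trans hg.symm

/-- The word obtained by inserting the letter `r` at position `k`. -/
def insertLetter (k : Fin (n + 1)) (r : ℕ) (w : Fin n → ℕ) : Fin (n + 1) → ℕ :=
  Fin.insertNth (α := fun _ => ℕ) k r w

theorem insertLetter_self (k : Fin (n + 1)) (r : ℕ) (w : Fin n → ℕ) :
    insertLetter k r w k = r := Fin.insertNth_apply_same (α := fun _ => ℕ) k r w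

theorem insertLetter_succAbove (k : Fin (n + 1)) (r : ℕ) (w : Fin n → ℕ) (i : Fin n) :
    insertLetter k r w (k.succAbove i) = w i :=
  Fin.insertNth_apply_succAbove (α := fun _ => ℕ) k r w i

theorem insertLetter_injective (k : Fin (n + 1)) (r : ℕ) :
    Function.Injective (insertLetter k r) := fun w w' h => funext fun i => by
  rw [← insertLetter_succAbove k r w i, h, insertLetter_succAbove]

theorem eq_insertLetter {k : Fin (n + 1)} {r : ℕ} {u : Fin (n + 1) → ℕ} {w : Fin n → ℕ}
    (h1 : u k = r) (h2 : ∀ i, u (k.succAbove i) = w i) : u = insertLetter k r w := by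
  funext j
  rcases Fin.eq_self_or_eq_succAbove k j with rfl | ⟨a, rfl⟩
  · rw [h1, insertLetter_self]
  · rw [h2, insertLetter_succAbove]

theorem insertLetter_last_castSucc (r : ℕ) (w : Fin n → ℕ) (i : Fin n) :
    insertLetter (Fin.last n) r w i.castSucc = w i := by
  rw [← Fin.succAbove_last_apply i, insertLetter_succAbove]

theorem countLt_insertLetter (k : Fin (n + 1)) (r : ℕ) (w : Fin n → ℕ) (c : ℕ) :
    countLt (insertLetter k r w) (n + 1) c = countLt w n c + if r < c then 1 else 0 := by
  simp only [countLt, Fin.is_lt, true_and, Finset.card_filter]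
  rw [Fin.sum_univ_succAbove _ k, insertLetter_self, add_comm]
  simp only [insertLetter_succAbove]

theorem isRearrangement_insertLetter {c k : Fin (n + 1)} {r : ℕ} {f w : Fin n → ℕ} :
    IsRearrangement (insertLetter c r f) (insertLetter k r w) ↔ IsRearrangement f w := by
  rw [isRearrangement_iff_countLt, isRearrangement_iff_countLt]
  refine forall_congr' fun a => ?_
  rw [countLt_insertLetter, countLt_insertLetter, Nat.add_right_cancel_iff]

theorem val_succAbove (k : Fin (n + 1)) (i : Fin n) :
    (k.succAbove i).1 = if i.1 < k.1 then i.1 else i.1 + 1 := by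
  rw [Fin.succAbove]
  split_ifs with h1 h2 h2
  · rfl
  · exact absurd (Fin.lt_def.1 h1) h2
  · exact absurd (Fin.lt_def.2 h2) h1
  · rfl

/-- Three ways in which windows survive an insertion: the letter lies behind the window, which is
unchanged; before it, and the window is shifted; or it is placed right after the window, which grows
by one position to contain it. -/
theorem insertLetter_mem_windowWords {c k : Fin (n + 1)} {r x y x' y' : ℕ} {f w : Fin n → ℕ}
    (hxy : x ≤ y) (h : (k = c ∧ y ≤ c.1 ∧ x' = x ∧ y' = y) ∨
      (k = c ∧ c.1 ≤ x ∧ x' = x + 1 ∧ y' = y + 1) ∨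
      (k.1 = y ∧ x ≤ c.1 ∧ c.1 ≤ y ∧ x' = x ∧ y' = y + 1)) :
    insertLetter k r w ∈ windowWords (insertLetter c r f) x' y' ↔ w ∈ windowWords f x y := by
  rw [mem_windowWords, mem_windowWords, isRearrangement_insertLetter]
  refine and_congr_right fun _ => ?_
  have h1 : ∀ i : Fin n, (i.1 < x ∨ y ≤ i.1) ↔
      ((k.succAbove i).1 < x' ∨ y' ≤ (k.succAbove i).1) := by
    intro i
    rw [val_succAbove]
    rcases h with ⟨rfl, h⟩ | ⟨rfl, h⟩ | h <;> split_ifs <;> omega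
  have h2 : ∀ i : Fin n, (i.1 < x ∨ y ≤ i.1) → k.succAbove i = c.succAbove i := by
    intro i hi
    rw [Fin.ext_iff, val_succAbove, val_succAbove]
    rcases h with ⟨rfl, h⟩ | ⟨rfl, h⟩ | h <;> split_ifs <;> omega
  have h3 : (k.1 < x' ∨ y' ≤ k.1) → k = c := by
    rcases h with ⟨rfl, h⟩ | ⟨rfl, h⟩ | h
    · exact fun _ => rfl
    · exact fun _ => rfl
    · omega
  constructor
  · intro hw i hi
    have h4 := hw (k.succAbove i) ((h1 i).1 hi)
    rwa [insertLetter_succAbove, h2 i hi, insertLetter_succAbove] at h4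
  · intro hw j hj
    rcases Fin.eq_self_or_eq_succAbove k j with rfl | ⟨i, rfl⟩
    · rw [insertLetter_self, h3 hj, insertLetter_self]
    · have hi := (h1 i).2 hj
      rw [insertLetter_succAbove, hw i hi, h2 i hi, insertLetter_succAbove]

theorem insertLetter_comp_simpleSwap (k : Fin n) (r : ℕ) (w : Fin n → ℕ) :
    insertLetter k.castSucc r w ∘ simpleSwap (n := n + 1) k = insertLetter k.succ r w := by
  refine eq_insertLetter ?_ fun i => ?_
  · rw [Function.comp_apply]
    exact (congrArg _ (simpleSwap_hi (n := n + 1) k)).trans (insertLetter_self k.castSucc r w)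
  · rw [Function.comp_apply]
    by_cases hi : i = k
    · subst hi
      rw [Fin.succAbove_of_castSucc_lt _ _ Fin.castSucc_lt_succ]
      refine (congrArg _ (simpleSwap_lo (n := n + 1) i)).trans ?_
      have : hi (n := n + 1) i = i.castSucc.succAbove i :=
        (Fin.succAbove_of_le_castSucc _ _ le_rfl).symm
      rw [this, insertLetter_succAbove]
    · have hik : i.1 ≠ k.1 := fun h => hi (Fin.ext h)
      have h1 : k.succ.succAbove i = k.castSucc.succAbove i := by
        rw [Fin.ext_iff, val_succAbove, val_succAbove, Fin.val_succ, Fin.val_castSucc]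
        split_ifs <;> omega
      rw [h1, simpleSwap_of_ne (n := n + 1), insertLetter_succAbove]
      · exact Fin.succAbove_ne _ _
      · rw [← h1]
        exact Fin.succAbove_ne _ _

variable (R) in
/-- Appending the letter `r` to words. -/
noncomputable def appendLin (r : ℕ) : ((Fin n → ℕ) →₀ R) →ₗ[R] ((Fin (n + 1) → ℕ) →₀ R) :=
  Finsupp.lmapDomain R R (insertLetter (Fin.last n) r)

theorem appendLin_single (r : ℕ) (w : Fin n → ℕ) (a : R) : appendLin R r (Finsupp.single w a) =
    Finsupp.single (insertLetter (Fin.last n) r w) a := Finsupp.mapDomain_single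

theorem wordOp_appendLin (r : ℕ) (i : Fin (n - 1)) (c : (Fin n → ℕ) →₀ R) :
    wordOp q (castGen i) (appendLin R r c) = appendLin R r (wordOp q i c) := by
  suffices h : wordOp q (castGen i) ∘ₗ appendLin R r = appendLin R r ∘ₗ wordOp q i from
    LinearMap.congr_fun h c
  refine Finsupp.lhom_ext' fun w => LinearMap.ext_ring ?_
  have h1 : insertLetter (Fin.last n) r w ∘ simpleSwap (castGen i) =
      insertLetter (Fin.last n) r (w ∘ simpleSwap i) := by
    rw [← extendPerm_simpleSwap]
    refine eq_insertLetter ?_ fun j => ?_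
    · rw [Function.comp_apply, extendPerm_last, insertLetter_self]
    · rw [Fin.succAbove_last_apply, Function.comp_apply, extendPerm_castSucc,
        insertLetter_last_castSucc, Function.comp_apply]
  simp only [LinearMap.comp_apply, Finsupp.lsingle_apply, appendLin_single, wordOp_single,
    lo_castGen, hi_castGen, insertLetter_last_castSucc, h1]
  split_ifs <;> simp only [map_smul, map_add, appendLin_single]

/-! ## Words with large letters at the end -/

variable (R q) in
/-- The span of the words in which all letters behind position `k` are larger than `r`. -/
noncomputable def tailSpan (lam : Shape (n + 1)) (r k : ℕ) : Submodule R (Cell R q lam) :=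
  Submodule.span R (wordVec R q lam '' {u | ∀ j : Fin (n + 1), k ≤ j.1 → r < u j})

theorem tailSpan_le_rowSpan (lam : Shape (n + 1)) {r k : ℕ} (hk : k ≤ n) :
    tailSpan R q lam r k ≤ rowSpan R q lam (UpperSet.Ioi r) := by
  refine Submodule.span_le.2 ?_
  rintro _ ⟨u, hu, rfl⟩
  exact wordVec_mem_rowSpan (UpperSet.mem_Ioi_iff.2 (hu _ hk))

theorem op_gen_smul_mem_tailSpan {lam : Shape (n + 1)} {r k : ℕ} {i : Fin (n + 1 - 1)}
    (hki : k ≤ i.1) {x : Cell R q lam} (hx : x ∈ tailSpan R q lam r k) :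
    op (gen i : Hecke R q (n + 1)) • x ∈ tailSpan R q lam r k := by
  suffices h : tailSpan R q lam r k ≤ (tailSpan R q lam r k).comap (actLin R q lam (gen i)) from
    h hx
  refine Submodule.span_le.2 ?_
  rintro _ ⟨u, hu, rfl⟩
  refine op_gen_smul_wordVec_mem (Submodule.subset_span (Set.mem_image_of_mem _ hu))
    (Submodule.subset_span (Set.mem_image_of_mem _ fun j hj => ?_))
  rw [Function.comp_apply]
  by_cases h1 : j = lo i
  · rw [h1, simpleSwap_lo]
    exact hu _ (hki.trans (Nat.le_succ i.1))
  by_cases h2 : j = hi i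
  · rw [h2, simpleSwap_hi]
    exact hu _ hki
  rw [simpleSwap_of_ne h1 h2]
  exact hu j hj

theorem wordVec_insertLetter_succ (lam : Shape (n + 1)) {r : ℕ} {k : Fin n} {w : Fin n → ℕ}
    (h : r < w k) : wordVec R q lam (insertLetter k.succ r w) =
      (q : R) • op (gen (n := n + 1) k : Hecke R q (n + 1)) •
        wordVec R q lam (insertLetter k.castSucc r w) := by
  have h1 : insertLetter k.castSucc r w (lo (n := n + 1) k) <
      insertLetter k.castSucc r w (hi (n := n + 1) k) := by
    have h2 : lo (n := n + 1) k = k.castSucc := rfl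
    have h3 : hi (n := n + 1) k = k.castSucc.succAbove k :=
      (Fin.succAbove_of_le_castSucc _ _ le_rfl).symm
    rw [h2, h3, insertLetter_self, insertLetter_succAbove]
    exact h
  rw [← wordVecLin_single lam (insertLetter k.castSucc r w), op_gen_smul_wordVecLin,
    wordOp_single, if_pos h1, map_smul, wordVecLin_single, smul_smul, Units.mul_inv, one_smul,
    insertLetter_comp_simpleSwap]

/-- Behind position `k` the inserted `r` meets only larger letters, so moving it one place to the
right is `q` times one generator, the same for all words of the sum. These generators preserve
`tailSpan`. -/
theorem sum_wordVec_append_mem {lam : Shape (n + 1)} {r : ℕ} {k : Fin (n + 1)}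
    {E : Finset (Fin n → ℕ)} (hE : ∀ w ∈ E, ∀ i : Fin n, k.1 ≤ i.1 → r < w i)
    (h : ∑ w ∈ E, wordVec R q lam (insertLetter k r w) ∈ tailSpan R q lam r k.1) :
    ∑ w ∈ E, wordVec R q lam (insertLetter (Fin.last n) r w) ∈ tailSpan R q lam r k.1 := by
  suffices H : ∀ j, k.1 ≤ j → ∀ hj : j < n + 1,
      ∑ w ∈ E, wordVec R q lam (insertLetter ⟨j, hj⟩ r w) ∈ tailSpan R q lam r k.1 from
    H n (Nat.lt_succ_iff.1 k.2) (Nat.lt_succ_self n)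
  intro j hkj
  induction j, hkj using Nat.le_induction with
  | base => exact fun _ => h
  | succ j hkj ih =>
    intro hj
    have h1 : ∀ w ∈ E, wordVec R q lam (insertLetter ⟨j + 1, hj⟩ r w) =
        (q : R) • op (gen (n := n + 1) ⟨j, Nat.lt_of_succ_lt_succ hj⟩ : Hecke R q (n + 1)) •
          wordVec R q lam (insertLetter ⟨j, (Nat.lt_succ_self j).trans hj⟩ r w) := fun w hw =>
      wordVec_insertLetter_succ lam (k := ⟨j, Nat.lt_of_succ_lt_succ hj⟩) (hE w hw _ hkj)
    rw [Finset.sum_congr rfl h1, ← Finset.smul_sum, ← Finset.smul_sum]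
    exact Submodule.smul_mem _ _ (op_gen_smul_mem_tailSpan hkj (ih _))

theorem sum_windowWords_wordVec {lam : Shape n} {ρ x y : ℕ} (h1 : lam.rowStart ρ ≤ x)
    (h2 : x ≤ lam.rowStart (ρ + 1)) (h3 : lam.rowStart (ρ + 1) ≤ y)
    (h4 : y ≤ lam.rowStart (ρ + 2)) (h5 : x + lam.rowStart (ρ + 1) < y + lam.rowStart ρ) :
    ∑ w ∈ windowWords lam.word x y, wordVec R q lam w = 0 := by
  simp only [← countLt_rowWord (initial lam)] at h1 h2 h3 h4 h5
  have h := containsGarnir_comap (R := R) (q := q) (monotone_rowWord_initial lam) ρ x y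
    h1 h2 h3 h4 h5
  have h6 := coord_of_mem_idealAbove (Submodule.mem_comap.1 h)
  rwa [wordLin_garnirSum, map_sum] at h6

theorem exists_word_eq_insertLetter {μ : Shape n} {lam : Shape (n + 1)} {r : ℕ}
    (hr : μ.EdgeAt lam r) : ∃ c : Fin (n + 1), c.1 = μ.rowStart (r + 1) ∧
      lam.word = insertLetter c r μ.word := by
  have hα : (r, μ.diagram.rowLen r) ∉ μ.diagram.cells := Shape.EdgeAt.notMem r
  let α : lam.Node := ⟨(r, μ.diagram.rowLen r), hr.cells.symm.subset (Finset.mem_insert_self _ _)⟩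
  have hw : ∀ p : lam.Node, lam.word (initial lam p) = p.1.1 := fun p => by
    rw [Shape.word, rowWord, Equiv.symm_apply_apply]
  refine ⟨initial lam α, ?_, eq_insertLetter (hw α) fun i => ?_⟩
  · rw [initial_val, hr.rowStart, if_neg (lt_irrefl _), Shape.rowStart_succ, add_zero]
  · have hp := ((initial μ).symm i).2
    have h1 := initial_of_mem hr (α := α) hα (p := ⟨((initial μ).symm i).1, hr.edge.subset hp⟩) hp
    simp only [Subtype.coe_eta, Equiv.apply_symm_apply] at h1
    rw [← h1, hw]
    rfl

/-- Split a vanishing window sum of `lam` according to the letter at position `k`. The words with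
`r` there are the window words of `μ` with `r` inserted; all others have only letters larger than
`r` from `k` on. Moving the inserted letter to the end gives the claim. -/
theorem sum_append_mem_of_window {μ : Shape n} {lam : Shape (n + 1)} {r x y x' y' : ℕ}
    {k : Fin (n + 1)}
    (hiff : ∀ w, insertLetter k r w ∈ windowWords lam.word x' y' ↔ w ∈ windowWords μ.word x y)
    (hE : ∀ w ∈ windowWords μ.word x y, ∀ i : Fin n, k.1 ≤ i.1 → r < w i)
    (hE' : ∀ u ∈ windowWords lam.word x' y', u k ≠ r → ∀ j : Fin (n + 1), k.1 ≤ j.1 → r < u j)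
    (hsum : ∑ u ∈ windowWords lam.word x' y', wordVec R q lam u = 0) :
    wordVecLin R q lam (appendLin R r (garnirSum R μ.word x y)) ∈
      rowSpan R q lam (UpperSet.Ioi r) := by
  classical
  rw [garnirSum, map_sum, map_sum]
  simp only [appendLin_single, wordVecLin_single]
  refine tailSpan_le_rowSpan lam (Nat.lt_succ_iff.1 k.2) (sum_wordVec_append_mem hE ?_)
  have h1 : ∑ w ∈ windowWords μ.word x y, wordVec R q lam (insertLetter k r w) =
      ∑ u ∈ windowWords lam.word x' y' with u k = r, wordVec R q lam u := by
    refine Finset.sum_nbij (insertLetter k r) ?_ (insertLetter_injective k r).injOn ?_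
      fun _ _ => rfl
    · intro w hw
      exact Finset.mem_filter.2 ⟨(hiff w).2 hw, insertLetter_self k r w⟩
    · intro u hu
      obtain ⟨hu, huk⟩ := Finset.mem_filter.1 (Finset.mem_coe.1 hu)
      have h2 : u = insertLetter k r (fun i => u (k.succAbove i)) :=
        eq_insertLetter huk fun _ => rfl
      exact ⟨_, (hiff _).1 (h2 ▸ hu), h2.symm⟩
  have h2 := Finset.sum_filter_add_sum_filter_not (windowWords lam.word x' y') (fun u => u k = r)
    (wordVec R q lam)
  rw [hsum] at h2
  rw [h1, eq_neg_of_add_eq_zero_left h2]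
  refine Submodule.neg_mem _ (Submodule.sum_mem _ fun u hu => Submodule.subset_span ?_)
  obtain ⟨hu, huk⟩ := Finset.mem_filter.1 hu
  exact ⟨u, hE' u hu huk, rfl⟩

theorem lt_word_iff (lam : Shape n) (i : Fin n) (r : ℕ) :
    r < lam.word i ↔ lam.rowStart (r + 1) ≤ i.1 := by
  rw [← countLt_rowWord (initial lam), ← not_lt (a := i.1),
    ← Monotone.lt_iff_countLt (monotone_rowWord_initial lam), Nat.lt_succ_iff, not_le]

theorem windowWords_word_letter {lam : Shape n} {ρ x y : ℕ} (h1 : lam.rowStart ρ ≤ x)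
    (h4 : y ≤ lam.rowStart (ρ + 2)) {w : Fin n → ℕ} (hw : w ∈ windowWords lam.word x y) {i : Fin n}
    (hx : x ≤ i.1) (hy : i.1 < y) : w i = ρ ∨ w i = ρ + 1 := by
  rw [← countLt_rowWord (initial lam)] at h1 h4
  exact windowWords_letter (Monotone.isBlock (monotone_rowWord_initial lam) ρ) h1 h4 hw hx hy

/-- Appending the letter of the added node to a Garnir sum gives an element of the next step of
the filtration. -/
theorem containsGarnir_append {μ : Shape n} {lam : Shape (n + 1)} {r : ℕ}
    (hr : μ.EdgeAt lam r) : ContainsGarnir μ.word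
      ((rowSpan R q lam (UpperSet.Ioi r)).comap (wordVecLin R q lam ∘ₗ appendLin R r)) := by
  intro ρ x y h1 h2 h3 h4 h5
  simp only [countLt_rowWord (initial μ)] at h1 h2 h3 h4 h5
  rw [Submodule.mem_comap, LinearMap.comp_apply]
  obtain ⟨c, hc, hword⟩ := exists_word_eq_insertLetter hr
  have hxy : x ≤ y := h2.trans h3
  have l0 := hr.rowStart ρ
  have l1 := hr.rowStart (ρ + 1)
  have l2 := hr.rowStart (ρ + 2)
  -- If `ρ < r` the added node lies behind the window, and if `ρ > r` before it; then the inserted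
  -- letter keeps its own position `c` and the extra words do not occur. If `ρ = r`, row `r` of
  -- `lam` is one longer than that of `μ`, so a Garnir window of `lam` must be one longer as well,
  -- and the letter is inserted at its last position `y`.
  rcases lt_trichotomy ρ r with hρ | rfl | hρ
  · have hyc : y ≤ c.1 := by
      rw [hc]
      exact h4.trans (μ.rowStart_mono (by omega))
    rw [if_neg (by omega), add_zero] at l0 l1
    have hck : ∀ u ∈ windowWords lam.word x y, u c = r := fun u hu => by
      rw [(mem_windowWords.1 hu).2 c (Or.inr hyc), hword, insertLetter_self]
    refine sum_append_mem_of_window (k := c) (x' := x) (y' := y) (fun w => ?_) (fun w hw i hi => ?_)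
      (fun u hu huc => absurd (hck u hu) huc) ?_
    · rw [hword]
      exact insertLetter_mem_windowWords hxy (Or.inl ⟨rfl, hyc, rfl, rfl⟩)
    · rw [(mem_windowWords.1 hw).2 i (Or.inr (hyc.trans hi)), lt_word_iff, ← hc]
      exact hi
    · exact sum_windowWords_wordVec (ρ := ρ) (by omega) (by omega) (by omega) (by omega) (by omega)
  · have hyn : y < n + 1 := by
      have := μ.rowStart_le (ρ + 2)
      omega
    rw [if_neg (by omega), add_zero] at l0
    rw [if_pos (by omega)] at l1 l2
    refine sum_append_mem_of_window (k := ⟨y, hyn⟩) (x' := x) (y' := y + 1) (fun w => ?_)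
      (fun w hw i hi => ?_) (fun u hu huk j hj => ?_) ?_
    · rw [hword]
      exact insertLetter_mem_windowWords hxy
        (Or.inr (Or.inr ⟨rfl, by omega, by omega, rfl, rfl⟩))
    · rw [(mem_windowWords.1 hw).2 i (Or.inr hi), lt_word_iff]
      exact h3.trans hi
    · simp only at hj
      rcases hj.eq_or_lt with hj | hj
      · have hj' : (⟨y, hyn⟩ : Fin (n + 1)) = j := Fin.ext hj
        rw [hj'] at huk
        have := windowWords_word_letter (lam := lam) (ρ := ρ) (by omega) (by omega) hu (i := j)
          (by omega) (by omega)
        omega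
      · rw [(mem_windowWords.1 hu).2 j (Or.inr hj), lt_word_iff, l1]
        omega
    · exact sum_windowWords_wordVec (ρ := ρ) (by omega) (by omega) (by omega) (by omega) (by omega)
  · have hcx : c.1 ≤ x := by
      rw [hc]
      exact (μ.rowStart_mono (by omega)).trans h1
    rw [if_pos (by omega)] at l0 l1 l2
    have hck : ∀ u ∈ windowWords lam.word (x + 1) (y + 1), u c = r := fun u hu => by
      rw [(mem_windowWords.1 hu).2 c (Or.inl (by omega)), hword, insertLetter_self]
    refine sum_append_mem_of_window (k := c) (x' := x + 1) (y' := y + 1) (fun w => ?_)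
      (fun w hw i hi => ?_) (fun u hu huc => absurd (hck u hu) huc) ?_
    · rw [hword]
      exact insertLetter_mem_windowWords hxy (Or.inr (Or.inl ⟨rfl, hcx, rfl, rfl⟩))
    · by_cases hiw : i.1 < x ∨ y ≤ i.1
      · rw [(mem_windowWords.1 hw).2 i hiw, lt_word_iff, ← hc]
        exact hi
      · have := windowWords_word_letter h1 h4 hw (i := i) (by omega) (by omega)
        omega
    · exact sum_windowWords_wordVec (ρ := ρ) (by omega) (by omega) (by omega) (by omega) (by omega)

end Hecke

namespace Hecke

open Tableau CellModule

variable {R : Type*} [CommRing R] {q : Rˣ} {n : ℕ} {μ : Shape n} {lam : Shape (n + 1)}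

/-! ## Subquotients of restricted cell modules -/

theorem prevShape_edgeAt (t : StdTableau lam) :
    t.prevShape.EdgeAt lam (rowWord t.1 (Fin.last n)) := by
  obtain ⟨r, hr⟩ := t.prevShape_edge.exists_edgeAt
  have h := rowWord_adjoin_last t.prev.1 t.prevShape_edge hr
  have h1 : t.prev.1.adjoin t.prevShape_edge = t.1 := congrArg Subtype.val t.adjoin_prev
  rw [h1] at h
  rwa [h]

theorem exists_adjoin_eq {r : ℕ} (hr : μ.EdgeAt lam r) {t : StdTableau lam}
    (ht : rowWord t.1 (Fin.last n) = r) : ∃ s : StdTableau μ, s.adjoin hr.edge = t :=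
  StdTableau.exists_adjoin_of_prevShape_eq ((ht ▸ prevShape_edgeAt t).eq_left hr) hr.edge

theorem rowWord_adjoin_eq_insertLetter {r : ℕ} (hr : μ.EdgeAt lam r) (s : StdTableau μ) :
    rowWord (s.adjoin hr.edge).1 = insertLetter (Fin.last n) r (rowWord s.1) := by
  refine eq_insertLetter (rowWord_adjoin_last s.1 hr.edge hr) fun i => ?_
  rw [Fin.succAbove_last_apply]
  exact rowWord_adjoin_castSucc s.1 hr.edge i

variable (R q) in
/-- The linear map that keeps the coefficients of the tableaux `s ∪ α`. -/
noncomputable def restrictLin (h : μ.Edge lam) : Cell R q lam →ₗ[R] Cell R q μ where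
  toFun x := fun s => x (s.adjoin h)
  map_add' _ _ := rfl
  map_smul' _ _ := rfl

theorem restrictLin_cellVec_adjoin (h : μ.Edge lam) (s : StdTableau μ) :
    restrictLin R q h (cellVec R q (s.adjoin h)) = cellVec R q s := by
  funext v
  by_cases hv : v = s
  · rw [hv]
    exact (basis_apply_self _ (s.adjoin h)).trans (basis_apply_self _ s).symm
  · exact (basis_apply_of_ne _ fun he => hv (StdTableau.adjoin_injective h he)).trans
      (basis_apply_of_ne _ hv).symm

theorem restrictLin_of_mem {r : ℕ} (hr : μ.EdgeAt lam r) {x : Cell R q lam}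
    (hx : x ∈ rowSpan R q lam (UpperSet.Ioi r)) : restrictLin R q hr.edge x = 0 := by
  funext s
  refine hx _ ?_
  rw [UpperSet.mem_Ioi_iff]
  exact (rowWord_adjoin_last s.1 hr.edge hr).le.not_gt

/-- Appending the row of the added node to words corresponds to adjoining this node to
tableaux, up to a power of `q`. -/
theorem restrictLin_wordVecLin_appendLin {r : ℕ} (hr : μ.EdgeAt lam r) (c : (Fin n → ℕ) →₀ R) :
    restrictLin R q hr.edge (wordVecLin R q lam (appendLin R r c)) =
      (q : R) ^ invCount ((initial μ).adjoin hr.edge).perm • wordVecLin R q μ c := by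
  suffices h : restrictLin R q hr.edge ∘ₗ wordVecLin R q lam ∘ₗ appendLin R r =
      (q : R) ^ invCount ((initial μ).adjoin hr.edge).perm • wordVecLin R q μ from
    LinearMap.congr_fun h c
  refine Finsupp.lhom_ext' fun f => LinearMap.ext_ring ?_
  change (restrictLin R q hr.edge ∘ₗ wordVecLin R q lam ∘ₗ appendLin R r) (Finsupp.single f 1) =
    ((q : R) ^ invCount ((initial μ).adjoin hr.edge).perm • wordVecLin R q μ) (Finsupp.single f 1)
  by_cases hf : IsRearrangement μ.word f
  · have hmono := monotone_rowWord_initial μ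
    -- `Q` consists of relations on which both sides vanish. It is stable under generators and
    -- contains all Garnir sums of `μ`, so straightening reduces the identity to row words of
    -- standard tableaux.
    let Q : Submodule R ((Fin n → ℕ) →₀ R) :=
      (rowSpan R q lam (UpperSet.Ioi r)).comap (wordVecLin R q lam ∘ₗ appendLin R r) ⊓
        LinearMap.ker (wordVecLin R q μ)
    have hQ : ∀ i, ∀ c ∈ Q, wordOp q i c ∈ Q := by
      rintro i c ⟨h1, h2⟩
      refine ⟨?_, ?_⟩
      · change wordVecLin R q lam (appendLin R r (wordOp q i c)) ∈
          rowSpan R q lam (UpperSet.Ioi r)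
        rw [← wordOp_appendLin, ← op_gen_smul_wordVecLin]
        exact op_incl_gen_smul_mem h1 i
      · rw [SetLike.mem_coe, LinearMap.mem_ker] at h2 ⊢
        rw [← op_gen_smul_wordVecLin, h2, smul_zero]
    have hG : ContainsGarnir μ.word Q := fun ρ x y h1 h2 h3 h4 h5 =>
      ⟨containsGarnir_append hr ρ x y h1 h2 h3 h4 h5, LinearMap.mem_ker.2
        (coord_of_mem_idealAbove (containsGarnir_comap hmono ρ x y h1 h2 h3 h4 h5))⟩
    suffices h : Submodule.span R ((fun g => Finsupp.single g (1 : R)) ''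
        {g | IsRearrangement μ.word g ∧ IsLattice g ∧ Dominates g f}) ⊔ Q ≤
        LinearMap.eqLocus (restrictLin R q hr.edge ∘ₗ wordVecLin R q lam ∘ₗ appendLin R r)
          ((q : R) ^ invCount ((initial μ).adjoin hr.edge).perm • wordVecLin R q μ) from
      h (single_mem_span_lattice hmono hQ hG hf)
    refine sup_le (Submodule.span_le.2 ?_) ?_
    · rintro _ ⟨g, ⟨hg, hl, _⟩, rfl⟩
      obtain ⟨s, rfl⟩ := hl.exists_of_isRearrangement hg
      change restrictLin R q hr.edge (wordVecLin R q lam (appendLin R r (Finsupp.single _ 1))) =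
        (q : R) ^ invCount ((initial μ).adjoin hr.edge).perm •
          wordVecLin R q μ (Finsupp.single _ 1)
      rw [appendLin_single, ← rowWord_adjoin_eq_insertLetter hr, wordVecLin_single,
        wordVecLin_single, wordVec_rowWord, wordVec_rowWord, map_smul,
        restrictLin_cellVec_adjoin, smul_smul, ← pow_add]
      have h := invCount_perm_adjoin s.1 hr.edge
      change invCount (s.adjoin hr.edge).1.perm = _ at h
      rw [h, add_comm]
    · rintro c ⟨h1, h2⟩
      change restrictLin R q hr.edge (wordVecLin R q lam (appendLin R r c)) =
        (q : R) ^ invCount ((initial μ).adjoin hr.edge).perm • wordVecLin R q μ c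
      have h3 : wordVecLin R q lam (appendLin R r c) ∈ rowSpan R q lam (UpperSet.Ioi r) := h1
      rw [restrictLin_of_mem hr h3, LinearMap.mem_ker.1 h2, smul_zero]
  · rw [LinearMap.comp_apply, LinearMap.comp_apply, appendLin_single, LinearMap.smul_apply,
      wordVecLin_single, wordVecLin_single, wordVec_of_not_isRearrangement hf,
      wordVec_of_not_isRearrangement, map_zero, smul_zero]
    intro h
    obtain ⟨k, _, hk⟩ := exists_word_eq_insertLetter hr
    rw [hk, isRearrangement_insertLetter] at h
    exact hf h

/-- On tableaux with the largest entry below row `r` both sides vanish. On `s ∪ α` the vector is a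
word with appended letter `r`, up to a unit, and `restrictLin_wordVecLin_appendLin` turns the formal
action on the longer word into that on the shorter one. -/
theorem restrictLin_op_gen_smul {r : ℕ} (hr : μ.EdgeAt lam r) {x : Cell R q lam}
    (hx : x ∈ rowSpan R q lam (UpperSet.Ici r)) (i : Fin (n - 1)) :
    restrictLin R q hr.edge (op (gen (castGen i) : Hecke R q (n + 1)) • x) =
      op (gen i : Hecke R q n) • restrictLin R q hr.edge x := by
  suffices h : rowSpan R q lam (UpperSet.Ici r) ≤
      LinearMap.eqLocus (restrictLin R q hr.edge ∘ₗ actLin R q lam (gen (castGen i)))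
        (actLin R q μ (gen i) ∘ₗ restrictLin R q hr.edge) from h hx
  refine rowSpan_le fun t ht => ?_
  rcases (UpperSet.mem_Ici_iff.1 ht).eq_or_lt with h | h
  · obtain ⟨s, rfl⟩ := exists_adjoin_eq hr h.symm
    refine mem_of_unit_smul_mem (q ^ invCount (s.adjoin hr.edge).1.perm) ?_
    rw [Units.val_pow_eq_pow_val, ← wordVec_rowWord, rowWord_adjoin_eq_insertLetter hr,
      ← wordVecLin_single, ← appendLin_single]
    change restrictLin R q hr.edge (op (gen (castGen i) : Hecke R q (n + 1)) •
        wordVecLin R q lam (appendLin R r _)) =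
      op (gen i : Hecke R q n) • restrictLin R q hr.edge (wordVecLin R q lam (appendLin R r _))
    rw [op_gen_smul_wordVecLin, wordOp_appendLin, restrictLin_wordVecLin_appendLin hr,
      restrictLin_wordVecLin_appendLin hr, op_smul_smul, op_gen_smul_wordVecLin]
  · have h1 : cellVec R q t ∈ rowSpan R q lam (UpperSet.Ioi r) :=
      cellVec_mem_rowSpan (UpperSet.mem_Ioi_iff.2 h)
    change restrictLin R q hr.edge (op (gen (castGen i) : Hecke R q (n + 1)) • cellVec R q t) =
      op (gen i : Hecke R q n) • restrictLin R q hr.edge (cellVec R q t)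
    rw [restrictLin_of_mem hr h1, restrictLin_of_mem hr (op_incl_gen_smul_mem h1 i), smul_zero]

theorem restrictLin_op_incl_smul {r : ℕ} (hr : μ.EdgeAt lam r) (a : Hecke R q n)
    {x : Cell R q lam} (hx : x ∈ rowSpan R q lam (UpperSet.Ici r)) :
    restrictLin R q hr.edge (op (incl n a) • x) = op a • restrictLin R q hr.edge x := by
  let S : Submodule R (Hecke R q n) :=
    { carrier := {a | ∀ x ∈ rowSpan R q lam (UpperSet.Ici r),
        restrictLin R q hr.edge (op (incl n a) • x) = op a • restrictLin R q hr.edge x}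
      zero_mem' := fun x _ => by rw [map_zero, op_zero, zero_smul, op_zero, zero_smul, map_zero]
      add_mem' := fun {a b} ha hb x hx => by
        rw [map_add, op_add, add_smul, map_add, ha x hx, hb x hx, op_add, add_smul]
      smul_mem' := fun r a ha x hx => by
        rw [map_smul (incl n), smul_op_smul, LinearMap.map_smul, ha x hx, smul_op_smul] }
  refine induction_gen (P := S) ?_ ?_ a x hx
  · intro x hx
    rw [map_one, op_one, one_smul, op_one, one_smul]
  · intro a ha i x hx
    rw [map_mul, op_mul, mul_smul, incl_gen, restrictLin_op_gen_smul hr (op_incl_smul_mem a hx),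
      ha x hx, op_mul, mul_smul]

/-- The map to the cell module of `μ` from a step of the filtration of the restriction. -/
noncomputable def restrictHom {r : ℕ} (hr : μ.EdgeAt lam r) {P : UpperSet ℕ}
    (hP : ∀ t : StdTableau lam, rowWord t.1 (Fin.last n) ∈ P → r ≤ rowWord t.1 (Fin.last n)) :
    rowFiltration R q lam P →ₗ[(Hecke R q n)ᵐᵒᵖ] Cell R q μ where
  toFun x := restrictLin R q hr.edge x.1
  map_add' _ _ := map_add (restrictLin R q hr.edge) _ _
  map_smul' a x := restrictLin_op_incl_smul hr (unop a) fun t ht => x.2 t fun h =>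
    ht (UpperSet.mem_Ici_iff.2 (hP t h))

/-- The subquotients of the filtration are cell modules. -/
noncomputable def quotEquiv {r : ℕ} (hr : μ.EdgeAt lam r) {P P' : UpperSet ℕ}
    (hP : ∀ t : StdTableau lam, rowWord t.1 (Fin.last n) ∈ P ↔ r ≤ rowWord t.1 (Fin.last n))
    (hP' : ∀ t : StdTableau lam, rowWord t.1 (Fin.last n) ∈ P' ↔ r < rowWord t.1 (Fin.last n)) :
    (rowFiltration R q lam P ⧸ (rowFiltration R q lam P').submoduleOf (rowFiltration R q lam P))
      ≃ₗ[(Hecke R q n)ᵐᵒᵖ] Cell R q μ :=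
  (Submodule.quotEquivOfEq _ (LinearMap.ker (restrictHom (R := R) (q := q) hr fun t => (hP t).1))
    (by
      ext ⟨x, hx⟩
      rw [LinearMap.mem_ker, Submodule.submoduleOf, Submodule.mem_comap]
      constructor
      · intro h
        refine restrictLin_of_mem hr fun t ht => ?_
        exact h t fun h' => ht (UpperSet.mem_Ioi_iff.2 ((hP' t).1 h'))
      -- A tableau outside `P'` either has its largest entry in row `r`, so it is `s ∪ α` and its
      -- coefficient is seen by the restriction, or it lies outside `P`.
      · intro h t ht
        by_cases h1 : rowWord t.1 (Fin.last n) ∈ P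
        · obtain ⟨s, rfl⟩ := exists_adjoin_eq hr
            (le_antisymm (not_lt.1 fun h' => ht ((hP' t).2 h')) ((hP t).1 h1))
          exact congrFun h s
        · exact hx t h1)).trans
  (LinearMap.quotKerEquivOfSurjective _ (by
      intro y
      refine ⟨⟨(∑ s, y s • cellVec R q (s.adjoin hr.edge) : Cell R q lam),
        (rowSpan R q lam P).sum_mem fun s _ => (rowSpan R q lam P).smul_mem _
          (cellVec_mem_rowSpan ?_)⟩, ?_⟩
      · exact (hP _).2 (rowWord_adjoin_last s.1 hr.edge hr).ge
      · change restrictLin R q hr.edge (∑ s, y s • cellVec R q (s.adjoin hr.edge)) = y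
        rw [map_sum]
        simp only [map_smul, restrictLin_cellVec_adjoin]
        exact sum_smul_basis _ _ y))

theorem quotEquiv_mk {r : ℕ} (hr : μ.EdgeAt lam r) {P P' : UpperSet ℕ}
    (hP : ∀ t : StdTableau lam, rowWord t.1 (Fin.last n) ∈ P ↔ r ≤ rowWord t.1 (Fin.last n))
    (hP' : ∀ t : StdTableau lam, rowWord t.1 (Fin.last n) ∈ P' ↔ r < rowWord t.1 (Fin.last n))
    (x : rowFiltration R q lam P) :
    quotEquiv hr hP hP' (Submodule.Quotient.mk x) = restrictLin R q hr.edge x.1 := rfl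

/-- The restriction of a cell module has an order preserving cell filtration, for which the
elements `dCoeff` are branching coefficients. -/
theorem exists_cellFiltration (lam : Shape (n + 1)) :
    ∃ F : CellFiltration (isCellDatum_murphy (R := R) (q := q))
        (ResModule (incl (R := R) (q := q) n) (Cell R q lam)),
      F.OrderPreserving ∧ (∀ μ : Shape n, μ.Edge lam ↔ ∃ j, F.label j = μ) ∧
      (∀ (j : Fin F.len) (h : (F.label j).Edge lam),
        F.IsBranchingCoeff j (cellVec R q (StdTableau.initial lam))
          (cellVec R q (StdTableau.initial (F.label j))) (dCoeff n (F.label j) lam h)) := by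
  classical
  let rows : Finset ℕ := Finset.univ.image fun t : StdTableau lam => rowWord t.1 (Fin.last n)
  -- The rows are listed from bottom to top: the lowest row spans the smallest submodule, and
  -- removing its node leaves the most dominant shape.
  let e : Fin rows.card → ℕ := fun j => rows.orderEmbOfFin rfl j.rev
  have he : StrictAnti e := fun i j hij =>
    (rows.orderEmbOfFin rfl).strictMono (Fin.rev_lt_rev.2 hij)
  have hmem : ∀ r, r ∈ rows ↔ ∃ j, e j = r := by
    intro r
    constructor
    · intro hr
      have h1 : r ∈ Set.range (rows.orderEmbOfFin rfl) := by
        rw [Finset.range_orderEmbOfFin]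
        exact hr
      obtain ⟨j, hj⟩ := h1
      exact ⟨j.rev, by simpa only [e, Fin.rev_rev] using hj⟩
    · rintro ⟨j, rfl⟩
      exact Finset.orderEmbOfFin_mem _ _ _
  have hrow : ∀ t : StdTableau lam, ∃ j, e j = rowWord t.1 (Fin.last n) := fun t =>
    (hmem _).1 (Finset.mem_image_of_mem _ (Finset.mem_univ t))
  have hlabel : ∀ j, ∃ μ : Shape n, μ.EdgeAt lam (e j) := by
    intro j
    obtain ⟨t, _, ht⟩ := Finset.mem_image.1 ((hmem _).2 ⟨j, rfl⟩)
    exact ⟨t.prevShape, ht ▸ prevShape_edgeAt t⟩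
  choose label hlabel using hlabel
  -- On rows that occur, `P j` selects `e 0, …, e (j - 1)`. Phrasing it by excluding the later rows
  -- also covers the ends: no row occurs in `P 0`, and the last set contains every natural number.
  let P : Fin (rows.card + 1) → UpperSet ℕ := fun j =>
    ⟨{a | ∀ i : Fin rows.card, j.1 ≤ i.1 → e i < a}, fun a b hab ha i hi => (ha i hi).trans_le hab⟩
  have hP : ∀ j a, a ∈ P j ↔ ∀ i : Fin rows.card, j.1 ≤ i.1 → e i < a := fun j a => Iff.rfl
  have hP1 : ∀ (j : Fin rows.card) (t : StdTableau lam),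
      rowWord t.1 (Fin.last n) ∈ P j.succ ↔ e j ≤ rowWord t.1 (Fin.last n) := by
    intro j t
    obtain ⟨i, hi⟩ := hrow t
    rw [hP, ← hi, he.le_iff_ge]
    constructor
    · intro h
      by_contra hij
      exact lt_irrefl _ (h i (not_le.1 hij))
    · intro h i' hi'
      exact he (h.trans_lt hi')
  have hP2 : ∀ (j : Fin rows.card) (t : StdTableau lam),
      rowWord t.1 (Fin.last n) ∈ P j.castSucc ↔ e j < rowWord t.1 (Fin.last n) := by
    intro j t
    obtain ⟨i, hi⟩ := hrow t
    rw [hP, ← hi, he.lt_iff_gt]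
    constructor
    · intro h
      by_contra hij
      exact lt_irrefl _ (h i (not_lt.1 hij))
    · intro h i' hi'
      exact he (h.trans_le hi')
  let F : CellFiltration (isCellDatum_murphy (R := R) (q := q))
      (ResModule (incl (R := R) (q := q) n) (Cell R q lam)) :=
    { len := rows.card
      label := label
      N := fun j => rowFiltration R q lam (P j)
      N_zero := by
        rw [eq_bot_iff]
        intro x hx
        rw [Submodule.mem_bot]
        funext t
        refine hx t fun h => ?_
        obtain ⟨i, hi⟩ := hrow t
        exact (h i (Nat.zero_le _)).ne hi
      N_last := by
        rw [eq_top_iff]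
        intro x _ t ht
        exact absurd (fun i hi => absurd i.2 (not_lt.2 hi)) ht
      N_le := fun j x hx t ht => hx t fun h => ht ((hP1 j t).2 ((hP2 j t).1 h).le)
      iso := fun j => quotEquiv (hlabel j) (hP1 j) (hP2 j) }
  refine ⟨F, fun i j hij => ?_, fun μ => ⟨fun h => ?_, ?_⟩, fun j h => ?_⟩
  · change label j < label i
    rw [lt_iff_le_not_ge, (hlabel j).le_iff (hlabel i), (hlabel i).le_iff (hlabel j), not_le]
    exact ⟨(he hij).le, he hij⟩
  · obtain ⟨r, hr⟩ := h.exists_edgeAt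
    obtain ⟨j, hj⟩ := hrow ((StdTableau.initial μ).adjoin h)
    have h1 := rowWord_adjoin_last (StdTableau.initial μ).1 h hr
    exact ⟨j, (hlabel j).eq_left (hj.trans h1 ▸ hr)⟩
  · rintro ⟨j, rfl⟩
    exact (hlabel j).edge
  · have h1 : op (dCoeff n (F.label j) lam h : Hecke R q (n + 1)) •
        cellVec R q (StdTableau.initial lam) =
        cellVec R q ((StdTableau.initial (F.label j)).adjoin h) :=
      op_T_smul_cellVec_initial ((StdTableau.initial (F.label j)).adjoin h)
    have h2 : cellVec R q ((StdTableau.initial (F.label j)).adjoin h) ∈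
        rowSpan R q lam (P j.succ) := cellVec_mem_rowSpan
      ((hP1 j _).2 (rowWord_adjoin_last (StdTableau.initial (F.label j)).1 h (hlabel j)).ge)
    refine ⟨h1 ▸ h2, ?_⟩
    refine (quotEquiv_mk (hlabel j) (hP1 j) (hP2 j) _).trans ?_
    refine (congrArg (restrictLin R q (hlabel j).edge) h1).trans ?_
    exact restrictLin_cellVec_adjoin (hlabel j).edge _

end Hecke

/-! ### The main theorem -/

theorem mainTheorem11 {R : Type*} [CommRing R] [IsDomain R] (q : Rˣ) :
    -- the Murphy bases are cellular bases; the cell modules below are the resulting ones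
    ∃ hM : ∀ n : ℕ, IsCellDatum R (Hecke.star (R := R) (q := q) (n := n)) Hecke.murphy,
      -- the cell module is generated by the basis element of `t^lam`
      (∀ (n : ℕ) (lam : Shape n), Submodule.span (Hecke R q n)ᵐᵒᵖ
        {CellModule.basis (hM n) lam (StdTableau.initial lam)} = ⊤) ∧
      -- the restricted cell module has an order preserving cell filtration with one subquotient
      -- for each edge `μ → lam`, for which the branching coefficients are `T_{w(t^μ ∪ α)}`
      (∀ (n : ℕ) (lam : Shape (n + 1)),
        ∃ F : CellFiltration (hM n) (ResModule (Hecke.incl n) (CellModule (hM (n + 1)) lam)),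
          F.OrderPreserving ∧
          (∀ μ : Shape n, μ.Edge lam ↔ ∃ j, F.label j = μ) ∧
          (∀ (j : Fin F.len) (h : (F.label j).Edge lam),
            F.IsBranchingCoeff j
              (CellModule.basis (hM (n + 1)) lam (StdTableau.initial lam))
              (CellModule.basis (hM n) (F.label j) (StdTableau.initial (F.label j)))
              (Hecke.dCoeff n (F.label j) lam h))) ∧
      -- explicit form, where `a` is the entry of `t^lam` in the added node `α`
      (∀ (n : ℕ) (μ : Shape n) (lam : Shape (n + 1)) (h : μ.Edge lam) (α : lam.Node),
        α.1 ∉ μ.diagram.cells →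
        ((Tableau.initial μ).adjoin h).perm = descendingCycle (Tableau.initial lam α) ∧
        Hecke.dCoeff (R := R) (q := q) n μ lam h = Hecke.T (descendingCycle (Tableau.initial lam α)) ∧
        Hecke.dCoeff (R := R) (q := q) n μ lam h = Hecke.TT (Tableau.initial lam α) (Fin.last n)) ∧
      -- the path bases are the Murphy bases
      (∀ (n : ℕ) (lam : Shape n) (t : StdTableau lam),
        Hecke.pathProd Hecke.dCoeff n lam t = Hecke.T (R := R) (q := q) t.1.perm ∧
        CellModule.basis (hM n) lam t =
          op (Hecke.pathProd (R := R) (q := q) Hecke.dCoeff n lam t) •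
            CellModule.basis (hM n) lam (StdTableau.initial lam)) ∧
      (∀ (n : ℕ) (lam : Shape n) (s t : StdTableau lam),
        Hecke.murphy (R := R) (q := q) lam s t =
          Hecke.star (Hecke.pathProd Hecke.dCoeff n lam s) * Hecke.m lam *
            Hecke.pathProd Hecke.dCoeff n lam t) := by
  refine ⟨fun n => Hecke.isCellDatum_murphy, fun n lam => Hecke.span_cellVec_initial lam,
    fun n lam => Hecke.exists_cellFiltration lam, fun n μ lam h α hα => ?_,
    fun n lam t => ⟨Hecke.pathProd_dCoeff n lam t, ?_⟩, fun n lam s t => ?_⟩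
  · have h1 := Tableau.perm_adjoin_initial h hα
    rw [Hecke.dCoeff, h1]
    exact ⟨rfl, rfl, Hecke.T_descendingCycle _⟩
  · rw [Hecke.pathProd_dCoeff]
    exact (Hecke.op_T_smul_cellVec_initial t).symm
  · rw [Hecke.pathProd_dCoeff, Hecke.pathProd_dCoeff, Hecke.murphy]
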